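/- **Setting.** Let $\mathcal X$ be a separable metrizable space with its Borel $\sigma$-algebra, and let $\mathcal A$ be a finite set (with the discrete $\sigma$-algebra). Let $\mathbb X=(X_t)_{t\ge 1}$ be a stochastic process on $\mathcal X$. *Learning with online rewards.* A learning rule is a sequence of measurable functions $f_t$, $t\ge1$, possibly randomized through a random seed that is independent of everything else; at time $t$ the learner selects $\hat a_t=f_t(X_1,\dots,X_{t-1},\,r_1,\dots,r_{t-1},\,X_t)\in\mathcal A$, where $r_s=r_s(\hat a_s)\in[0,1]$ is the reward received at time $s$. An online reward mechanism is a sequence of conditional distributions (Markov kernels) $(P_{r\mid a,x_{\le t}})_{t\ge1}$ on $[0,1]$: given $\mathbb X$ (and independently of the learner's seed), the rewards $r_t(a)$, $t\ge 1$, $a\in\mathcal A$, are independent and $r_t(a)$ follows $P_{r\mid a,\mathbb X_{\le t}}$. Let $\mathcal C_{online}$ be the set of processes $\mathbb X$ for which there is a learning rule such that, for every online reward mechanism and every measurable policy $\pi^*:\mathcal X\to\mathcal A$, $$\limsup_{T\to\infty}\frac1T\sum_{t=1}^T\bigl(r_t(\pi^*(X_t))-r_t(\hat a_t)\bigr)\le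 0\qquad\text{almost surely.}$$ *Conditions.* For $i\ge0$ and $k=u2^i+v$ with $u\ge 0$, $0\le v<2^i$, let $T_i^k=\lfloor 2^u(1+v2^{-i})\rfloor$, and let $$\mathcal T^i=\{t\ge1:\ T_i^k\le t<T_i^{k+1}\text{ for some }k\text{, and }X_{t'}\ne X_t\text{ for all }T_i^k\le t'<t\}.$$ For measurable $A\subset\mathcal X$ let $\hat\mu_{\mathbb X^i}(A)=\limsup_{T\to\infty}\frac1T\sum_{t\le T,\,t\in\mathcal T^i}\mathbf 1_A(X_t)$. The process $\mathbb X$ is in $\mathcal C_4$ if $\lim_{i\to\infty}\mathbb E[\hat\mu_{\mathbb X^i}(A_i)]=0$ for every sequence $(A_i)_{i\ge1}$ of pairwise disjoint measurable sets. For $p\ge0$, $\epsilon>0$ and $T\ge1$, let $\delta^p(\epsilon;T)$ be the supremum of all $\delta\in[0,1]$ such that for every measurable $A$ with $\sup_{l\ge0}\mathbb E[\hat\mu_{\mathbb X^l}(A)]\le\delta$ and every finite stopping time $\tau\ge T$ with respect to the filtration generated by $\mathbb X$, $$\mathbb E\Bigl[\frac1{2\tau}\sum_{\tau\le t<2\tau,\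 t\in\mathcal T^p}\mathbf 1_A(X_t)\Bigr]\le\epsilon,$$ with $\sup\emptyset=0$. Let $\delta^p(\epsilon)=\lim_{T\to\infty}\delta^p(\epsilon;T)$. The process $\mathbb X$ is in $\mathcal C_6$ if $\mathbb X\in\mathcal C_4$ and, for every $\epsilon>0$, the limits $\delta^p(\epsilon)$, $p\ge 0$, and $\lim_{p\to\infty}\delta^p(\epsilon)$ exist and $\lim_{p\to\infty}\delta^p(\epsilon)>0$. **Theorem.** If $|\mathcal A|\ge2$, then $\mathcal C_{online}\subset\mathcal C_6$. -/

import Mathlib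

open MeasureTheory ProbabilityTheory Filter Topology

universe u v w z

section Learning

variable {𝒳 : Type u} [MeasurableSpace 𝒳] {𝒜 : Type v} [MeasurableSpace 𝒜]

/-- A (possibly randomized) learning rule: measurable maps `f_t`, `t ≥ 1`, from the past contexts
`x_1, …, x_{t-1}`, the past rewards `r_1, …, r_{t-1}` in `[0,1]` and the current context `x_t` to an
action. The internal randomness of the learner is a random seed, drawn once and available at all
times. (The value at `t = 0` is never used.) -/
structure LearningRule (𝒳 : Type u) [MeasurableSpace 𝒳] (𝒜 : Type v) [MeasurableSpace 𝒜] where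
  Seed : Type w
  [measurableSpaceSeed : MeasurableSpace Seed]
  seedLaw : Measure Seed
  [isProbabilityMeasure_seedLaw : IsProbabilityMeasure seedLaw]
  act : (t : ℕ) →
    Seed × (Finset.Ico 1 t → 𝒳) × (Finset.Ico 1 t → unitInterval) × 𝒳 → 𝒜
  measurable_act : ∀ t, Measurable (act t)

attribute [instance] LearningRule.measurableSpaceSeed LearningRule.isProbabilityMeasure_seedLaw

/-- The action `â_t` selected at time `t`, given the seed `θ`, the contexts `x` and the table `R` of
rewards: `R s a` is the reward `r_s(a)` that is received if action `a` is selected at time `s`. The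
rule only sees the rewards `r_s(â_s)`, `s < t`, of the actions that it selected. -/
noncomputable def LearningRule.action (f : LearningRule.{u, v, w} 𝒳 𝒜) (θ : f.Seed) (x : ℕ → 𝒳)
    (R : ℕ → 𝒜 → unitInterval) (t : ℕ) : 𝒜 :=
  f.act t (θ, fun s => x s, fun s => R s (LearningRule.action f θ x R s), x t)
termination_by t
decreasing_by exact (Finset.mem_Ico.mp s.2).2

/-- An online reward mechanism: conditional distributions `P_{r ∣ a, x_{≤ t}}` on `[0,1]`, `t ≥ 1`,
of the reward at time `t` given the selected action and the contexts up to time `t`. -/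
structure OnlineRewards (𝒳 : Type u) [MeasurableSpace 𝒳] (𝒜 : Type v) [MeasurableSpace 𝒜] where
  condLaw : (t : ℕ) → Kernel (𝒜 × (Finset.Icc 1 t → 𝒳)) unitInterval
  [isMarkovKernel_condLaw : ∀ t, IsMarkovKernel (condLaw t)]

attribute [instance] OnlineRewards.isMarkovKernel_condLaw

/-- Given the whole sequence of contexts `x`, the rewards `r_t(a)` are drawn independently, with
`r_t(a)` following `P_{r ∣ a, x_{≤ t}}`. -/
noncomputable def OnlineRewards.tableLaw (r : OnlineRewards 𝒳 𝒜) (x : ℕ → 𝒳) :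
    Measure (ℕ × 𝒜 → unitInterval) :=
  Measure.infinitePi fun q : ℕ × 𝒜 => r.condLaw q.1 (q.2, fun s => x s)

variable {Ω : Type z} [MeasurableSpace Ω]

/-- Consistency of `f` under the contexts `(X_t)_{t ≥ 1}` and the reward mechanism `r`: almost
surely in the contexts and the seed of the learner (which are independent) and in the rewards
(whose law given the contexts is `r.tableLaw`), the average regret against any measurable
policy has nonpositive limsup. -/
def IsConsistent (P : Measure Ω) (X : ℕ → Ω → 𝒳) (r : OnlineRewards 𝒳 𝒜)
    (f : LearningRule.{u, v, w} 𝒳 𝒜) : Prop :=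
  ∀ π : 𝒳 → 𝒜, Measurable π →
    ∀ᵐ p ∂(P.prod f.seedLaw), ∀ᵐ R ∂(r.tableLaw fun t => X t p.1),
      limsup (fun T : ℕ => (1 / (T : ℝ)) * ∑ t ∈ Finset.Icc 1 T,
        ((R (t, π (X t p.1)) : ℝ) -
          R (t, f.action p.2 (fun s => X s p.1) (fun s a => R (s, a)) t))) atTop ≤ 0

/-- The class of processes that admit universal learning under online rewards: some learning rule
(which may depend on the process) is consistent under every online reward mechanism. -/
def OnlineLearnable (P : Measure Ω) (X : ℕ → Ω → 𝒳) (𝒜 : Type v) [MeasurableSpace 𝒜] : Prop :=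
  ∃ f : LearningRule.{u, v, w} 𝒳 𝒜, ∀ r : OnlineRewards 𝒳 𝒜, IsConsistent P X r f

end Learning

section Conditions

/-- The times `T_i^k = ⌊2^u (1 + v 2^{-i})⌋`, where `k = u 2^i + v` and `0 ≤ v < 2^i`
(the division of natural numbers rounds down). -/
def scaleTime (i k : ℕ) : ℕ := 2 ^ (k / 2 ^ i) * (2 ^ i + k % 2 ^ i) / 2 ^ i

theorem scaleTime_eq_floor (i k : ℕ) :
    scaleTime i k
      = ⌊(2 : ℝ) ^ (k / 2 ^ i) * (1 + ((k % 2 ^ i : ℕ) : ℝ) * ((2 : ℝ) ^ i)⁻¹)⌋₊ := by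
  rw [scaleTime, ← Nat.floor_div_eq_div (K := ℝ)]
  congr 1
  push_cast
  field_simp

variable {𝒳 : Type u}

/-- The set `𝒯^i` of the times `t ≥ 1` at which `x_t` appears for the first time in the period
`[T_i^k, T_i^{k+1})` containing `t`. -/
def firstTimes (i : ℕ) (x : ℕ → 𝒳) : Set ℕ :=
  {t | 1 ≤ t ∧ ∃ k, scaleTime i k ≤ t ∧ t < scaleTime i (k + 1) ∧
    ∀ t', scaleTime i k ≤ t' → t' < t → x t' ≠ x t}

/-- The number of times `t ∈ I ∩ 𝒯^i` such that `x_t ∈ A`. -/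
noncomputable def visits (i : ℕ) (A : Set 𝒳) (x : ℕ → 𝒳) (I : Finset ℕ) : ℝ :=
  ∑ t ∈ I, (firstTimes i x).indicator (fun t => A.indicator (fun _ => (1 : ℝ)) (x t)) t

/-- The limit submeasure of the extended process `(x_t)_{t ∈ 𝒯^i}`. -/
noncomputable def limitSubmeasure (i : ℕ) (x : ℕ → 𝒳) (A : Set 𝒳) : ℝ :=
  limsup (fun T : ℕ => (1 / (T : ℝ)) * visits i A x (Finset.Icc 1 T)) atTop

variable [MeasurableSpace 𝒳] {Ω : Type z} [mΩ : MeasurableSpace Ω]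

/-- Condition C4. -/
def ConditionFour (P : Measure Ω) (X : ℕ → Ω → 𝒳) : Prop :=
  ∀ A : ℕ → Set 𝒳, (∀ i, MeasurableSet (A i)) → Pairwise (Function.onFun Disjoint A) →
    Tendsto (fun i : ℕ => ∫ ω, limitSubmeasure i (fun t => X t ω) (A i) ∂P) atTop (𝓝 0)

/-- The filtration generated by the contexts `(X_t)_{t ≥ 1}`. -/
def contextFiltration (X : ℕ → Ω → 𝒳) (hX : ∀ t, Measurable (X t)) : Filtration ℕ mΩ where
  seq t := ⨆ s ∈ Finset.Icc 1 t, MeasurableSpace.comap (X s) inferInstance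
  mono' _ _ h := biSup_mono fun _ hs => Finset.Icc_subset_Icc_right h hs
  le' _ := iSup₂_le fun s _ => (hX s).comap_le

/-- The quantity `δ^p(ε; T)`. The supremum is over a subset of `[0,1]`; it is `0` if this
subset is empty. -/
noncomputable def deviationLevel (P : Measure Ω) (X : ℕ → Ω → 𝒳) (hX : ∀ t, Measurable (X t))
    (p : ℕ) (ε : ℝ) (T : ℕ) : ℝ :=
  sSup {δ : ℝ | 0 ≤ δ ∧ δ ≤ 1 ∧ ∀ A : Set 𝒳, MeasurableSet A →
    (⨆ l : ℕ, ∫ ω, limitSubmeasure l (fun t => X t ω) A ∂P) ≤ δ →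
    ∀ τ : Ω → ℕ, IsStoppingTime (contextFiltration X hX) (fun ω => (τ ω : WithTop ℕ)) →
      (∀ ω, T ≤ τ ω) →
      ∫ ω, (1 / (2 * (τ ω : ℝ))) *
        visits p A (fun t => X t ω) (Finset.Ico (τ ω) (2 * τ ω)) ∂P ≤ ε}

/-- Condition C6: condition C4 holds and `lim_{p → ∞} lim_{T → ∞} δ^p(ε; T) > 0` for all `ε > 0`
(in particular these limits exist). -/
def ConditionSix (P : Measure Ω) (X : ℕ → Ω → 𝒳) (hX : ∀ t, Measurable (X t)) : Prop :=
  ConditionFour P X ∧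
    ∀ ε : ℝ, 0 < ε → ∃ δ : ℕ → ℝ,
      (∀ p, Tendsto (fun T => deviationLevel P X hX p ε T) atTop (𝓝 (δ p))) ∧
      ∃ δ₀ : ℝ, 0 < δ₀ ∧ Tendsto δ atTop (𝓝 δ₀)

end Conditions

/-!
The proof is by contraposition. If the process violates one of the two conditions, an adversary is
constructed that defeats every learning rule.

*Hard stages.* A stage is a finite piece of the time axis that contains windows `[t₀, 2 t₀)`, which
are started by events known at time `t₀`, and a set `A` of contexts. Both conditions, when violated,
provide infinitely many types of stages, each with arbitrarily late representatives, in which a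
random window sees a constant density of new visits of `A` (`Stage.IsHard`), and for which the sets
of different types hardly overlap in the windows. If `ConditionFour` fails, the sets are disjoint
and the windows are dyadic periods (`exists_isHard_of_limitSubmeasure`); if the deviation levels are
not bounded below, the sets have small limit submeasures and the windows start at stopping times
(`exists_isHard_of_isStoppingTime`). Since the contexts live in a separable metrizable space, a
countable partition into cells separates the relevant contexts with high probability
(`exists_cell`).

*The adversary.* Each cell of each stage carries a fair coin. At the new visits in a window, the
safe action `a₀` yields `3 / 4`, and the risky action `a₁` yields `1` or `0`, as the coin decides. A
coin that is known to be good gains `1 / 4` at each visit, while trying an unknown coin costs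
`3 / 4 - 1 / 2 = 1 / 4` on average. Each window is immortal with probability `1 / 2`. Otherwise it
is mortal, and survives for `n` periods with probability `4⁻ⁿ`; all rewards vanish after its death.
The learner cannot tell the two kinds of windows apart before the death. Given the coins and the
lifetimes, the rewards are deterministic functions of the past contexts, so for each value of this
hidden randomness they form a legitimate online reward mechanism, under which the learner must be
consistent.

*The dichotomy* (`IsolatedWindow.regret_ge`). A cell occurs at most once per period, so a cell that
is explored at age `u` of a mortal window can only be exploited with weight
`∑_{n > u} 4⁻ⁿ = 4⁻ᵘ / 3`, less than the weight `4⁻ᵘ` of its exploration. Hence exploring in mortal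
windows costs regret against the policy that always plays safe, and consistency with this policy
forces the learner to explore very little, at a rate that only depends on the number of periods in
the window. But then it does not know the coins in immortal windows either, and there it has a
constant regret against the policy that plays according to the coins. How little exploration is
needed depends on the scale of the periods, but this constant does not: for each type, the
comparison takes place at a stage that is late enough for the given scale.

*One policy for all types* (`not_onlineLearnable_of_isHard`). From each type one selects a late
stage at which the regret against the safe policy is negligible on average. The coins of these
stages are combined into one measurable policy, with precedence for earlier stages where their sets
overlap. The learner has a constant expected regret against it in the window of every selected
stage, which contradicts consistency by the reverse Fatou lemma, applied over the contexts, the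
seed, and the hidden randomness.

Finally, the deviation levels are monotone in `T`, and antitone in `p` because the periods of scale
`p + 1` refine those of scale `p`. So the limits in `ConditionSix` exist, and they are positive
because the deviation levels are bounded below.
-/

/-! ### Actions of a learning rule -/

section Locality

variable {𝒳 : Type u} [MeasurableSpace 𝒳] {𝒜 : Type v} [MeasurableSpace 𝒜]

/-- The learner only reacts to the rewards it has received: two reward tables that agree along the
trajectory up to time `t` produce the same actions up to time `t`. -/
theorem LearningRule.action_congr (f : LearningRule.{u, v, w} 𝒳 𝒜) (θ : f.Seed) (x : ℕ → 𝒳)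
    {R R' : ℕ → 𝒜 → unitInterval} {t : ℕ}
    (h : ∀ s < t, R s (f.action θ x R s) = R' s (f.action θ x R s)) :
    ∀ s ≤ t, f.action θ x R s = f.action θ x R' s := by
  intro s
  induction s using Nat.strong_induction_on with
  | _ s ih =>
    intro hs
    rw [LearningRule.action, LearningRule.action]
    congr 3
    congr 1
    funext r
    have hr : (r : ℕ) < s := (Finset.mem_Ico.mp r.2).2
    rw [← ih r hr (hr.le.trans hs), h r (hr.trans_le hs)]

theorem LearningRule.measurable_action [MeasurableSingletonClass 𝒜] [Countable 𝒜]
    (f : LearningRule.{u, v, w} 𝒳 𝒜) (t : ℕ) :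
    Measurable fun p : f.Seed × (ℕ → 𝒳) × (ℕ → 𝒜 → unitInterval) =>
      f.action p.1 p.2.1 p.2.2 t := by
  induction t using Nat.strong_induction_on with
  | _ t ih =>
    have : (fun p : f.Seed × (ℕ → 𝒳) × (ℕ → 𝒜 → unitInterval) => f.action p.1 p.2.1 p.2.2 t)
        = fun p => f.act t (p.1, fun s => p.2.1 s,
            fun s => p.2.2 s (f.action p.1 p.2.1 p.2.2 s), p.2.1 t) := by
      funext p
      rw [LearningRule.action]
    rw [this]
    refine (f.measurable_act t).comp ?_
    refine measurable_fst.prodMk (Measurable.prodMk ?_ (Measurable.prodMk ?_ ?_))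
    · exact measurable_pi_lambda _ fun s => (measurable_pi_apply _).comp
        (measurable_fst.comp measurable_snd)
    · refine measurable_pi_lambda _ fun s => ?_
      have hs := ih s (Finset.mem_Ico.mp s.2).2
      have hev : Measurable fun q : (𝒜 → unitInterval) × 𝒜 => q.1 q.2 :=
        measurable_from_prod_countable_left fun a => measurable_pi_apply a
      exact hev.comp (Measurable.prodMk ((measurable_pi_apply _).comp
        (measurable_snd.comp measurable_snd)) hs)
    · exact (measurable_pi_apply _).comp (measurable_fst.comp measurable_snd)

end Locality

/-! ### The hidden randomness of the adversary -/

section Hidden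

/-- The hidden randomness of the adversary: independent uniform variables in `[0,1]`, one for each
pair of a stage and a cell (`Sum.inl (k, q)`), which gives the coin of the cell, and one for each
time (`Sum.inr t₀`), which gives the lifetime of the windows that start at `t₀`. -/
abbrev Hidden : Type := (ℕ × ℕ) ⊕ ℕ → unitInterval

/-- The law of the hidden randomness. -/
noncomputable abbrev hiddenLaw : Measure Hidden :=
  Measure.infinitePi fun _ => (volume : Measure unitInterval)

/-- Resampling one coordinate of an independent identically distributed family preserves its law. -/
theorem measurePreserving_update {ι : Type*} [DecidableEq ι] {E : Type*} [MeasurableSpace E]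
    (ν : Measure E) [IsProbabilityMeasure ν] (i : ι) :
    MeasurePreserving (fun p : (ι → E) × E => Function.update p.1 i p.2)
      ((Measure.infinitePi fun _ : ι => ν).prod ν) (Measure.infinitePi fun _ : ι => ν) := by
  have hm : Measurable fun p : (ι → E) × E => Function.update p.1 i p.2 := by
    refine measurable_pi_lambda _ fun j => ?_
    by_cases hj : j = i
    · subst hj; simpa using measurable_snd
    · simp only [Function.update_of_ne hj]
      exact (measurable_pi_apply j).comp measurable_fst
  refine ⟨hm, ?_⟩
  refine Measure.eq_infinitePi _ fun s t ht => ?_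
  rw [Measure.map_apply hm (MeasurableSet.pi s.countable_toSet fun j _ => ht j)]
  by_cases hi : i ∈ s
  · have : (fun p : (ι → E) × E => Function.update p.1 i p.2) ⁻¹' (Set.pi s t)
        = (Set.pi (s.erase i : Finset ι) t) ×ˢ (t i) := by
      ext p
      simp only [Set.mem_preimage, Set.mem_pi, Finset.mem_coe, Set.mem_prod, Finset.mem_erase]
      constructor
      · intro h
        exact ⟨fun j hj => by simpa [Function.update_of_ne hj.1] using h j hj.2,
          by simpa using h i hi⟩
      · rintro ⟨h1, h2⟩ j hj
        by_cases hji : j = i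
        · subst hji; simpa using h2
        · simpa [Function.update_of_ne hji] using h1 j ⟨hji, hj⟩
    rw [this, Measure.prod_prod, Measure.infinitePi_pi _ fun j _ => ht j,
      Finset.prod_erase_mul _ _ hi]
  · have : (fun p : (ι → E) × E => Function.update p.1 i p.2) ⁻¹' (Set.pi s t)
        = (Set.pi s t) ×ˢ Set.univ := by
      ext p
      simp only [Set.mem_preimage, Set.mem_pi, Finset.mem_coe, Set.mem_prod, Set.mem_univ, and_true]
      refine forall₂_congr fun j hj => ?_
      rw [Function.update_of_ne (fun h : j = i => hi (by simpa [h] using hj))]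
    rw [this, Measure.prod_prod, Measure.infinitePi_pi _ fun j _ => ht j]
    simp

/-- A coordinate of the hidden randomness is independent of every quantity that ignores it. -/
theorem integral_mul_of_update_invariant {i : (ℕ × ℕ) ⊕ ℕ} {φ : unitInterval → ℝ}
    {ψ : Hidden → ℝ} (hφ : Measurable φ) (hψ : Measurable ψ)
    (hinv : ∀ h y, ψ (Function.update h i y) = ψ h) :
    ∫ h, φ (h i) * ψ h ∂hiddenLaw = (∫ y, φ y) * ∫ h, ψ h ∂hiddenLaw := by
  have mp : MeasurePreserving (fun p : Hidden × unitInterval => Function.update p.1 i p.2)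
      (hiddenLaw.prod volume) hiddenLaw := measurePreserving_update volume i
  have hF : Measurable fun h : Hidden => φ (h i) * ψ h :=
    (hφ.comp (measurable_pi_apply i)).mul hψ
  have key := integral_map (μ := hiddenLaw.prod volume) mp.measurable.aemeasurable
    (f := fun h : Hidden => φ (h i) * ψ h) hF.aestronglyMeasurable
  rw [mp.map_eq] at key
  simp only [Function.update_self, hinv] at key
  rw [key, show (fun p : Hidden × unitInterval => φ p.2 * ψ p.1) = fun p => ψ p.1 * φ p.2 from
    funext fun p => mul_comm _ _, integral_prod_mul, mul_comm]

open Classical in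
/-- The indicator of a proposition, as a real number. -/
noncomputable def ind (p : Prop) : ℝ := if p then 1 else 0

theorem ind_of {p : Prop} (h : p) : ind p = 1 := if_pos h

theorem ind_of_not {p : Prop} (h : ¬p) : ind p = 0 := if_neg h

theorem ind_nonneg (p : Prop) : 0 ≤ ind p := by
  by_cases h : p <;> simp [ind, h]

theorem ind_le_one (p : Prop) : ind p ≤ 1 := by
  by_cases h : p <;> simp [ind, h]

theorem ind_mono {p q : Prop} (h : p → q) : ind p ≤ ind q := by
  by_cases hp : p
  · rw [ind_of hp, ind_of (h hp)]
  · rw [ind_of_not hp]; exact ind_nonneg q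

theorem ind_and (p q : Prop) : ind (p ∧ q) = ind p * ind q := by
  by_cases hp : p <;> by_cases hq : q <;> simp [ind, hp, hq]

theorem measurable_ind {α : Type*} [MeasurableSpace α] {p : α → Prop}
    (hp : MeasurableSet {a | p a}) : Measurable fun a => ind (p a) := by
  classical
  exact Measurable.ite hp measurable_const measurable_const

theorem integral_ind {α : Type*} [MeasurableSpace α] (μ : Measure α) {p : α → Prop}
    (hp : MeasurableSet {a | p a}) : ∫ a, ind (p a) ∂μ = μ.real {a | p a} := by
  classical
  rw [← integral_indicator_one hp]
  congr 1

theorem integral_ind_le {c : ℝ} (h0 : 0 ≤ c) (h1 : c ≤ 1) :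
    ∫ y : unitInterval, ind ((y : ℝ) ≤ c) = c := by
  rw [integral_ind _ (measurableSet_le measurable_subtype_coe measurable_const)]
  have : {y : unitInterval | (y : ℝ) ≤ c} = Set.Iic ⟨c, h0, h1⟩ := rfl
  simp [this, Measure.real, unitInterval.volume_Iic, h0]

theorem integral_ind_half_lt : ∫ y : unitInterval, ind (1 / 2 < (y : ℝ)) = 1 / 2 := by
  rw [integral_ind _ (measurableSet_lt measurable_const measurable_subtype_coe)]
  have : {y : unitInterval | 1 / 2 < (y : ℝ)} =
      Set.Ioi ⟨1 / 2, by norm_num, by norm_num⟩ := rfl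
  rw [this, Measure.real, unitInterval.volume_Ioi]
  norm_num

end Hidden

/-! ### Periods and first times -/

section Periods

theorem scaleTime_zero (i : ℕ) : scaleTime i 0 = 1 := by
  simp [scaleTime]

/-- Time doubles, at least, after `2 ^ i` periods of scale `i`. -/
theorem scaleTime_add_two_pow (i k : ℕ) : 2 * scaleTime i k ≤ scaleTime i (k + 2 ^ i) := by
  have hm : 0 < 2 ^ i := by positivity
  simp only [scaleTime, Nat.add_div_right _ hm, Nat.add_mod_right]
  rw [pow_succ, mul_comm (2 ^ (k / 2 ^ i)) 2, mul_assoc]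
  exact Nat.mul_div_le_mul_div_assoc _ _ _

theorem scaleTime_mono (i : ℕ) : Monotone (scaleTime i) := by
  refine monotone_nat_of_le_succ fun k => Nat.div_le_div_right ?_
  have hm : 0 < 2 ^ i := by positivity
  have hk := Nat.mod_lt k hm
  by_cases h : k % 2 ^ i + 1 < 2 ^ i
  · have h1 : (k + 1) % 2 ^ i = k % 2 ^ i + 1 := by
      rw [Nat.add_mod, Nat.mod_eq_of_lt (a := 1) (by omega), Nat.mod_eq_of_lt h]
    have h2 : (k + 1) / 2 ^ i = k / 2 ^ i := by
      rw [Nat.succ_div_of_not_dvd]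
      intro hd
      rw [Nat.dvd_iff_mod_eq_zero] at hd
      omega
    rw [h1, h2]
    exact Nat.mul_le_mul_left _ (by omega)
  · have h0 : k % 2 ^ i + 1 = 2 ^ i := by omega
    have hd : 2 ^ i ∣ k + 1 := by
      refine ⟨k / 2 ^ i + 1, ?_⟩
      have := Nat.div_add_mod k (2 ^ i)
      rw [mul_add]
      omega
    rw [Nat.succ_div_of_dvd hd, Nat.mod_eq_zero_of_dvd hd, pow_succ, add_zero, mul_assoc]
    exact Nat.mul_le_mul_left _ (by omega)

theorem lt_scaleTime_mul (i t : ℕ) : t < scaleTime i (t * 2 ^ i) := by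
  have hm : 0 < 2 ^ i := by positivity
  rw [scaleTime, Nat.mul_div_cancel _ hm, Nat.mul_mod_left, add_zero, Nat.mul_div_cancel _ hm]
  exact Nat.lt_two_pow_self

/-- The index of the period of scale `i` that contains the time `t ≥ 1`. -/
def periodIndex (i t : ℕ) : ℕ := Nat.findGreatest (fun k => scaleTime i k ≤ t) (t * 2 ^ i)

theorem scaleTime_periodIndex_le {i t : ℕ} (ht : 1 ≤ t) : scaleTime i (periodIndex i t) ≤ t :=
  Nat.findGreatest_spec (P := fun k => scaleTime i k ≤ t) (Nat.zero_le _)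
    (by rw [scaleTime_zero]; exact ht)

theorem lt_scaleTime_periodIndex_succ (i t : ℕ) : t < scaleTime i (periodIndex i t + 1) := by
  by_contra! h
  have hle : periodIndex i t + 1 ≤ t * 2 ^ i := by
    by_contra! h'
    exact absurd ((lt_scaleTime_mul i t).trans_le (scaleTime_mono i h'.le)) (not_lt.mpr h)
  exact absurd (Nat.le_findGreatest (P := fun k => scaleTime i k ≤ t) hle h)
    (not_le.mpr (Nat.lt_succ_self _))

theorem le_periodIndex {i t k : ℕ} (h : scaleTime i k ≤ t) : k ≤ periodIndex i t := by
  by_contra! h'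
  exact absurd ((lt_scaleTime_periodIndex_succ i t).trans_le (scaleTime_mono i h'))
    (not_lt.mpr h)

theorem periodIndex_mono {i s t : ℕ} (hs : 1 ≤ s) (hst : s ≤ t) :
    periodIndex i s ≤ periodIndex i t :=
  le_periodIndex ((scaleTime_periodIndex_le hs).trans hst)

/-- A window `[s, 2 s)` meets at most `2 ^ i + 1` periods of scale `i`. -/
theorem periodIndex_le_add {i s t : ℕ} (ht : 1 ≤ t) (hst : t < 2 * s) :
    periodIndex i t ≤ periodIndex i s + 2 ^ i := by
  by_contra! h
  have h1 := lt_scaleTime_periodIndex_succ i s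
  have h2 := scaleTime_add_two_pow i (periodIndex i s + 1)
  have h3 := scaleTime_mono i (show periodIndex i s + 1 + 2 ^ i ≤ periodIndex i t by omega)
  have h4 := scaleTime_periodIndex_le (i := i) ht
  omega

theorem periodIndex_eq {i t k : ℕ} (h1 : scaleTime i k ≤ t) (h2 : t < scaleTime i (k + 1)) :
    periodIndex i t = k := by
  refine le_antisymm ?_ (le_periodIndex h1)
  by_contra! h
  have ht : 1 ≤ t := (scaleTime_zero i ▸ scaleTime_mono i (Nat.zero_le k)).trans h1
  exact absurd (h2.trans_le (scaleTime_mono i h)) (not_lt.mpr (scaleTime_periodIndex_le ht))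

/-- A point has at most one first time in each period. -/
theorem firstTimes_inj {α : Type*} {i : ℕ} {x : ℕ → α} {s t : ℕ} (hs : s ∈ firstTimes i x)
    (ht : t ∈ firstTimes i x) (hx : x s = x t) (hp : periodIndex i s = periodIndex i t) :
    s = t := by
  obtain ⟨-, k, hk1, hk2, hk⟩ := hs
  obtain ⟨-, l, hl1, hl2, hl⟩ := ht
  obtain rfl : k = l := by rw [← periodIndex_eq hk1 hk2, hp, periodIndex_eq hl1 hl2]
  rcases lt_trichotomy s t with h | h | h
  · exact absurd hx (hl s hk1 h)
  · exact h
  · exact absurd hx.symm (hk t hl1 h)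

end Periods

/-! ### Stages and the reward mechanism -/

section Mechanism

section Extend

variable {𝒳 : Type u}

/-- Extends a tuple `(x_s)_{1 ≤ s ≤ t}` to a sequence, by the constant `x₀`. -/
def extendTuple (x₀ : 𝒳) (t : ℕ) (y : Finset.Icc 1 t → 𝒳) (s : ℕ) : 𝒳 :=
  if hs : s ∈ Finset.Icc 1 t then y ⟨s, hs⟩ else x₀

theorem extendTuple_restrict (x₀ : 𝒳) (t : ℕ) (x : ℕ → 𝒳) :
    ∀ s ∈ Finset.Icc 1 t, extendTuple x₀ t (fun s => x s) s = x s := by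
  intro s hs
  simp only [extendTuple, dif_pos hs]

end Extend

/-- A stage of the adversary: on the windows `[t₀, 2 t₀)`, `a ≤ t₀ < b`, that are started by the
contexts, it only uses the contexts in `A` that fall into a new cell of the countable partition
`cell` within their period of scale `p`. Whether a window starts at `t₀` is decided by
`x_1, …, x_{t₀}`. -/
structure Stage (𝒳 : Type u) [MeasurableSpace 𝒳] where
  a : ℕ
  b : ℕ
  p : ℕ
  A : Set 𝒳
  measurableSet_A : MeasurableSet A
  cell : 𝒳 → ℕ
  measurable_cell : Measurable cell
  start : ℕ → Set (ℕ → 𝒳)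
  measurableSet_start : ∀ t, MeasurableSet (start t)
  start_congr : ∀ t (x y : ℕ → 𝒳), (∀ s ∈ Finset.Icc 1 t, x s = y s) →
    (x ∈ start t ↔ y ∈ start t)

variable {𝒳 : Type u} [MeasurableSpace 𝒳]

/-- The time `t` is used by the stage within the window that starts at `t₀`. -/
def Stage.Slot (S : Stage 𝒳) (x : ℕ → 𝒳) (t₀ t : ℕ) : Prop :=
  S.a ≤ t₀ ∧ t₀ < S.b ∧ x ∈ S.start t₀ ∧ t₀ ≤ t ∧ t < 2 * t₀ ∧ x t ∈ S.A ∧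
    t ∈ firstTimes S.p fun s => S.cell (x s)

/-- The number of periods of scale `p` between the start `t₀` of the window and `t`. -/
def Stage.age (S : Stage 𝒳) (t₀ t : ℕ) : ℕ := periodIndex S.p t - periodIndex S.p t₀

/-- A window with hidden variable `y` is still alive after `n` periods: it lives forever if
`y > 1/2`, and otherwise it survives `n` periods with probability `4⁻ⁿ`. The base `4` makes the
total weight `4⁻ᵘ / 3` of the periods after the `u`-th one smaller than the weight of this period.
-/
def Alive (y : unitInterval) (n : ℕ) : Prop := 1 / 2 < (y : ℝ) ∨ (y : ℝ) ≤ 1 / 2 * (1 / 4) ^ n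

theorem Alive.anti {y : unitInterval} {m n : ℕ} (h : Alive y n) (hmn : m ≤ n) : Alive y m := by
  refine h.imp id fun h => h.trans ?_
  have : ((1 : ℝ) / 4) ^ n ≤ (1 / 4) ^ m :=
    pow_le_pow_of_le_one (by norm_num) (by norm_num) hmn
  linarith

variable (𝔖 : ℕ → Stage 𝒳)

/-- The time `t` is used in the window of stage `k` that starts at `t₀`, and this window is alive.
-/
def OpenSlot (h : Hidden) (x : ℕ → 𝒳) (t k t₀ : ℕ) : Prop :=
  (𝔖 k).Slot x t₀ t ∧ Alive (h (Sum.inr t₀)) ((𝔖 k).age t₀ t)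

/-- The fair coin attached to the pair `q` of a stage and a cell shows that the risky action is
good. -/
def Good (h : Hidden) (q : ℕ × ℕ) : Prop := (h (Sum.inl q) : ℝ) ≤ 1 / 2

/-- The reward of the safe action. -/
noncomputable def safeReward : unitInterval := ⟨3 / 4, by norm_num, by norm_num⟩

variable {𝒜 : Type v} (a₀ a₁ : 𝒜)

open Classical in
/-- The rewards given the hidden randomness. At the times used by an alive window, the safe action
`a₀` gives `3 / 4` and the risky action `a₁` gives `1` or `0`, according to the coin of the cell
of the context. All other rewards are zero. -/
noncomputable def reward (h : Hidden) (x : ℕ → 𝒳) (t : ℕ) (c : 𝒜) : unitInterval :=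
  if ∃ k t₀, OpenSlot 𝔖 h x t k t₀ then
    if c = a₀ then safeReward
    else if c = a₁ ∧ ∃ k t₀, OpenSlot 𝔖 h x t k t₀ ∧ Good h (k, (𝔖 k).cell (x t)) then 1 else 0
  else 0

theorem firstTimes_congr {α : Type*} {i t : ℕ} {x y : ℕ → α} (hxy : ∀ s ∈ Finset.Icc 1 t, x s = y s)
    (ht : t ∈ firstTimes i x) : t ∈ firstTimes i y := by
  obtain ⟨h1, k, hk1, hk2, hk⟩ := ht
  refine ⟨h1, k, hk1, hk2, fun t' h' h'' => ?_⟩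
  have h1' : 1 ≤ t' := (scaleTime_zero i ▸ scaleTime_mono i (Nat.zero_le k)).trans h'
  rw [← hxy t' (Finset.mem_Icc.mpr ⟨h1', h''.le⟩), ← hxy t (Finset.mem_Icc.mpr ⟨h1, le_rfl⟩)]
  exact hk t' h' h''

theorem Stage.Slot.one_le {S : Stage 𝒳} {x : ℕ → 𝒳} {t₀ t : ℕ} (h : S.Slot x t₀ t) : 1 ≤ t := by
  have := h.2.2.2.1
  have := h.2.2.2.2.1
  omega

theorem Stage.Slot.congr {S : Stage 𝒳} {x y : ℕ → 𝒳} {t₀ t : ℕ}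
    (hxy : ∀ s ∈ Finset.Icc 1 t, x s = y s) (h : S.Slot x t₀ t) : S.Slot y t₀ t := by
  have h1 := h.one_le
  obtain ⟨ha, hb, hs, h0, h2, hA, hf⟩ := h
  refine ⟨ha, hb, (S.start_congr t₀ x y fun s hs => hxy s ?_).mp hs, h0, h2,
    hxy t (Finset.mem_Icc.mpr ⟨h1, le_rfl⟩) ▸ hA,
    firstTimes_congr (fun s hs => congrArg S.cell (hxy s hs)) hf⟩
  exact Finset.Icc_subset_Icc_right h0 hs

/-- The rewards at time `t` only depend on the contexts up to time `t`. -/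
theorem reward_congr {h : Hidden} {x y : ℕ → 𝒳} {t : ℕ} (hxy : ∀ s ∈ Finset.Icc 1 t, x s = y s)
    (c : 𝒜) : reward 𝔖 a₀ a₁ h x t c = reward 𝔖 a₀ a₁ h y t c := by
  classical
  have hO : ∀ k t₀, OpenSlot 𝔖 h x t k t₀ ↔ OpenSlot 𝔖 h y t k t₀ := fun k t₀ =>
    and_congr_left' ⟨Stage.Slot.congr hxy, Stage.Slot.congr fun s hs => (hxy s hs).symm⟩
  have hG : ∀ k t₀, (OpenSlot 𝔖 h y t k t₀ ∧ Good h (k, (𝔖 k).cell (x t))) ↔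
      (OpenSlot 𝔖 h y t k t₀ ∧ Good h (k, (𝔖 k).cell (y t))) := by
    intro k t₀
    refine and_congr_right fun ho => ?_
    rw [hxy t (Finset.mem_Icc.mpr ⟨ho.1.one_le, le_rfl⟩)]
  exact if_congr (exists₂_congr hO) (if_congr Iff.rfl rfl (if_congr (and_congr_right' <|
    exists₂_congr fun k t₀ => (and_congr_left' (hO k t₀)).trans (hG k t₀)) rfl rfl)) rfl

theorem measurableSet_firstTimes {β : Type*} [MeasurableSpace β] [MeasurableEq β] (i t : ℕ)
    {c : 𝒳 → β} (hc : Measurable c) :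
    MeasurableSet {x : ℕ → 𝒳 | t ∈ firstTimes i fun s => c (x s)} := by
  have hx : ∀ s, Measurable fun x : ℕ → 𝒳 => c (x s) := fun s => hc.comp (measurable_pi_apply s)
  have : {x : ℕ → 𝒳 | t ∈ firstTimes i fun s => c (x s)} = {x | 1 ≤ t} ∩ ⋃ k,
      {x | scaleTime i k ≤ t ∧ t < scaleTime i (k + 1)} ∩ ⋂ t', {x | scaleTime i k ≤ t' → t' < t →
        c (x t') ≠ c (x t)} := by
    ext x
    simp [firstTimes, and_assoc]
  rw [this]
  refine (MeasurableSet.const _).inter (MeasurableSet.iUnion fun k =>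
    (MeasurableSet.const _).inter (MeasurableSet.iInter fun t' => ?_))
  by_cases h : scaleTime i k ≤ t' ∧ t' < t
  · simp only [h.1, h.2, true_imp_iff, ne_eq]
    exact (measurableSet_eq_fun (hx t') (hx t)).compl
  · convert MeasurableSet.univ
    exact Set.eq_univ_of_forall fun x h1 h2 => absurd ⟨h1, h2⟩ h

theorem Stage.measurableSet_slot (S : Stage 𝒳) (t₀ t : ℕ) :
    MeasurableSet {x : ℕ → 𝒳 | S.Slot x t₀ t} := by
  refine (MeasurableSet.const _).inter ((MeasurableSet.const _).inter
    ((S.measurableSet_start t₀).inter ((MeasurableSet.const _).inter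
    ((MeasurableSet.const _).inter (MeasurableSet.inter ?_ ?_)))))
  · exact measurable_pi_apply t S.measurableSet_A
  · exact measurableSet_firstTimes S.p t S.measurable_cell

theorem measurableSet_alive (n : ℕ) : MeasurableSet {y : unitInterval | Alive y n} :=
  (measurableSet_lt measurable_const measurable_subtype_coe).union
    (measurableSet_le measurable_subtype_coe measurable_const)

theorem measurableSet_openSlot (t k t₀ : ℕ) :
    MeasurableSet {p : Hidden × (ℕ → 𝒳) | OpenSlot 𝔖 p.1 p.2 t k t₀} :=
  MeasurableSet.inter (s₁ := Prod.snd ⁻¹' {x | (𝔖 k).Slot x t₀ t})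
    (s₂ := (fun p : Hidden × (ℕ → 𝒳) => p.1 (Sum.inr t₀)) ⁻¹' {y | Alive y ((𝔖 k).age t₀ t)})
    (measurable_snd ((𝔖 k).measurableSet_slot t₀ t))
    (((measurable_pi_apply (Sum.inr t₀)).comp measurable_fst) (measurableSet_alive _))

theorem measurableSet_good {S : Stage 𝒳} (k t : ℕ) :
    MeasurableSet {p : Hidden × (ℕ → 𝒳) | Good p.1 (k, S.cell (p.2 t))} := by
  have : {p : Hidden × (ℕ → 𝒳) | Good p.1 (k, S.cell (p.2 t))} =
      ⋃ q : ℕ, {p | S.cell (p.2 t) = q} ∩ {p | Good p.1 (k, q)} := by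
    ext p; simp
  rw [this]
  refine MeasurableSet.iUnion fun q => MeasurableSet.inter ?_ ?_
  · exact (S.measurable_cell.comp ((measurable_pi_apply t).comp measurable_snd))
      (measurableSet_singleton q)
  · exact measurableSet_le (measurable_subtype_coe.comp
      ((measurable_pi_apply _).comp measurable_fst)) measurable_const

theorem measurable_reward (t : ℕ) (c : 𝒜) :
    Measurable fun p : Hidden × (ℕ → 𝒳) => reward 𝔖 a₀ a₁ p.1 p.2 t c := by
  classical
  have h1 : MeasurableSet {p : Hidden × (ℕ → 𝒳) | ∃ k t₀, OpenSlot 𝔖 p.1 p.2 t k t₀} := by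
    simp only [Set.ofPred_exists]
    exact MeasurableSet.iUnion fun k => MeasurableSet.iUnion fun t₀ =>
      measurableSet_openSlot 𝔖 t k t₀
  have h2 : MeasurableSet {p : Hidden × (ℕ → 𝒳) | c = a₁ ∧ ∃ k t₀, OpenSlot 𝔖 p.1 p.2 t k t₀ ∧
      Good p.1 (k, (𝔖 k).cell (p.2 t))} := by
    have : MeasurableSet {p : Hidden × (ℕ → 𝒳) | ∃ k t₀, OpenSlot 𝔖 p.1 p.2 t k t₀ ∧
        Good p.1 (k, (𝔖 k).cell (p.2 t))} := by
      simp only [Set.ofPred_exists]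
      exact MeasurableSet.iUnion fun k => MeasurableSet.iUnion fun t₀ =>
        (measurableSet_openSlot 𝔖 t k t₀).inter (measurableSet_good k t)
    exact (MeasurableSet.const _).inter this
  unfold reward
  refine Measurable.ite h1 ?_ measurable_const
  by_cases hc : c = a₀
  · simp only [hc, if_true]; exact measurable_const
  · simp only [hc, if_false]; exact Measurable.ite h2 measurable_const measurable_const

theorem measurable_extendTuple (x₀ : 𝒳) (t : ℕ) : Measurable (extendTuple x₀ t) := by
  refine measurable_pi_lambda _ fun s => ?_
  unfold extendTuple
  by_cases hs : s ∈ Finset.Icc 1 t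
  · simp only [hs, dif_pos]; exact measurable_pi_apply _
  · simp only [hs]; exact measurable_const

theorem measurable_table :
    Measurable fun p : Hidden × (ℕ → 𝒳) => reward 𝔖 a₀ a₁ p.1 p.2 :=
  measurable_pi_lambda _ fun t => measurable_pi_lambda _ fun c => measurable_reward 𝔖 a₀ a₁ t c

variable [MeasurableSpace 𝒜]

/-- The regret of the learner up to time `T` against the policy `π`, not normalized. -/
noncomputable def totalRegret (f : LearningRule.{u, v, w} 𝒳 𝒜) (π : 𝒳 → 𝒜) (h : Hidden) (θ : f.Seed)
    (x : ℕ → 𝒳) (T : ℕ) : ℝ :=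
  ∑ t ∈ Finset.Icc 1 T, ((reward 𝔖 a₀ a₁ h x t (π (x t)) : ℝ) -
    reward 𝔖 a₀ a₁ h x t (f.action θ x (reward 𝔖 a₀ a₁ h x) t))

theorem abs_totalRegret_le (f : LearningRule.{u, v, w} 𝒳 𝒜) (π : 𝒳 → 𝒜) (h : Hidden) (θ : f.Seed)
    (x : ℕ → 𝒳) (T : ℕ) : |totalRegret 𝔖 a₀ a₁ f π h θ x T| ≤ T := by
  refine (Finset.abs_sum_le_sum_abs _ _).trans ?_
  refine (Finset.sum_le_card_nsmul _ _ 1 fun t _ => ?_).trans (by simp)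
  rw [abs_le]
  constructor <;> linarith [unitInterval.nonneg (reward 𝔖 a₀ a₁ h x t (π (x t))),
    unitInterval.le_one (reward 𝔖 a₀ a₁ h x t (π (x t))),
    unitInterval.nonneg (reward 𝔖 a₀ a₁ h x t (f.action θ x (reward 𝔖 a₀ a₁ h x) t)),
    unitInterval.le_one (reward 𝔖 a₀ a₁ h x t (f.action θ x (reward 𝔖 a₀ a₁ h x) t))]

variable [MeasurableSingletonClass 𝒜] [Countable 𝒜]

/-- The online reward mechanism for a fixed value of the hidden randomness. Its rewards are
deterministic. They are defined through sequences of contexts, so the tuple of the past contexts is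
extended by a constant `x₀`, which does not matter. -/
noncomputable def mechanism (x₀ : 𝒳) (h : Hidden) : OnlineRewards 𝒳 𝒜 where
  condLaw t := Kernel.deterministic
    (fun q : 𝒜 × (Finset.Icc 1 t → 𝒳) => reward 𝔖 a₀ a₁ h (extendTuple x₀ t q.2) t q.1)
    (measurable_from_prod_countable_right fun c => (measurable_reward 𝔖 a₀ a₁ t c).comp
      (measurable_const.prodMk (measurable_extendTuple x₀ t)))

theorem tableLaw_mechanism (x₀ : 𝒳) (h : Hidden) (x : ℕ → 𝒳) :
    (mechanism 𝔖 a₀ a₁ x₀ h).tableLaw x =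
      Measure.dirac fun q : ℕ × 𝒜 => reward 𝔖 a₀ a₁ h x q.1 q.2 := by
  rw [← Measure.infinitePi_dirac, OnlineRewards.tableLaw]
  congr 1
  funext q
  simp only [mechanism, Kernel.deterministic_apply]
  rw [reward_congr 𝔖 a₀ a₁ (extendTuple_restrict x₀ q.1 x)]

theorem measurable_learnerAction (f : LearningRule.{u, v, w} 𝒳 𝒜) (t : ℕ) :
    Measurable fun p : f.Seed × Hidden × (ℕ → 𝒳) =>
      f.action p.1 p.2.2 (reward 𝔖 a₀ a₁ p.2.1 p.2.2) t :=
  (f.measurable_action t).comp (measurable_fst.prodMk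
    ((measurable_snd.comp measurable_snd).prodMk
      ((measurable_table 𝔖 a₀ a₁).comp measurable_snd)))

theorem measurable_reward_action {α : Type*} [MeasurableSpace α] {H : α → Hidden × (ℕ → 𝒳)}
    (hH : Measurable H) {c : α → 𝒜} (hc : Measurable c) (t : ℕ) :
    Measurable fun p => (reward 𝔖 a₀ a₁ (H p).1 (H p).2 t (c p) : ℝ) := by
  have hev : Measurable fun q : (Hidden × (ℕ → 𝒳)) × 𝒜 =>
      (reward 𝔖 a₀ a₁ q.1.1 q.1.2 t q.2 : ℝ) :=
    measurable_from_prod_countable_left fun c =>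
      measurable_subtype_coe.comp (measurable_reward 𝔖 a₀ a₁ t c)
  exact hev.comp (hH.prodMk hc)

theorem measurable_totalRegret (f : LearningRule.{u, v, w} 𝒳 𝒜) {π : Hidden → 𝒳 → 𝒜}
    (hπ : Measurable fun p : Hidden × 𝒳 => π p.1 p.2) (T : ℕ) :
    Measurable fun p : f.Seed × Hidden × (ℕ → 𝒳) =>
      totalRegret 𝔖 a₀ a₁ f (π p.2.1) p.2.1 p.1 p.2.2 T := by
  refine Finset.measurable_sum _ fun t _ => Measurable.sub ?_ ?_
  · refine measurable_reward_action 𝔖 a₀ a₁ measurable_snd ?_ t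
    exact hπ.comp ((measurable_fst.comp measurable_snd).prodMk
      ((measurable_pi_apply t).comp (measurable_snd.comp measurable_snd)))
  · exact measurable_reward_action 𝔖 a₀ a₁ measurable_snd (measurable_learnerAction 𝔖 a₀ a₁ f t) t

variable {Ω : Type z} [MeasurableSpace Ω]

/-- Consistency under the mechanism, for a fixed value of the hidden randomness: the law of the
reward table is a Dirac measure. -/
theorem eventually_totalRegret_le {P : Measure Ω} {X : ℕ → Ω → 𝒳} {f : LearningRule.{u, v, w} 𝒳 𝒜}
    (x₀ : 𝒳) (h : Hidden) (hf : IsConsistent P X (mechanism 𝔖 a₀ a₁ x₀ h) f) {π : 𝒳 → 𝒜}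
    (hπ : Measurable π) :
    ∀ᵐ p ∂(P.prod f.seedLaw), ∀ η : ℝ, 0 < η → ∀ᶠ T : ℕ in atTop,
      totalRegret 𝔖 a₀ a₁ f π h p.2 (fun t => X t p.1) T ≤ η * T := by
  filter_upwards [hf π hπ] with p hp η hη
  rw [tableLaw_mechanism, ae_dirac_eq] at hp
  have hp' : limsup (fun T : ℕ => (1 / (T : ℝ)) *
      totalRegret 𝔖 a₀ a₁ f π h p.2 (fun t => X t p.1) T) atTop ≤ 0 := hp
  have hbdd : IsBoundedUnder (· ≤ ·) atTop fun T : ℕ => (1 / (T : ℝ)) *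
      totalRegret 𝔖 a₀ a₁ f π h p.2 (fun t => X t p.1) T := by
    refine isBoundedUnder_of ⟨1, fun T => ?_⟩
    rcases Nat.eq_zero_or_pos T with rfl | hT
    · simp
    · have := (abs_le.mp (abs_totalRegret_le 𝔖 a₀ a₁ f π h p.2 (fun t => X t p.1) T)).2
      have hT' : (0 : ℝ) < T := by exact_mod_cast hT
      rw [one_div, inv_mul_le_iff₀ hT']
      linarith
  have := eventually_lt_of_limsup_lt (hp'.trans_lt hη) hbdd
  filter_upwards [this, eventually_gt_atTop 0] with T hT hT0
  have hT' : (0 : ℝ) < T := by exact_mod_cast hT0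
  rw [one_div, inv_mul_lt_iff₀ hT'] at hT
  linarith

end Mechanism

/-! ### Counting repetitions -/

section Combinatorics

/-- If every repetition is caused by an old cell or by a strictly younger first visit of the same
cell, and a cell is visited at most once per age, then the weight of the repetitions is bounded by
the weights of the ages above their causes. -/
theorem sum_repetitions_le {act rep fst : Finset ℕ} {old : Finset ℕ} {q u : ℕ → ℕ} {V : ℕ}
    (hinj : ∀ s ∈ act, ∀ t ∈ act, q s = q t → u s = u t → s = t) (hV : ∀ t ∈ act, u t ≤ V)
    (hrep : rep ⊆ act)
    (hcause : ∀ t ∈ rep, q t ∈ old ∨ ∃ s ∈ fst, q s = q t ∧ u s < u t)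
    {w : ℕ → ℝ} (hw : ∀ n, 0 ≤ w n) :
    ∑ t ∈ rep, w (u t) ≤ old.card * ∑ n ∈ Finset.range (V + 1), w n +
      ∑ s ∈ fst, ∑ n ∈ Finset.Ioc (u s) V, w n := by
  classical
  -- the ages of the visits of one cell are distinct
  have hage : ∀ (c : ℕ) (B : Finset ℕ) (p : ℕ → Prop) [DecidablePred p], (∀ n ≤ V, p n → n ∈ B) →
      ∑ t ∈ act.filter (fun t => q t = c ∧ p (u t)), w (u t) ≤ ∑ n ∈ B, w n := by
    intro c B p _ hB
    rw [← Finset.sum_image (f := w) (g := u)]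
    · refine Finset.sum_le_sum_of_subset_of_nonneg ?_ fun n _ _ => hw n
      intro n hn
      obtain ⟨t, ht, rfl⟩ := Finset.mem_image.mp hn
      obtain ⟨ht, -, hp⟩ := Finset.mem_filter.mp ht
      exact hB _ (hV t ht) hp
    · intro s hs t ht hst
      obtain ⟨hs, hsc, -⟩ := Finset.mem_filter.mp hs
      obtain ⟨ht, htc, -⟩ := Finset.mem_filter.mp ht
      exact hinj s hs t ht (hsc.trans htc.symm) hst
  have hcover : rep ⊆ (old.biUnion fun c => act.filter fun t => q t = c ∧ True) ∪
      fst.biUnion fun s => act.filter fun t => q t = q s ∧ u s < u t := by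
    intro t ht
    rcases hcause t ht with h | ⟨s, hs, hq, hu⟩
    · exact Finset.mem_union_left _ (Finset.mem_biUnion.mpr
        ⟨q t, h, Finset.mem_filter.mpr ⟨hrep ht, rfl, trivial⟩⟩)
    · exact Finset.mem_union_right _ (Finset.mem_biUnion.mpr
        ⟨s, hs, Finset.mem_filter.mpr ⟨hrep ht, hq.symm, hu⟩⟩)
  have hbU : ∀ (I : Finset ℕ) (B : ℕ → Finset ℕ),
      ∑ t ∈ I.biUnion B, w (u t) ≤ ∑ i ∈ I, ∑ t ∈ B i, w (u t) := by
    intro I B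
    induction I using Finset.induction_on with
    | empty => simp
    | insert a I ha ih =>
      rw [Finset.biUnion_insert, Finset.sum_insert ha]
      have := Finset.sum_union_inter (s₁ := B a) (s₂ := I.biUnion B) (f := fun t => w (u t))
      have h0 : 0 ≤ ∑ t ∈ B a ∩ I.biUnion B, w (u t) := Finset.sum_nonneg fun t _ => hw _
      linarith
  calc ∑ t ∈ rep, w (u t)
      ≤ ∑ t ∈ (old.biUnion fun c => act.filter fun t => q t = c ∧ True) ∪
          fst.biUnion fun s => act.filter fun t => q t = q s ∧ u s < u t, w (u t) :=
        Finset.sum_le_sum_of_subset_of_nonneg hcover fun t _ _ => hw _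
    _ ≤ ∑ t ∈ old.biUnion fun c => act.filter fun t => q t = c ∧ True, w (u t) +
          ∑ t ∈ fst.biUnion fun s => act.filter fun t => q t = q s ∧ u s < u t, w (u t) := by
        have h0 := Finset.sum_nonneg (s := (old.biUnion fun c => act.filter fun t =>
          q t = c ∧ True) ∩ fst.biUnion fun s => act.filter fun t => q t = q s ∧ u s < u t)
          (f := fun t => w (u t)) fun t _ => hw _
        have := Finset.sum_union_inter (s₁ := old.biUnion fun c => act.filter fun t =>
          q t = c ∧ True) (s₂ := fst.biUnion fun s => act.filter fun t => q t = q s ∧ u s < u t)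
          (f := fun t => w (u t))
        linarith
    _ ≤ _ := by
        refine add_le_add ((hbU _ _).trans ?_) ((hbU _ _).trans ?_)
        · rw [← nsmul_eq_mul]
          refine Finset.sum_le_card_nsmul _ _ _ fun c _ => hage c _ (fun _ => True) ?_
          intro n hn _
          exact Finset.mem_range.mpr (Nat.lt_succ_of_le hn)
        · refine Finset.sum_le_sum fun s _ => hage (q s) _ (fun n => u s < n) ?_
          intro n hn h
          exact Finset.mem_Ioc.mpr ⟨h, hn⟩

theorem sum_range_quarter_pow_le (n : ℕ) :
    ∑ m ∈ Finset.range n, ((1 : ℝ) / 4) ^ m ≤ 4 / 3 := by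
  have : ∑ m ∈ Finset.range n, ((1 : ℝ) / 4) ^ m = 4 / 3 * (1 - (1 / 4) ^ n) := by
    induction n with
    | zero => simp
    | succ n ih => rw [Finset.sum_range_succ, ih, pow_succ]; ring
  rw [this]
  have : (0 : ℝ) ≤ (1 / 4) ^ n := by positivity
  linarith

theorem sum_Ioc_quarter_pow_le (m n : ℕ) :
    ∑ l ∈ Finset.Ioc m n, ((1 : ℝ) / 4) ^ l ≤ 1 / 3 * (1 / 4) ^ m := by
  rcases le_total n m with h | h
  · rw [Finset.Ioc_eq_empty (by omega), Finset.sum_empty]; positivity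
  have : ∑ l ∈ Finset.Ioc m n, ((1 : ℝ) / 4) ^ l = 1 / 3 * ((1 / 4) ^ m - (1 / 4) ^ n) := by
    induction n, h using Nat.le_induction with
    | base => simp
    | succ n hmn ih => rw [← Finset.insert_Ioc_right_eq_Ioc_add_one hmn,
        Finset.sum_insert (by simp), ih, pow_succ]; ring
  rw [this]
  have : (0 : ℝ) ≤ (1 / 4) ^ n := by positivity
  linarith

end Combinatorics

/-! ### Isolated windows -/

section Window

variable {𝒳 : Type u} [MeasurableSpace 𝒳] (𝔖 : ℕ → Stage 𝒳)

/-- The window of stage `k` that starts at `t₀` is isolated in the sequence `x`: all other slots are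
at times `≤ M < t₀`, or after the end of the window. -/
structure IsolatedWindow (x : ℕ → 𝒳) (k t₀ M : ℕ) : Prop where
  lt : M < t₀
  sep : ∀ k' t' s, (𝔖 k').Slot x t' s → (k' = k ∧ t' = t₀) ∨ s ≤ M ∨ 2 * t₀ < s

open Classical in
/-- The times used in the window that starts at `t₀`. -/
noncomputable def Stage.slots (S : Stage 𝒳) (x : ℕ → 𝒳) (t₀ : ℕ) : Finset ℕ :=
  (Finset.Ico t₀ (2 * t₀)).filter fun t => S.Slot x t₀ t

theorem Stage.mem_slots {S : Stage 𝒳} {x : ℕ → 𝒳} {t₀ t : ℕ} :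
    t ∈ S.slots x t₀ ↔ S.Slot x t₀ t := by
  classical
  rw [Stage.slots, Finset.mem_filter, Finset.mem_Ico]
  exact ⟨fun h => h.2, fun h => ⟨⟨h.2.2.2.1, h.2.2.2.2.1⟩, h⟩⟩

theorem Stage.age_mono {S : Stage 𝒳} {t₀ s t : ℕ} (hs : 1 ≤ s) (hst : s ≤ t) :
    S.age t₀ s ≤ S.age t₀ t :=
  Nat.sub_le_sub_right (periodIndex_mono hs hst) _

theorem Stage.age_le {S : Stage 𝒳} {x : ℕ → 𝒳} {t₀ t : ℕ} (h : S.Slot x t₀ t) :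
    S.age t₀ t ≤ 2 ^ S.p := by
  have := periodIndex_le_add (i := S.p) h.one_le h.2.2.2.2.1
  exact Nat.sub_le_iff_le_add'.mpr this

/-- A cell is used at most once per period of a window. -/
theorem Stage.slot_inj {S : Stage 𝒳} {x : ℕ → 𝒳} {t₀ s t : ℕ} (hs : S.Slot x t₀ s)
    (ht : S.Slot x t₀ t) (hq : S.cell (x s) = S.cell (x t)) (hu : S.age t₀ s = S.age t₀ t) :
    s = t := by
  have h0 : 1 ≤ t₀ := by
    have := hs.2.2.2.2.1
    have := hs.2.2.2.1
    omega
  have h1 := periodIndex_mono (i := S.p) h0 hs.2.2.2.1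
  have h2 := periodIndex_mono (i := S.p) h0 ht.2.2.2.1
  rw [Stage.age, Stage.age] at hu
  exact firstTimes_inj hs.2.2.2.2.2.2 ht.2.2.2.2.2.2 hq (by omega)

variable {𝔖}

theorem IsolatedWindow.slot_eq {x : ℕ → 𝒳} {k t₀ M : ℕ} (hI : IsolatedWindow 𝔖 x k t₀ M)
    {k' t' s : ℕ} (h : (𝔖 k').Slot x t' s) (h1 : M < s) (h2 : s ≤ 2 * t₀) : k' = k ∧ t' = t₀ := by
  rcases hI.sep k' t' s h with h | h | h
  · exact h
  · omega
  · omega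

variable {𝒜 : Type v} {a₀ a₁ : 𝒜}

theorem reward_eq_zero {h : Hidden} {x : ℕ → 𝒳} {t : ℕ} (hn : ∀ k t₀, ¬(𝔖 k).Slot x t₀ t) (c : 𝒜) :
    reward 𝔖 a₀ a₁ h x t c = 0 := by
  classical
  rw [reward, if_neg]
  rintro ⟨k, t₀, ho⟩
  exact hn k t₀ ho.1

open Classical in
/-- The reward at a time used by a window of stage `k` that is alive, if the context is in the
cell `q`. -/
noncomputable def aliveReward (a₀ a₁ : 𝒜) (h : Hidden) (q : ℕ × ℕ) (c : 𝒜) : ℝ :=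
  if c = a₀ then 3 / 4 else if c = a₁ ∧ Good h q then 1 else 0

theorem IsolatedWindow.reward_slot {x : ℕ → 𝒳} {k t₀ M t : ℕ} (hI : IsolatedWindow 𝔖 x k t₀ M)
    (ht : (𝔖 k).Slot x t₀ t) (h : Hidden) (c : 𝒜) :
    (reward 𝔖 a₀ a₁ h x t c : ℝ) = ind (Alive (h (Sum.inr t₀)) ((𝔖 k).age t₀ t)) *
      aliveReward a₀ a₁ h (k, (𝔖 k).cell (x t)) c := by
  classical
  have hu : ∀ k' t', (𝔖 k').Slot x t' t → k' = k ∧ t' = t₀ := fun k' t' hs =>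
    hI.slot_eq hs (hI.lt.trans_le ht.2.2.2.1) ht.2.2.2.2.1.le
  by_cases ha : Alive (h (Sum.inr t₀)) ((𝔖 k).age t₀ t)
  · have ho : ∃ k t₀, OpenSlot 𝔖 h x t k t₀ := ⟨k, t₀, ht, ha⟩
    have hg : (∃ k t₀, OpenSlot 𝔖 h x t k t₀ ∧ Good h (k, (𝔖 k).cell (x t))) ↔
        Good h (k, (𝔖 k).cell (x t)) := by
      constructor
      · rintro ⟨k', t', ho', hg'⟩
        obtain ⟨rfl, rfl⟩ := hu k' t' ho'.1
        exact hg'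
      · exact fun hg => ⟨k, t₀, ⟨ht, ha⟩, hg⟩
    rw [ind_of ha, one_mul, reward, if_pos ho, aliveReward]
    split_ifs <;> simp_all [safeReward]
  · have ho : ¬∃ k t₀, OpenSlot 𝔖 h x t k t₀ := by
      rintro ⟨k', t', ho⟩
      obtain ⟨rfl, rfl⟩ := hu k' t' ho.1
      exact ha ho.2
    rw [ind_of_not ha, reward, if_neg ho]
    simp

/-- Up to a time at which the window is alive, the rewards do not depend on its lifetime. -/
theorem IsolatedWindow.reward_update_inr {x : ℕ → 𝒳} {k t₀ M t : ℕ}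
    (hI : IsolatedWindow 𝔖 x k t₀ M) (ht : (𝔖 k).Slot x t₀ t) {h : Hidden} {y : unitInterval}
    (ha : Alive (h (Sum.inr t₀)) ((𝔖 k).age t₀ t)) (hy : Alive y ((𝔖 k).age t₀ t)) {s : ℕ}
    (hs : s ≤ t) (c : 𝒜) :
    reward 𝔖 a₀ a₁ (Function.update h (Sum.inr t₀) y) x s c = reward 𝔖 a₀ a₁ h x s c := by
  classical
  have hO : ∀ k' t', OpenSlot 𝔖 (Function.update h (Sum.inr t₀) y) x s k' t' ↔
      OpenSlot 𝔖 h x s k' t' := by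
    intro k' t'
    refine and_congr_right fun hsl => ?_
    by_cases htt : t' = t₀
    · subst htt
      have hts : t' ≤ s := hsl.2.2.2.1
      obtain ⟨rfl, -⟩ := hI.slot_eq hsl (hI.lt.trans_le hts) (hs.trans ht.2.2.2.2.1.le)
      rw [Function.update_self]
      have hage := (𝔖 k').age_mono (t₀ := t') hsl.one_le hs
      exact iff_of_true (hy.anti hage) (ha.anti hage)
    · rw [Function.update_of_ne (by simpa using htt)]
  have hG : ∀ q, Good (Function.update h (Sum.inr t₀) y) q ↔ Good h q := by
    intro q
    rw [Good, Good, Function.update_of_ne (by simp)]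
  simp only [reward, hO, hG]

/-- Outside the slots of an isolated window, only the first `M` times contribute. -/
theorem sum_ge_of_slots {x : ℕ → 𝒳} {k t₀ M : ℕ} (hI : IsolatedWindow 𝔖 x k t₀ M) {d : ℕ → ℝ}
    (hd : ∀ t, -1 ≤ d t) (hd0 : ∀ t, (∀ k t₀, ¬(𝔖 k).Slot x t₀ t) → d t = 0) :
    -(M : ℝ) + ∑ t ∈ (𝔖 k).slots x t₀, d t ≤ ∑ t ∈ Finset.Icc 1 (2 * t₀), d t := by
  classical
  have hsub : (𝔖 k).slots x t₀ ⊆ Finset.Icc 1 (2 * t₀) := by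
    intro t ht
    have ht := Stage.mem_slots.mp ht
    exact Finset.mem_Icc.mpr ⟨ht.one_le, ht.2.2.2.2.1.le⟩
  rw [← Finset.sum_sdiff hsub]
  gcongr
  have h1 : ∀ t ∈ Finset.Icc 1 (2 * t₀) \ (𝔖 k).slots x t₀,
      -(if t ∈ Finset.Icc 1 M then (1 : ℝ) else 0) ≤ d t := by
    intro t ht
    rw [Finset.mem_sdiff, Finset.mem_Icc] at ht
    by_cases htM : t ≤ M
    · rw [if_pos (Finset.mem_Icc.mpr ⟨ht.1.1, htM⟩)]
      exact hd t
    · rw [hd0 t]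
      · split_ifs <;> norm_num
      · intro k' t' hs
        obtain ⟨rfl, rfl⟩ := hI.slot_eq hs (by omega) ht.1.2
        exact ht.2 (Stage.mem_slots.mpr hs)
  refine le_trans ?_ (Finset.sum_le_sum h1)
  rw [Finset.sum_neg_distrib, neg_le_neg_iff, ← Finset.sum_filter, Finset.sum_const, nsmul_one]
  have : (Finset.filter (fun t => t ∈ Finset.Icc 1 M)
      (Finset.Icc 1 (2 * t₀) \ (𝔖 k).slots x t₀)).card ≤ (Finset.Icc 1 M).card :=
    Finset.card_le_card fun t ht => (Finset.mem_filter.mp ht).2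
  rw [Nat.card_Icc] at this
  exact_mod_cast this

end Window

/-! ### Explorations and repetitions -/

section Exploration

variable {𝒳 : Type u} [MeasurableSpace 𝒳] (𝔖 : ℕ → Stage 𝒳) {𝒜 : Type v} [MeasurableSpace 𝒜]
  (a₀ a₁ : 𝒜) (f : LearningRule.{u, v, w} 𝒳 𝒜) (θ : f.Seed) (x : ℕ → 𝒳)

/-- The action of the learner at time `t` for the value `h` of the hidden randomness. -/
noncomputable def learnerAction (h : Hidden) (t : ℕ) : 𝒜 :=
  f.action θ x (reward 𝔖 a₀ a₁ h x) t

/-- At time `s` the learner takes the risky action in the cell `q` of stage `k`, and so learns the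
coin of this cell. -/
def Explores (k : ℕ) (h : Hidden) (q s : ℕ) : Prop :=
  (∃ t', OpenSlot 𝔖 h x s k t') ∧ (𝔖 k).cell (x s) = q ∧ learnerAction 𝔖 a₀ a₁ f θ x h s = a₁

/-- At time `t` the learner takes the risky action, without having explored the cell before. -/
def FirstExplores (k : ℕ) (h : Hidden) (t : ℕ) : Prop :=
  learnerAction 𝔖 a₀ a₁ f θ x h t = a₁ ∧
    ∀ s < t, ¬Explores 𝔖 a₀ a₁ f θ x k h ((𝔖 k).cell (x t)) s

/-- At time `t` the learner takes the risky action in a cell that it has explored before. -/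
def Repeats (k : ℕ) (h : Hidden) (t : ℕ) : Prop :=
  learnerAction 𝔖 a₀ a₁ f θ x h t = a₁ ∧
    ∃ s < t, Explores 𝔖 a₀ a₁ f θ x k h ((𝔖 k).cell (x t)) s

variable {𝔖 a₀ a₁ f θ x}

/-- The choice to explore a cell for the first time does not depend on the coin of the cell. -/
theorem FirstExplores.update_inl {k t : ℕ} {h : Hidden} (hF : FirstExplores 𝔖 a₀ a₁ f θ x k h t)
    (y : unitInterval) :
    FirstExplores 𝔖 a₀ a₁ f θ x k (Function.update h (Sum.inl (k, (𝔖 k).cell (x t))) y) t := by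
  classical
  set h' := Function.update h (Sum.inl (k, (𝔖 k).cell (x t))) y with hh'
  have hO : ∀ s k' t', OpenSlot 𝔖 h' x s k' t' ↔ OpenSlot 𝔖 h x s k' t' := by
    intro s k' t'
    rw [OpenSlot, OpenSlot, hh', Function.update_of_ne (by simp)]
  have hact : ∀ s ≤ t, learnerAction 𝔖 a₀ a₁ f θ x h s = learnerAction 𝔖 a₀ a₁ f θ x h' s := by
    refine f.action_congr θ x fun s hs => ?_
    have hne := hF.2 s hs
    simp only [Explores, learnerAction] at hne
    generalize f.action θ x (reward 𝔖 a₀ a₁ h x) s = c at hne ⊢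
    have hG : (c = a₁ ∧ ∃ k t₀, OpenSlot 𝔖 h x s k t₀ ∧ Good h (k, (𝔖 k).cell (x s))) ↔
        (c = a₁ ∧ ∃ k t₀, OpenSlot 𝔖 h x s k t₀ ∧ Good h' (k, (𝔖 k).cell (x s))) := by
      refine and_congr_right fun hc => exists₂_congr fun k' t' => and_congr_right fun ho => ?_
      have : (Sum.inl (k', (𝔖 k').cell (x s)) : (ℕ × ℕ) ⊕ ℕ) ≠
          Sum.inl (k, (𝔖 k).cell (x t)) := by
        intro heq
        obtain ⟨rfl, hcell⟩ := Prod.mk.inj (Sum.inl.inj heq)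
        exact hne ⟨⟨t', ho⟩, hcell, hc⟩
      rw [Good, Good, hh', Function.update_of_ne this]
    simp only [reward, hO, hG]
  refine ⟨(hact t le_rfl).symm.trans hF.1, fun s hs hE => hF.2 s hs ?_⟩
  obtain ⟨⟨t', ho⟩, hc, ha⟩ := hE
  exact ⟨⟨t', (hO s k t').mp ho⟩, hc, (hact s hs.le).trans ha⟩

theorem firstExplores_update_inl {k t : ℕ} {h : Hidden} (y : unitInterval) :
    FirstExplores 𝔖 a₀ a₁ f θ x k (Function.update h (Sum.inl (k, (𝔖 k).cell (x t))) y) t ↔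
      FirstExplores 𝔖 a₀ a₁ f θ x k h t := by
  refine ⟨fun hF => ?_, fun hF => hF.update_inl y⟩
  simpa using hF.update_inl (h (Sum.inl (k, (𝔖 k).cell (x t))))

/-- The hidden randomness `h`, changed so that the window that starts at `t₀` lives forever. -/
noncomputable def immortal (t₀ : ℕ) (h : Hidden) : Hidden := Function.update h (Sum.inr t₀) 1

theorem alive_one (n : ℕ) : Alive 1 n := Or.inl (by norm_num)

theorem immortal_update_inr (t₀ : ℕ) (h : Hidden) (y : unitInterval) :
    immortal t₀ (Function.update h (Sum.inr t₀) y) = immortal t₀ h :=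
  Function.update_idem ..

theorem immortal_update_inl (t₀ : ℕ) (h : Hidden) (q : ℕ × ℕ) (y : unitInterval) :
    immortal t₀ (Function.update h (Sum.inl q) y) = Function.update (immortal t₀ h) (Sum.inl q) y :=
  Function.update_comm (by simp) ..

theorem measurable_immortal (t₀ : ℕ) : Measurable (immortal t₀) := by
  refine measurable_pi_lambda _ fun j => ?_
  by_cases hj : j = Sum.inr t₀
  · subst hj; simp only [immortal, Function.update_self]; exact measurable_const
  · simp only [immortal, Function.update_of_ne hj]; exact measurable_pi_apply j

/-- While a window is alive, the learner behaves as if it were immortal. -/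
theorem IsolatedWindow.learnerAction_immortal {k t₀ M t : ℕ} (hI : IsolatedWindow 𝔖 x k t₀ M)
    (ht : (𝔖 k).Slot x t₀ t) {h : Hidden} (ha : Alive (h (Sum.inr t₀)) ((𝔖 k).age t₀ t)) :
    learnerAction 𝔖 a₀ a₁ f θ x h t = learnerAction 𝔖 a₀ a₁ f θ x (immortal t₀ h) t :=
  f.action_congr θ x (fun _ hs => (hI.reward_update_inr ht ha (alive_one _) hs.le _).symm) t le_rfl

/-- At a slot, the regret factors into the survival of the window and a term that does not depend on
its lifetime. -/
theorem IsolatedWindow.reward_sub {k t₀ M t : ℕ} (hI : IsolatedWindow 𝔖 x k t₀ M)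
    (ht : (𝔖 k).Slot x t₀ t) (h : Hidden) (c : 𝒜) :
    (reward 𝔖 a₀ a₁ h x t c : ℝ) - reward 𝔖 a₀ a₁ h x t (learnerAction 𝔖 a₀ a₁ f θ x h t) =
      ind (Alive (h (Sum.inr t₀)) ((𝔖 k).age t₀ t)) *
        (aliveReward a₀ a₁ h (k, (𝔖 k).cell (x t)) c - aliveReward a₀ a₁ h (k, (𝔖 k).cell (x t))
          (learnerAction 𝔖 a₀ a₁ f θ x (immortal t₀ h) t)) := by
  rw [hI.reward_slot ht, hI.reward_slot ht, ← mul_sub]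
  by_cases ha : Alive (h (Sum.inr t₀)) ((𝔖 k).age t₀ t)
  · rw [hI.learnerAction_immortal ht ha]
  · rw [ind_of_not ha, zero_mul, zero_mul]

theorem repeats_of_not_firstExplores {k t : ℕ} {h : Hidden}
    (ha : learnerAction 𝔖 a₀ a₁ f θ x h t = a₁) (hn : ¬FirstExplores 𝔖 a₀ a₁ f θ x k h t) :
    Repeats 𝔖 a₀ a₁ f θ x k h t := by
  refine ⟨ha, ?_⟩
  by_contra! hs
  exact hn ⟨ha, hs⟩

/-- Within a window, a repetition is caused either by one of the slots before the window, or by the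
first exploration of its cell, which happened in a previous period of the window. -/
theorem IsolatedWindow.cause_of_repeats {k t₀ M t : ℕ} (hI : IsolatedWindow 𝔖 x k t₀ M)
    (ht : (𝔖 k).Slot x t₀ t) {h : Hidden} (hR : Repeats 𝔖 a₀ a₁ f θ x k h t) :
    (𝔖 k).cell (x t) ∈ (Finset.Icc 1 M).image (fun s => (𝔖 k).cell (x s)) ∨
      ∃ s, (𝔖 k).Slot x t₀ s ∧ FirstExplores 𝔖 a₀ a₁ f θ x k h s ∧
        (𝔖 k).cell (x s) = (𝔖 k).cell (x t) ∧ (𝔖 k).age t₀ s < (𝔖 k).age t₀ t := by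
  classical
  have hex : ∃ s, Explores 𝔖 a₀ a₁ f θ x k h ((𝔖 k).cell (x t)) s :=
    let ⟨s, _, hs⟩ := hR.2; ⟨s, hs⟩
  obtain ⟨s, hst, hs⟩ := hR.2
  have hmin := Nat.find_spec hex
  have hle : Nat.find hex < t := (Nat.find_min' hex hs).trans_lt hst
  have hlt : ∀ r < Nat.find hex, ¬Explores 𝔖 a₀ a₁ f θ x k h ((𝔖 k).cell (x t)) r :=
    fun r hr => Nat.find_min hex hr
  generalize Nat.find hex = r at hmin hle hlt
  obtain ⟨⟨t', ho⟩, hcell, ha⟩ := hmin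
  by_cases hrM : r ≤ M
  · exact Or.inl (Finset.mem_image.mpr ⟨r, Finset.mem_Icc.mpr ⟨ho.1.one_le, hrM⟩, hcell⟩)
  · obtain ⟨-, rfl⟩ := hI.slot_eq ho.1 (by omega) (hle.le.trans ht.2.2.2.2.1.le)
    refine Or.inr ⟨r, ho.1, ⟨ha, fun r' hr' => hcell ▸ hlt r' hr'⟩, hcell, ?_⟩
    refine lt_of_le_of_ne (Stage.age_mono ho.1.one_le hle.le) fun hage => ?_
    exact hle.ne (Stage.slot_inj ho.1 ht hcell hage)

/-- The weighted number of repetitions is bounded in terms of the first exploration that caused each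
of them, where cells that may be known from before the window are counted separately. -/
theorem IsolatedWindow.sum_repeats_le {k t₀ M : ℕ} (hI : IsolatedWindow 𝔖 x k t₀ M) (h : Hidden)
    {w : ℕ → ℝ} (hw : ∀ n, 0 ≤ w n) :
    ∑ t ∈ (𝔖 k).slots x t₀, w ((𝔖 k).age t₀ t) * ind (Repeats 𝔖 a₀ a₁ f θ x k h t) ≤
      M * ∑ n ∈ Finset.range (2 ^ (𝔖 k).p + 1), w n +
      ∑ t ∈ (𝔖 k).slots x t₀, ind (FirstExplores 𝔖 a₀ a₁ f θ x k h t) *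
        ∑ n ∈ Finset.Ioc ((𝔖 k).age t₀ t) (2 ^ (𝔖 k).p), w n := by
  classical
  have key := sum_repetitions_le (act := (𝔖 k).slots x t₀)
    (rep := ((𝔖 k).slots x t₀).filter fun t => Repeats 𝔖 a₀ a₁ f θ x k h t)
    (fst := ((𝔖 k).slots x t₀).filter fun t => FirstExplores 𝔖 a₀ a₁ f θ x k h t)
    (old := (Finset.Icc 1 M).image fun s => (𝔖 k).cell (x s))
    (q := fun t => (𝔖 k).cell (x t)) (u := (𝔖 k).age t₀) (V := 2 ^ (𝔖 k).p)
    (fun s hs t ht => Stage.slot_inj (Stage.mem_slots.mp hs) (Stage.mem_slots.mp ht))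
    (fun t ht => Stage.age_le (Stage.mem_slots.mp ht)) (Finset.filter_subset _ _)
    (by
      intro t ht
      obtain ⟨ht, hR⟩ := Finset.mem_filter.mp ht
      refine (hI.cause_of_repeats (Stage.mem_slots.mp ht) hR).imp id ?_
      rintro ⟨s, hs, hF, hq, hu⟩
      exact ⟨s, Finset.mem_filter.mpr ⟨Stage.mem_slots.mpr hs, hF⟩, hq, hu⟩) hw
  simp only [Finset.sum_filter] at key
  simp only [ind, mul_ite, mul_one, mul_zero, ite_mul, one_mul, zero_mul]
  refine key.trans ?_
  gcongr
  · exact Finset.sum_nonneg fun n _ => hw n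
  · have : ((Finset.Icc 1 M).image fun s => (𝔖 k).cell (x s)).card ≤ (Finset.Icc 1 M).card :=
      Finset.card_image_le
    rwa [Nat.card_Icc, Nat.add_sub_cancel] at this

theorem ind_mortal_mul_alive (y : unitInterval) (n : ℕ) :
    ind ((y : ℝ) ≤ 1 / 2) * ind (Alive y n) = ind ((y : ℝ) ≤ 1 / 2 * (1 / 4) ^ n) := by
  rw [← ind_and]
  congr 1
  refine propext ⟨fun h => h.2.resolve_left (not_lt.mpr h.1), fun h => ⟨h.trans ?_, Or.inr h⟩⟩
  have : ((1 : ℝ) / 4) ^ n ≤ 1 := pow_le_one₀ (by norm_num) (by norm_num)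
  linarith

theorem ind_immortal_mul_alive (y : unitInterval) (n : ℕ) :
    ind (1 / 2 < (y : ℝ)) * ind (Alive y n) = ind (1 / 2 < (y : ℝ)) := by
  rw [← ind_and]
  congr 1
  exact propext ⟨fun h => h.1, fun h => ⟨h, Or.inl h⟩⟩

/-- Compared with the safe action, a first exploration is a bet on the coin, and a repetition gains
at most `1 / 4`. -/
theorem aliveReward_safe_sub_ge (hne : a₁ ≠ a₀) {k t : ℕ} (h h' : Hidden) (q : ℕ × ℕ) :
    ind (FirstExplores 𝔖 a₀ a₁ f θ x k h' t) * (3 / 4 - ind (Good h q)) -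
        1 / 4 * ind (Repeats 𝔖 a₀ a₁ f θ x k h' t) ≤
      aliveReward a₀ a₁ h q a₀ - aliveReward a₀ a₁ h q (learnerAction 𝔖 a₀ a₁ f θ x h' t) := by
  classical
  by_cases ha : learnerAction 𝔖 a₀ a₁ f θ x h' t = a₁
  · have h1 : aliveReward a₀ a₁ h q a₁ = ind (Good h q) := by
      simp [aliveReward, ind, hne]
    have h0 : aliveReward a₀ a₁ h q a₀ = 3 / 4 := by simp [aliveReward]
    rw [ha, h0, h1]
    by_cases hF : FirstExplores 𝔖 a₀ a₁ f θ x k h' t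
    · rw [ind_of hF]
      have := ind_nonneg (Repeats 𝔖 a₀ a₁ f θ x k h' t)
      linarith
    · rw [ind_of_not hF, ind_of (repeats_of_not_firstExplores ha hF)]
      have := ind_le_one (Good h q)
      linarith
  · rw [ind_of_not fun hF => ha hF.1,
      ind_of_not (p := Repeats 𝔖 a₀ a₁ f θ x k h' t) fun hR => ha hR.1]
    simp only [aliveReward, ha, false_and, if_false, if_true]
    split_ifs <;> norm_num

/-- Compared with the action that the coin suggests, a learner that does not take the risky action
loses `1 / 4` where the coin is good. The proposition `o` marks the slots at which the action `c`
need not agree with the coin. -/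
theorem aliveReward_sub_ge (hne : a₁ ≠ a₀) {k t : ℕ} (h h' : Hidden) (q : ℕ × ℕ) {c : 𝒜} {o : Prop}
    (hc : ¬o → (Good h q → c = a₁) ∧ (¬Good h q → c = a₀)) :
    1 / 4 * ind (Good h q) - ind o - 1 / 4 * (ind (FirstExplores 𝔖 a₀ a₁ f θ x k h' t) +
        ind (Repeats 𝔖 a₀ a₁ f θ x k h' t)) ≤
      aliveReward a₀ a₁ h q c - aliveReward a₀ a₁ h q (learnerAction 𝔖 a₀ a₁ f θ x h' t) := by
  classical
  have hup : aliveReward a₀ a₁ h q (learnerAction 𝔖 a₀ a₁ f θ x h' t) ≤ 3 / 4 +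
      1 / 4 * (ind (FirstExplores 𝔖 a₀ a₁ f θ x k h' t) +
        ind (Repeats 𝔖 a₀ a₁ f θ x k h' t)) := by
    have hF0 := ind_nonneg (FirstExplores 𝔖 a₀ a₁ f θ x k h' t)
    have hR0 := ind_nonneg (Repeats 𝔖 a₀ a₁ f θ x k h' t)
    by_cases ha : learnerAction 𝔖 a₀ a₁ f θ x h' t = a₁
    · have h1 : aliveReward a₀ a₁ h q (learnerAction 𝔖 a₀ a₁ f θ x h' t) ≤ 1 := by
        rw [aliveReward]; split_ifs <;> norm_num
      by_cases hF : FirstExplores 𝔖 a₀ a₁ f θ x k h' t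
      · rw [ind_of hF]; linarith
      · rw [ind_of (repeats_of_not_firstExplores ha hF)]; linarith
    · have h1 : aliveReward a₀ a₁ h q (learnerAction 𝔖 a₀ a₁ f θ x h' t) ≤ 3 / 4 := by
        simp only [aliveReward, ha, false_and, if_false]; split_ifs <;> norm_num
      linarith
  have hlow : 3 / 4 + 1 / 4 * ind (Good h q) - ind o ≤ aliveReward a₀ a₁ h q c := by
    by_cases ho : o
    · have h0 : 0 ≤ aliveReward a₀ a₁ h q c := by
        rw [aliveReward]; split_ifs <;> norm_num
      rw [ind_of ho]
      have := ind_le_one (Good h q)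
      linarith
    · by_cases hg : Good h q
      · rw [(hc ho).1 hg, ind_of hg, ind_of_not ho]
        simp [aliveReward, hne, hg]; norm_num
      · rw [(hc ho).2 hg, ind_of_not hg, ind_of_not ho]
        simp [aliveReward]
  linarith

end Exploration

section Integrals

variable {𝒳 : Type u} [MeasurableSpace 𝒳] {𝔖 : ℕ → Stage 𝒳} {𝒜 : Type v} [MeasurableSpace 𝒜]
  [MeasurableSingletonClass 𝒜] [Countable 𝒜]
  {a₀ a₁ : 𝒜} {f : LearningRule.{u, v, w} 𝒳 𝒜} {θ : f.Seed} {x : ℕ → 𝒳}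

theorem measurable_learnerAction_hidden (t : ℕ) :
    Measurable fun h => learnerAction 𝔖 a₀ a₁ f θ x h t :=
  (measurable_learnerAction 𝔖 a₀ a₁ f t).comp
    (measurable_const.prodMk (measurable_id.prodMk measurable_const))

theorem measurableSet_explores (k q s : ℕ) :
    MeasurableSet {h | Explores 𝔖 a₀ a₁ f θ x k h q s} := by
  have h1 : MeasurableSet {h | ∃ t', OpenSlot 𝔖 h x s k t'} := by
    rw [Set.ofPred_exists]
    exact MeasurableSet.iUnion fun t' => (measurableSet_openSlot 𝔖 s k t').preimage
      (measurable_id.prodMk measurable_const)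
  exact h1.inter ((MeasurableSet.const _).inter
    ((measurable_learnerAction_hidden s) (measurableSet_singleton a₁)))

theorem measurableSet_firstExplores (k t : ℕ) :
    MeasurableSet {h | FirstExplores 𝔖 a₀ a₁ f θ x k h t} := by
  have : {h | FirstExplores 𝔖 a₀ a₁ f θ x k h t} = {h | learnerAction 𝔖 a₀ a₁ f θ x h t = a₁} ∩
      ⋂ s, ⋂ _ : s < t, {h | Explores 𝔖 a₀ a₁ f θ x k h ((𝔖 k).cell (x t)) s}ᶜ := by
    ext h; simp [FirstExplores]
  rw [this]
  exact ((measurable_learnerAction_hidden t) (measurableSet_singleton a₁)).inter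
    (MeasurableSet.iInter fun s => MeasurableSet.iInter fun _ =>
      (measurableSet_explores _ _ _).compl)

theorem measurableSet_repeats (k t : ℕ) :
    MeasurableSet {h | Repeats 𝔖 a₀ a₁ f θ x k h t} := by
  have : {h | Repeats 𝔖 a₀ a₁ f θ x k h t} = {h | learnerAction 𝔖 a₀ a₁ f θ x h t = a₁} ∩
      ⋃ s, ⋃ _ : s < t, {h | Explores 𝔖 a₀ a₁ f θ x k h ((𝔖 k).cell (x t)) s} := by
    ext h; simp [Repeats]
  rw [this]
  exact ((measurable_learnerAction_hidden t) (measurableSet_singleton a₁)).inter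
    (MeasurableSet.iUnion fun s => MeasurableSet.iUnion fun _ => measurableSet_explores _ _ _)

theorem measurableSet_good_hidden (q : ℕ × ℕ) : MeasurableSet {h | Good h q} :=
  measurableSet_le (measurable_subtype_coe.comp (measurable_pi_apply _)) measurable_const

end Integrals

/-! ### The dichotomy for a single window -/

section WindowEstimate

theorem integrable_of_abs_le {α : Type*} [MeasurableSpace α] {μ : Measure α} [IsFiniteMeasure μ]
    {g : α → ℝ} (hg : Measurable g) (C : ℝ) (hC : ∀ a, |g a| ≤ C) : Integrable g μ :=
  Integrable.of_bound hg.aestronglyMeasurable C (Eventually.of_forall hC)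

theorem abs_ind_le (p : Prop) : |ind p| ≤ 1 := by
  rw [abs_of_nonneg (ind_nonneg p)]; exact ind_le_one p

theorem integrable_ind {α : Type*} [MeasurableSpace α] {μ : Measure α} [IsFiniteMeasure μ]
    {p : α → Prop} (hp : MeasurableSet {a | p a}) : Integrable (fun a => ind (p a)) μ :=
  integrable_of_abs_le (measurable_ind hp) 1 fun _ => abs_ind_le _

variable {𝒳 : Type u} [MeasurableSpace 𝒳] {𝔖 : ℕ → Stage 𝒳} {𝒜 : Type v} [MeasurableSpace 𝒜]
  {a₀ a₁ : 𝒜} {f : LearningRule.{u, v, w} 𝒳 𝒜} {θ : f.Seed} {x : ℕ → 𝒳}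

/-- The probability that the slot `t` of the window that starts at `t₀` is a first exploration,
when the window is immortal. -/
noncomputable def firstProb (𝔖 : ℕ → Stage 𝒳) (a₀ a₁ : 𝒜) (f : LearningRule.{u, v, w} 𝒳 𝒜)
    (θ : f.Seed) (x : ℕ → 𝒳) (k t₀ t : ℕ) : ℝ :=
  ∫ h, ind (FirstExplores 𝔖 a₀ a₁ f θ x k (immortal t₀ h) t) ∂hiddenLaw

/-- The probability that the slot `t` of the window that starts at `t₀` is a repetition, when the
window is immortal. -/
noncomputable def repeatProb (𝔖 : ℕ → Stage 𝒳) (a₀ a₁ : 𝒜) (f : LearningRule.{u, v, w} 𝒳 𝒜)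
    (θ : f.Seed) (x : ℕ → 𝒳) (k t₀ t : ℕ) : ℝ :=
  ∫ h, ind (Repeats 𝔖 a₀ a₁ f θ x k (immortal t₀ h) t) ∂hiddenLaw

theorem firstProb_nonneg (k t₀ t : ℕ) : 0 ≤ firstProb 𝔖 a₀ a₁ f θ x k t₀ t :=
  integral_nonneg fun _ => ind_nonneg _

/-- The regret at the end of an isolated window is the regret in its slots, up to the `M` times
before the window. -/
theorem totalRegret_ge {k t₀ M : ℕ} (hI : IsolatedWindow 𝔖 x k t₀ M) (π : 𝒳 → 𝒜) (h : Hidden) :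
    -(M : ℝ) + ∑ t ∈ (𝔖 k).slots x t₀, ind (Alive (h (Sum.inr t₀)) ((𝔖 k).age t₀ t)) *
        (aliveReward a₀ a₁ h (k, (𝔖 k).cell (x t)) (π (x t)) -
          aliveReward a₀ a₁ h (k, (𝔖 k).cell (x t))
          (learnerAction 𝔖 a₀ a₁ f θ x (immortal t₀ h) t)) ≤
      totalRegret 𝔖 a₀ a₁ f π h θ x (2 * t₀) := by
  have := sum_ge_of_slots hI (d := fun t => (reward 𝔖 a₀ a₁ h x t (π (x t)) : ℝ) -
    reward 𝔖 a₀ a₁ h x t (learnerAction 𝔖 a₀ a₁ f θ x h t)) ?_ ?_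
  · refine le_trans (le_of_eq ?_) this
    congr 1
    exact Finset.sum_congr rfl fun t ht => (hI.reward_sub (Stage.mem_slots.mp ht) h _).symm
  · intro t
    have := unitInterval.nonneg (reward 𝔖 a₀ a₁ h x t (π (x t)))
    have := unitInterval.le_one (reward 𝔖 a₀ a₁ h x t (learnerAction 𝔖 a₀ a₁ f θ x h t))
    linarith
  · intro t ht
    simp [reward_eq_zero ht]

variable [MeasurableSingletonClass 𝒜] [Countable 𝒜]

theorem measurable_totalRegret_hidden {π : Hidden → 𝒳 → 𝒜}
    (hπ : Measurable fun p : Hidden × 𝒳 => π p.1 p.2) (T : ℕ) :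
    Measurable fun h => totalRegret 𝔖 a₀ a₁ f (π h) h θ x T :=
  (measurable_totalRegret 𝔖 a₀ a₁ f hπ T).comp
    (measurable_const.prodMk (measurable_id.prodMk measurable_const))

theorem measurableSet_firstExplores_immortal (k t₀ t : ℕ) :
    MeasurableSet {h | FirstExplores 𝔖 a₀ a₁ f θ x k (immortal t₀ h) t} :=
  (measurableSet_firstExplores k t).preimage (measurable_immortal t₀)

theorem measurableSet_repeats_immortal (k t₀ t : ℕ) :
    MeasurableSet {h | Repeats 𝔖 a₀ a₁ f θ x k (immortal t₀ h) t} :=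
  (measurableSet_repeats k t).preimage (measurable_immortal t₀)

/-- A first exploration is a fair bet on a coin, so it loses `3 / 4 - 1 / 2` on average. -/
theorem integral_first_mul_good (k t₀ t : ℕ) :
    ∫ h, ind (FirstExplores 𝔖 a₀ a₁ f θ x k (immortal t₀ h) t) *
      (3 / 4 - ind (Good h (k, (𝔖 k).cell (x t)))) ∂hiddenLaw =
      1 / 4 * firstProb 𝔖 a₀ a₁ f θ x k t₀ t := by
  have hm : MeasurableSet {y : unitInterval | (y : ℝ) ≤ 1 / 2} :=
    measurableSet_le measurable_subtype_coe measurable_const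
  have := integral_mul_of_update_invariant (i := Sum.inl (k, (𝔖 k).cell (x t)))
    (φ := fun y => 3 / 4 - ind ((y : ℝ) ≤ 1 / 2))
    (ψ := fun h => ind (FirstExplores 𝔖 a₀ a₁ f θ x k (immortal t₀ h) t))
    (measurable_const.sub (measurable_ind hm))
    (measurable_ind (measurableSet_firstExplores_immortal k t₀ t)) (by
      intro h y
      rw [immortal_update_inl, firstExplores_update_inl])
  rw [firstProb]
  convert this using 2
  · funext h; rw [mul_comm]; rfl
  · rw [integral_sub (integrable_const _) (integrable_ind hm), integral_ind_le] <;> norm_num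

theorem integral_good (q : ℕ × ℕ) : ∫ h, ind (Good h q) ∂hiddenLaw = 1 / 2 := by
  have hm : MeasurableSet {y : unitInterval | (y : ℝ) ≤ 1 / 2} :=
    measurableSet_le measurable_subtype_coe measurable_const
  have := integral_mul_of_update_invariant (i := Sum.inl q)
    (φ := fun y => ind ((y : ℝ) ≤ 1 / 2)) (ψ := fun _ => 1)
    (measurable_ind hm) measurable_const (fun _ _ => rfl)
  rw [integral_ind_le (by norm_num) (by norm_num)] at this
  simp only [mul_one, integral_const, probReal_univ, smul_eq_mul] at this
  exact this

/-- If `g` is bounded below, on the event given by `φ`, by a sum of quantities that are independent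
of the lifetime of the window, then its integral is bounded below accordingly. -/
theorem integral_mul_ge {i : (ℕ × ℕ) ⊕ ℕ} {M : ℕ} {φ₀ : unitInterval → ℝ} {J : Finset ℕ}
    {φ : ℕ → unitInterval → ℝ} {ψ : ℕ → Hidden → ℝ} {g : Hidden → ℝ}
    (hφ : ∀ t, Measurable (φ t)) (hφ1 : ∀ t y, |φ t y| ≤ 1)
    (hψ : ∀ t, Measurable (ψ t)) (hψ1 : ∀ t h, |ψ t h| ≤ 2)
    (hinv : ∀ t h y, ψ t (Function.update h i y) = ψ t h)
    (hg : Integrable (fun h => φ₀ (h i) * g h) hiddenLaw)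
    (hle : ∀ h, -(M : ℝ) + ∑ t ∈ J, φ t (h i) * ψ t h ≤ φ₀ (h i) * g h) :
    -(M : ℝ) + ∑ t ∈ J, (∫ y, φ t y) * ∫ h, ψ t h ∂hiddenLaw ≤
      ∫ h, φ₀ (h i) * g h ∂hiddenLaw := by
  have hint : ∀ t, Integrable (fun h => φ t (h i) * ψ t h) hiddenLaw := fun t =>
    integrable_of_abs_le (((hφ t).comp (measurable_pi_apply i)).mul (hψ t)) 2 fun h => by
      rw [abs_mul]
      nlinarith [hφ1 t (h i), hψ1 t h, abs_nonneg (φ t (h i)), abs_nonneg (ψ t h)]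
  refine le_trans (le_of_eq ?_) (integral_mono ((integrable_const (-(M : ℝ))).add
    (integrable_finsetSum J fun t _ => hint t)) hg hle)
  simp only [Pi.add_apply]
  rw [integral_add (integrable_const _) (integrable_finsetSum J fun t _ => hint t),
    integral_finsetSum J fun t _ => hint t]
  simp only [integral_const, probReal_univ, one_smul]
  congr 1
  exact Finset.sum_congr rfl fun t _ =>
    (integral_mul_of_update_invariant (hφ t) (hψ t) (hinv t)).symm

theorem integrable_ind_mul_totalRegret {π : Hidden → 𝒳 → 𝒜}
    (hπ : Measurable fun p : Hidden × 𝒳 => π p.1 p.2) (T : ℕ) {i : (ℕ × ℕ) ⊕ ℕ}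
    {p : unitInterval → Prop} (hp : MeasurableSet {y | p y}) :
    Integrable (fun h => ind (p (h i)) * totalRegret 𝔖 a₀ a₁ f (π h) h θ x T) hiddenLaw := by
  refine integrable_of_abs_le (((measurable_ind hp).comp (measurable_pi_apply i)).mul
    (measurable_totalRegret_hidden hπ T)) T fun h => ?_
  rw [abs_mul]
  exact (mul_le_mul (abs_ind_le _) (abs_totalRegret_le ..) (abs_nonneg _) zero_le_one).trans_eq
    (one_mul _)

/-- The regret against the safe action on the event that the window is mortal. Exploring costs more
than it can earn before the window dies. -/
theorem IsolatedWindow.mortal_regret_ge (hne : a₁ ≠ a₀) {k t₀ M : ℕ}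
    (hI : IsolatedWindow 𝔖 x k t₀ M) :
    -(M : ℝ) + ∑ t ∈ (𝔖 k).slots x t₀, 1 / 2 * (1 / 4) ^ ((𝔖 k).age t₀ t) *
        (1 / 4 * firstProb 𝔖 a₀ a₁ f θ x k t₀ t - 1 / 4 * repeatProb 𝔖 a₀ a₁ f θ x k t₀ t) ≤
      ∫ h, ind ((h (Sum.inr t₀) : ℝ) ≤ 1 / 2) *
        totalRegret 𝔖 a₀ a₁ f (fun _ => a₀) h θ x (2 * t₀) ∂hiddenLaw := by
  have hmle : ∀ c : ℝ, MeasurableSet {y : unitInterval | (y : ℝ) ≤ c} := fun c =>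
    measurableSet_le measurable_subtype_coe measurable_const
  have hF := fun t => measurable_ind (measurableSet_firstExplores_immortal
    (𝔖 := 𝔖) (a₀ := a₀) (a₁ := a₁) (f := f) (θ := θ) (x := x) k t₀ t)
  have hR := fun t => measurable_ind (measurableSet_repeats_immortal
    (𝔖 := 𝔖) (a₀ := a₀) (a₁ := a₁) (f := f) (θ := θ) (x := x) k t₀ t)
  have hG := fun t => measurable_ind (measurableSet_good_hidden (k, (𝔖 k).cell (x t)))
  have key := integral_mul_ge (i := Sum.inr t₀) (M := M) (J := (𝔖 k).slots x t₀)
    (φ₀ := fun y => ind ((y : ℝ) ≤ 1 / 2))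
    (φ := fun t y => ind ((y : ℝ) ≤ 1 / 2 * (1 / 4) ^ ((𝔖 k).age t₀ t)))
    (ψ := fun t h => ind (FirstExplores 𝔖 a₀ a₁ f θ x k (immortal t₀ h) t) *
      (3 / 4 - ind (Good h (k, (𝔖 k).cell (x t)))) -
      1 / 4 * ind (Repeats 𝔖 a₀ a₁ f θ x k (immortal t₀ h) t))
    (g := fun h => totalRegret 𝔖 a₀ a₁ f (fun _ => a₀) h θ x (2 * t₀))
    (fun t => measurable_ind (hmle _)) (fun t y => abs_ind_le _)
    (fun t => ((hF t).mul (measurable_const.sub (hG t))).sub (measurable_const.mul (hR t)))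
    ?_ ?_ (integrable_ind_mul_totalRegret (π := fun _ _ => a₀) measurable_const _ (hmle _)) ?_
  · refine le_trans (le_of_eq ?_) key
    congr 1
    refine Finset.sum_congr rfl fun t _ => ?_
    have h4 : ((1 : ℝ) / 4) ^ ((𝔖 k).age t₀ t) ≤ 1 := pow_le_one₀ (by norm_num) (by norm_num)
    have h4' : (0 : ℝ) ≤ (1 / 4) ^ ((𝔖 k).age t₀ t) := by positivity
    rw [integral_ind_le (by linarith) (by linarith), integral_sub, integral_first_mul_good,
      integral_const_mul, repeatProb]
    · refine integrable_of_abs_le ((hF t).mul (measurable_const.sub (hG t))) 1 fun h => ?_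
      rw [abs_mul]
      refine (mul_le_mul (abs_ind_le _) (b := _) (d := 1) ?_ (abs_nonneg _) zero_le_one).trans_eq
        (one_mul _)
      rw [abs_le]
      constructor <;> linarith [ind_nonneg (Good h (k, (𝔖 k).cell (x t))),
        ind_le_one (Good h (k, (𝔖 k).cell (x t)))]
    · exact (integrable_ind (measurableSet_repeats_immortal k t₀ t)).const_mul _
  · intro t h
    have h1 := ind_nonneg (FirstExplores 𝔖 a₀ a₁ f θ x k (immortal t₀ h) t)
    have h2 := ind_le_one (FirstExplores 𝔖 a₀ a₁ f θ x k (immortal t₀ h) t)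
    have h3 := ind_nonneg (Good h (k, (𝔖 k).cell (x t)))
    have h4 := ind_le_one (Good h (k, (𝔖 k).cell (x t)))
    have h5 := ind_nonneg (Repeats 𝔖 a₀ a₁ f θ x k (immortal t₀ h) t)
    have h6 := ind_le_one (Repeats 𝔖 a₀ a₁ f θ x k (immortal t₀ h) t)
    rw [abs_le]
    constructor <;> nlinarith
  · intro t h y
    have : Good (Function.update h (Sum.inr t₀) y) (k, (𝔖 k).cell (x t)) ↔
        Good h (k, (𝔖 k).cell (x t)) := by
      rw [Good, Good, Function.update_of_ne (by simp)]
    simp only [immortal_update_inr, this]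
  · intro h
    have hreg := totalRegret_ge (a₀ := a₀) (a₁ := a₁) (f := f) (θ := θ) hI (fun _ => a₀) h
    have h0 := ind_nonneg ((h (Sum.inr t₀) : ℝ) ≤ 1 / 2)
    have h1 := ind_le_one ((h (Sum.inr t₀) : ℝ) ≤ 1 / 2)
    refine le_trans ?_ (mul_le_mul_of_nonneg_left hreg h0)
    rw [mul_add, Finset.mul_sum]
    refine add_le_add (by nlinarith [(Nat.cast_nonneg M : (0 : ℝ) ≤ M)]) ?_
    refine Finset.sum_le_sum fun t _ => ?_
    rw [← mul_assoc, ind_mortal_mul_alive]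
    exact mul_le_mul_of_nonneg_left (aliveReward_safe_sub_ge hne _ _ _) (ind_nonneg _)

/-- The regret against a policy that knows the coins, on the event that the window is immortal. -/
theorem IsolatedWindow.immortal_regret_ge (hne : a₁ ≠ a₀) {k t₀ M : ℕ}
    (hI : IsolatedWindow 𝔖 x k t₀ M) {π : Hidden → 𝒳 → 𝒜}
    (hπ : Measurable fun p : Hidden × 𝒳 => π p.1 p.2) {o : ℕ → Prop}
    (ho : ∀ h, ∀ t ∈ (𝔖 k).slots x t₀, ¬o t → (Good h (k, (𝔖 k).cell (x t)) → π h (x t) = a₁) ∧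
      (¬Good h (k, (𝔖 k).cell (x t)) → π h (x t) = a₀)) :
    -(M : ℝ) + ∑ t ∈ (𝔖 k).slots x t₀, 1 / 2 * (1 / 8 - ind (o t) -
        1 / 4 * (firstProb 𝔖 a₀ a₁ f θ x k t₀ t + repeatProb 𝔖 a₀ a₁ f θ x k t₀ t)) ≤
      ∫ h, ind (1 / 2 < (h (Sum.inr t₀) : ℝ)) *
        totalRegret 𝔖 a₀ a₁ f (π h) h θ x (2 * t₀) ∂hiddenLaw := by
  have hmlt : MeasurableSet {y : unitInterval | 1 / 2 < (y : ℝ)} :=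
    measurableSet_lt measurable_const measurable_subtype_coe
  have hF := fun t => measurableSet_firstExplores_immortal
    (𝔖 := 𝔖) (a₀ := a₀) (a₁ := a₁) (f := f) (θ := θ) (x := x) k t₀ t
  have hR := fun t => measurableSet_repeats_immortal
    (𝔖 := 𝔖) (a₀ := a₀) (a₁ := a₁) (f := f) (θ := θ) (x := x) k t₀ t
  have hG := fun t => measurableSet_good_hidden (k, (𝔖 k).cell (x t))
  have key := integral_mul_ge (i := Sum.inr t₀) (M := M) (J := (𝔖 k).slots x t₀)
    (φ₀ := fun y => ind (1 / 2 < (y : ℝ))) (φ := fun t y => ind (1 / 2 < (y : ℝ)))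
    (ψ := fun t h => 1 / 4 * ind (Good h (k, (𝔖 k).cell (x t))) - ind (o t) -
      1 / 4 * (ind (FirstExplores 𝔖 a₀ a₁ f θ x k (immortal t₀ h) t) +
        ind (Repeats 𝔖 a₀ a₁ f θ x k (immortal t₀ h) t)))
    (g := fun h => totalRegret 𝔖 a₀ a₁ f (π h) h θ x (2 * t₀))
    (fun t => measurable_ind hmlt) (fun t y => abs_ind_le _)
    (fun t => ((measurable_const.mul (measurable_ind (hG t))).sub measurable_const).sub
      (measurable_const.mul ((measurable_ind (hF t)).add (measurable_ind (hR t)))))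
    ?_ ?_ (integrable_ind_mul_totalRegret hπ _ hmlt) ?_
  · refine le_trans (le_of_eq ?_) key
    congr 1
    refine Finset.sum_congr rfl fun t _ => ?_
    rw [integral_ind_half_lt, integral_sub, integral_sub, integral_const_mul, integral_const_mul,
      integral_add, integral_good, firstProb, repeatProb]
    · simp; norm_num
    · exact integrable_ind (hF t)
    · exact integrable_ind (hR t)
    · exact (integrable_ind (hG t)).const_mul _
    · exact integrable_const _
    · exact ((integrable_ind (hG t)).const_mul _).sub (integrable_const _)
    · exact ((integrable_ind (hF t)).add (integrable_ind (hR t))).const_mul _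
  · intro t h
    have h1 := ind_nonneg (FirstExplores 𝔖 a₀ a₁ f θ x k (immortal t₀ h) t)
    have h2 := ind_le_one (FirstExplores 𝔖 a₀ a₁ f θ x k (immortal t₀ h) t)
    have h3 := ind_nonneg (Good h (k, (𝔖 k).cell (x t)))
    have h4 := ind_le_one (Good h (k, (𝔖 k).cell (x t)))
    have h5 := ind_nonneg (Repeats 𝔖 a₀ a₁ f θ x k (immortal t₀ h) t)
    have h6 := ind_le_one (Repeats 𝔖 a₀ a₁ f θ x k (immortal t₀ h) t)
    have h7 := ind_nonneg (o t)
    have h8 := ind_le_one (o t)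
    rw [abs_le]
    constructor <;> linarith
  · intro t h y
    have : Good (Function.update h (Sum.inr t₀) y) (k, (𝔖 k).cell (x t)) ↔
        Good h (k, (𝔖 k).cell (x t)) := by
      rw [Good, Good, Function.update_of_ne (by simp)]
    simp only [immortal_update_inr, this]
  · intro h
    have hreg := totalRegret_ge (a₀ := a₀) (a₁ := a₁) (f := f) (θ := θ) hI (π h) h
    have h0 := ind_nonneg (1 / 2 < (h (Sum.inr t₀) : ℝ))
    have h1 := ind_le_one (1 / 2 < (h (Sum.inr t₀) : ℝ))
    refine le_trans ?_ (mul_le_mul_of_nonneg_left hreg h0)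
    rw [mul_add, Finset.mul_sum]
    refine add_le_add (by nlinarith [(Nat.cast_nonneg M : (0 : ℝ) ≤ M)]) ?_
    refine Finset.sum_le_sum fun t ht => ?_
    rw [← mul_assoc, ind_immortal_mul_alive]
    exact mul_le_mul_of_nonneg_left (aliveReward_sub_ge hne _ _ _ (ho h t ht)) (ind_nonneg _)

theorem IsolatedWindow.sum_repeatProb_le {k t₀ M : ℕ} (hI : IsolatedWindow 𝔖 x k t₀ M)
    {w : ℕ → ℝ} (hw : ∀ n, 0 ≤ w n) :
    ∑ t ∈ (𝔖 k).slots x t₀, w ((𝔖 k).age t₀ t) * repeatProb 𝔖 a₀ a₁ f θ x k t₀ t ≤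
      M * ∑ n ∈ Finset.range (2 ^ (𝔖 k).p + 1), w n +
      ∑ t ∈ (𝔖 k).slots x t₀, firstProb 𝔖 a₀ a₁ f θ x k t₀ t *
        ∑ n ∈ Finset.Ioc ((𝔖 k).age t₀ t) (2 ^ (𝔖 k).p), w n := by
  have hR := fun t => integrable_ind (μ := hiddenLaw) (measurableSet_repeats_immortal
    (𝔖 := 𝔖) (a₀ := a₀) (a₁ := a₁) (f := f) (θ := θ) (x := x) k t₀ t)
  have hF := fun t => integrable_ind (μ := hiddenLaw) (measurableSet_firstExplores_immortal
    (𝔖 := 𝔖) (a₀ := a₀) (a₁ := a₁) (f := f) (θ := θ) (x := x) k t₀ t)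
  have hRs : Integrable (fun h => ∑ t ∈ (𝔖 k).slots x t₀, w ((𝔖 k).age t₀ t) *
      ind (Repeats 𝔖 a₀ a₁ f θ x k (immortal t₀ h) t)) hiddenLaw :=
    integrable_finsetSum _ fun t _ => (hR t).const_mul _
  have hFs : Integrable (fun h => ∑ t ∈ (𝔖 k).slots x t₀,
      ind (FirstExplores 𝔖 a₀ a₁ f θ x k (immortal t₀ h) t) *
        ∑ n ∈ Finset.Ioc ((𝔖 k).age t₀ t) (2 ^ (𝔖 k).p), w n) hiddenLaw :=
    integrable_finsetSum _ fun t _ => (hF t).mul_const _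
  have key := integral_mono hRs ((integrable_const
    (M * ∑ n ∈ Finset.range (2 ^ (𝔖 k).p + 1), w n)).add hFs)
    fun h => hI.sum_repeats_le (immortal t₀ h) hw
  simp only [Pi.add_apply] at key
  rw [integral_add (integrable_const _) hFs, integral_finsetSum _ fun t _ => (hR t).const_mul _,
    integral_finsetSum _ fun t _ => (hF t).mul_const _] at key
  simp only [integral_const_mul, integral_mul_const, integral_const, probReal_univ,
    one_smul] at key
  exact key

/-- The dichotomy for a single window: the learner has a large regret either against the safe
action, on the event that the window is mortal, or against the policy that knows the coins, on the
event that the window is immortal. -/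
theorem IsolatedWindow.regret_ge (hne : a₁ ≠ a₀) {k t₀ M : ℕ}
    (hI : IsolatedWindow 𝔖 x k t₀ M) {π : Hidden → 𝒳 → 𝒜}
    (hπ : Measurable fun p : Hidden × 𝒳 => π p.1 p.2) {o : ℕ → Prop}
    (ho : ∀ h, ∀ t ∈ (𝔖 k).slots x t₀, ¬o t → (Good h (k, (𝔖 k).cell (x t)) → π h (x t) = a₁) ∧
      (¬Good h (k, (𝔖 k).cell (x t)) → π h (x t) = a₀)) {V : ℕ} (hV : V = 2 ^ (𝔖 k).p) :
    1 / 16 * ((𝔖 k).slots x t₀).card - 1 / 2 * ∑ t ∈ (𝔖 k).slots x t₀, ind (o t) -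
        4 * ((V + 1) * 4 ^ V) * M ≤
      3 / 2 * ((V + 1) * 4 ^ V) * ∫ h, ind ((h (Sum.inr t₀) : ℝ) ≤ 1 / 2) *
        totalRegret 𝔖 a₀ a₁ f (fun _ => a₀) h θ x (2 * t₀) ∂hiddenLaw +
      ∫ h, ind (1 / 2 < (h (Sum.inr t₀) : ℝ)) *
        totalRegret 𝔖 a₀ a₁ f (π h) h θ x (2 * t₀) ∂hiddenLaw := by
  have hA := hI.mortal_regret_ge (f := f) (θ := θ) hne
  have hB := hI.immortal_regret_ge (f := f) (θ := θ) hne hπ ho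
  have hC := hI.sum_repeatProb_le (a₀ := a₀) (a₁ := a₁) (f := f) (θ := θ)
    (w := fun n => (1 / 4) ^ n) fun n => by positivity
  have hD := hI.sum_repeatProb_le (a₀ := a₀) (a₁ := a₁) (f := f) (θ := θ)
    (w := fun _ => 1) fun n => zero_le_one
  set F := firstProb 𝔖 a₀ a₁ f θ x k t₀ with hFdef
  set R := repeatProb 𝔖 a₀ a₁ f θ x k t₀ with hRdef
  set u := (𝔖 k).age t₀ with hu
  set J := (𝔖 k).slots x t₀ with hJ
  rw [← hV] at hC hD
  have hF0 : ∀ t, 0 ≤ F t := firstProb_nonneg k t₀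
  have huV : ∀ t ∈ J, u t ≤ V := fun t ht => hV ▸ Stage.age_le (Stage.mem_slots.mp ht)
  have hM0 : (0 : ℝ) ≤ M := Nat.cast_nonneg M
  have hV0 : (0 : ℝ) ≤ V := Nat.cast_nonneg V
  -- the weighted number of repetitions
  have hC' : ∑ t ∈ J, (1 / 4) ^ u t * R t ≤ 4 / 3 * M + 1 / 3 * ∑ t ∈ J, (1 / 4) ^ u t * F t := by
    refine hC.trans (add_le_add ?_ ?_)
    · rw [mul_comm]
      exact mul_le_mul_of_nonneg_right (sum_range_quarter_pow_le _) hM0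
    · rw [Finset.mul_sum]
      refine Finset.sum_le_sum fun t _ => ?_
      have := mul_le_mul_of_nonneg_left (sum_Ioc_quarter_pow_le (u t) V) (hF0 t)
      linarith
  -- the number of repetitions
  have hD' : ∑ t ∈ J, R t ≤ (V + 1) * M + V * ∑ t ∈ J, F t := by
    simp only [one_mul, Finset.sum_const, Finset.card_range, Nat.card_Ioc, nsmul_eq_mul,
      mul_one] at hD
    refine hD.trans (add_le_add (by push_cast; linarith) ?_)
    rw [Finset.mul_sum]
    refine Finset.sum_le_sum fun t _ => ?_
    rw [mul_comm]
    refine mul_le_mul_of_nonneg_right ?_ (hF0 t)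
    exact_mod_cast Nat.sub_le _ _
  have hE : (1 / 4) ^ V * ∑ t ∈ J, F t ≤ ∑ t ∈ J, (1 / 4) ^ u t * F t := by
    rw [Finset.mul_sum]
    refine Finset.sum_le_sum fun t ht => mul_le_mul_of_nonneg_right ?_ (hF0 t)
    exact pow_le_pow_of_le_one (by norm_num) (by norm_num) (huV t ht)
  have hA' : -(M : ℝ) + 1 / 8 * (∑ t ∈ J, (1 / 4) ^ u t * F t - ∑ t ∈ J, (1 / 4) ^ u t * R t) ≤
      ∫ h, ind ((h (Sum.inr t₀) : ℝ) ≤ 1 / 2) *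
        totalRegret 𝔖 a₀ a₁ f (fun _ => a₀) h θ x (2 * t₀) ∂hiddenLaw := by
    refine le_trans (le_of_eq ?_) hA
    rw [← Finset.sum_sub_distrib, Finset.mul_sum]
    congr 1
    exact Finset.sum_congr rfl fun t _ => by ring
  have hB' : -(M : ℝ) + (1 / 16 * J.card - 1 / 2 * ∑ t ∈ J, ind (o t) -
      1 / 8 * (∑ t ∈ J, F t + ∑ t ∈ J, R t)) ≤
      ∫ h, ind (1 / 2 < (h (Sum.inr t₀) : ℝ)) *
        totalRegret 𝔖 a₀ a₁ f (π h) h θ x (2 * t₀) ∂hiddenLaw := by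
    refine le_trans (le_of_eq ?_) hB
    congr 1
    rw [← Finset.sum_add_distrib, Finset.mul_sum, Finset.mul_sum,
      show (1 / 16 * (J.card : ℝ)) = ∑ _t ∈ J, (1 / 16 : ℝ) by simp [mul_comm],
      ← Finset.sum_sub_distrib, ← Finset.sum_sub_distrib]
    exact Finset.sum_congr rfl fun t _ => by ring
  set SF := ∑ t ∈ J, F t
  set K : ℝ := (V + 1) * 4 ^ V with hK
  set IA := ∫ h, ind ((h (Sum.inr t₀) : ℝ) ≤ 1 / 2) *
        totalRegret 𝔖 a₀ a₁ f (fun _ => a₀) h θ x (2 * t₀) ∂hiddenLaw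
  -- eliminate the explorations between the two estimates
  have h4 : (4 : ℝ) ^ V * (1 / 4) ^ V = 1 := by rw [← mul_pow]; norm_num
  have hK1 : V + 1 ≤ K := le_mul_of_one_le_right (by linarith) (one_le_pow₀ (by norm_num))
  have hIA : -(7 / 6) * M + 1 / 12 * ((1 / 4) ^ V * SF) ≤ IA := by linarith
  have hIA' := mul_le_mul_of_nonneg_left hIA (show 0 ≤ 3 / 2 * K by linarith)
  have hKSF : 3 / 2 * K * (1 / 12 * ((1 / 4) ^ V * SF)) = 1 / 8 * ((V + 1) * SF) := by
    rw [hK]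
    linear_combination (1 / 8 * ((V : ℝ) + 1) * SF) * h4
  have hKM : (V + 1) * (M : ℝ) ≤ K * M := mul_le_mul_of_nonneg_right hK1 hM0
  nlinarith

end WindowEstimate

/-! ### Recursive choice and the reverse Fatou lemma -/

section Sequences

/-- The sequence in which each term is chosen by `y` from the preceding terms. -/
noncomputable def prefixSeq {α : Type*} (d : α) (y : ℕ → (ℕ → α) → α) (n : ℕ) : α :=
  y n fun j => if _h : j < n then prefixSeq d y j else d
termination_by n

/-- Recursive choice: if `Q n g y` only depends on the first `n` terms of `g`, and always has a
solution `y`, then there is a sequence whose terms solve it along their predecessors. -/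
theorem exists_seq_of_forall_prefix {α : Type*} [Nonempty α] {Q : ℕ → (ℕ → α) → α → Prop}
    (hQ : ∀ n g g' y, (∀ j < n, g j = g' j) → Q n g y → Q n g' y) (h : ∀ n g, ∃ y, Q n g y) :
    ∃ g : ℕ → α, ∀ n, Q n g (g n) := by
  choose y hy using h
  obtain ⟨d⟩ := ‹Nonempty α›
  refine ⟨prefixSeq d y, fun n => ?_⟩
  have hn := hy n fun j => if _h : j < n then prefixSeq d y j else d
  rw [prefixSeq]
  exact hQ n _ _ _ (fun j hj => dif_pos hj) hn

/-- The reverse Fatou lemma, for uniformly bounded functions and an integrable upper bound. -/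
theorem eventually_integral_le {α : Type*} [MeasurableSpace α] {μ : Measure α}
    [IsProbabilityMeasure μ] {F : ℕ → α → ℝ} {G : α → ℝ} (hF : ∀ n, Measurable (F n))
    (hF1 : ∀ n a, |F n a| ≤ 1) (hG : Integrable G μ)
    (h : ∀ᵐ a ∂μ, ∀ η : ℝ, 0 < η → ∀ᶠ n in atTop, F n a ≤ G a + η) {η : ℝ} (hη : 0 < η) :
    ∀ᶠ n in atTop, ∫ a, F n a ∂μ ≤ ∫ a, G a ∂μ + η := by
  have hFi : ∀ n, Integrable (F n) μ := fun n => integrable_of_abs_le (hF n) 1 (hF1 n)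
  have hi : ∀ n, Integrable (fun a => max (F n a - G a) 0) μ := fun n =>
    ((hFi n).sub hG).pos_part
  have ht : Tendsto (fun n => ∫ a, max (F n a - G a) 0 ∂μ) atTop (𝓝 (∫ _, (0 : ℝ) ∂μ)) := by
    refine tendsto_integral_of_dominated_convergence (fun a => 1 + |G a|)
      (fun n => (hi n).aestronglyMeasurable) ((integrable_const 1).add hG.abs) ?_ ?_
    · intro n
      refine Eventually.of_forall fun a => ?_
      rw [Real.norm_of_nonneg (le_max_right _ _)]
      refine max_le ?_ (by positivity)
      linarith [le_abs_self (F n a), hF1 n a, neg_abs_le (G a)]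
    · filter_upwards [h] with a ha
      rw [Metric.tendsto_atTop]
      intro e he
      obtain ⟨N, hN⟩ := eventually_atTop.mp (ha (e / 2) (by linarith))
      refine ⟨N, fun n hn => ?_⟩
      rw [Real.dist_eq, sub_zero, abs_of_nonneg (le_max_right _ _)]
      refine max_lt ?_ he
      linarith [hN n hn]
  rw [integral_zero] at ht
  filter_upwards [ht.eventually_lt_const hη] with n hn
  have h1 : ∫ a, F n a ∂μ - ∫ a, G a ∂μ ≤ ∫ a, max (F n a - G a) 0 ∂μ := by
    rw [← integral_sub (hFi n) hG]
    exact integral_mono ((hFi n).sub hG) (hi n) fun a => le_max_left _ _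
  linarith

end Sequences

/-! ### Regret of consistent rules at random times -/

section Consistency

variable {𝒳 : Type u} [MeasurableSpace 𝒳] {𝔖 : ℕ → Stage 𝒳} {𝒜 : Type v} [MeasurableSpace 𝒜]
  {a₀ a₁ : 𝒜} {f : LearningRule.{u, v, w} 𝒳 𝒜} {Ω : Type z} [MeasurableSpace Ω]

/-- The average regret at the end of the window that starts at `t₀`, on the event that the hidden
variable of this window satisfies `p`. -/
noncomputable def windowRegret (𝔖 : ℕ → Stage 𝒳) (a₀ a₁ : 𝒜) (f : LearningRule.{u, v, w} 𝒳 𝒜)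
    (p : unitInterval → Prop) (π : Hidden → 𝒳 → 𝒜) (h : Hidden) (θ : f.Seed) (x : ℕ → 𝒳)
    (t₀ : ℕ) : ℝ :=
  ind (p (h (Sum.inr t₀))) *
    (totalRegret 𝔖 a₀ a₁ f (π h) h θ x (2 * t₀) / ((2 * t₀ : ℕ) : ℝ))

theorem abs_windowRegret_le (p : unitInterval → Prop) (π : Hidden → 𝒳 → 𝒜) (h : Hidden)
    (θ : f.Seed) (x : ℕ → 𝒳) (t₀ : ℕ) : |windowRegret 𝔖 a₀ a₁ f p π h θ x t₀| ≤ 1 := by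
  rw [windowRegret, abs_mul, abs_div, Nat.abs_cast]
  refine mul_le_one₀ (abs_ind_le _) (by positivity) (div_le_one_of_le₀ ?_ (by positivity))
  exact abs_totalRegret_le ..

variable [MeasurableSingletonClass 𝒜] [Countable 𝒜]

theorem measurable_windowRegret {p : unitInterval → Prop} (hp : MeasurableSet {y | p y})
    {π : Hidden → 𝒳 → 𝒜} (hπ : Measurable fun p : Hidden × 𝒳 => π p.1 p.2) :
    Measurable fun q : (f.Seed × Hidden × (ℕ → 𝒳)) × ℕ =>
      windowRegret 𝔖 a₀ a₁ f p π q.1.2.1 q.1.1 q.1.2.2 q.2 := by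
  refine measurable_from_prod_countable_left fun t₀ => Measurable.mul ?_ ?_
  · exact (measurable_ind hp).comp ((measurable_pi_apply (Sum.inr t₀)).comp
      (measurable_fst.comp measurable_snd))
  · exact (measurable_totalRegret 𝔖 a₀ a₁ f hπ (2 * t₀)).div_const ((2 * t₀ : ℕ) : ℝ)

theorem measurable_windowRegret_comp {X : ℕ → Ω → 𝒳} (hX : ∀ t, Measurable (X t))
    {p : unitInterval → Prop} (hp : MeasurableSet {y | p y})
    {π : Hidden → 𝒳 → 𝒜} (hπ : Measurable fun p : Hidden × 𝒳 => π p.1 p.2) {σ : Ω → ℕ}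
    (hσ : Measurable σ) :
    Measurable fun q : Hidden × (Ω × f.Seed) =>
      windowRegret 𝔖 a₀ a₁ f p π q.1 q.2.2 (fun t => X t q.2.1) (σ q.2.1) := by
  refine (measurable_windowRegret hp hπ).comp ((Measurable.prodMk
    (measurable_snd.comp measurable_snd) (measurable_fst.prodMk ?_)).prodMk ?_)
  · exact measurable_pi_lambda _ fun t => (hX t).comp (measurable_fst.comp measurable_snd)
  · exact hσ.comp (measurable_fst.comp measurable_snd)

/-- For a consistent learning rule, the expected average regret at random times that tend to
infinity is asymptotically nonpositive, also on average over the hidden randomness. -/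
theorem eventually_integral_windowRegret_le {P : Measure Ω} [IsProbabilityMeasure P]
    {X : ℕ → Ω → 𝒳} (hX : ∀ t, Measurable (X t)) (x₀ : 𝒳)
    (hf : ∀ h, IsConsistent P X (mechanism 𝔖 a₀ a₁ x₀ h) f) {p : unitInterval → Prop}
    (hp : MeasurableSet {y | p y}) {π : Hidden → 𝒳 → 𝒜}
    (hπ : Measurable fun p : Hidden × 𝒳 => π p.1 p.2) {σ : ℕ → Ω → ℕ} (hσ : ∀ n, Measurable (σ n))
    (hσn : ∀ n ω, σ n ω = 0 ∨ n ≤ σ n ω) {η : ℝ} (hη : 0 < η) :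
    ∀ᶠ n in atTop, ∫ q, ∫ h, windowRegret 𝔖 a₀ a₁ f p π h q.2 (fun t => X t q.1) (σ n q.1)
      ∂hiddenLaw ∂(P.prod f.seedLaw) ≤ η := by
  have hm : ∀ n, Measurable fun q : Hidden × (Ω × f.Seed) =>
      windowRegret 𝔖 a₀ a₁ f p π q.1 q.2.2 (fun t => X t q.2.1) (σ n q.2.1) := fun n =>
    measurable_windowRegret_comp hX hp hπ (hσ n)
  have hswap : ∀ n, ∫ q, ∫ h, windowRegret 𝔖 a₀ a₁ f p π h q.2 (fun t => X t q.1) (σ n q.1)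
      ∂hiddenLaw ∂(P.prod f.seedLaw) = ∫ h, ∫ q, windowRegret 𝔖 a₀ a₁ f p π h q.2
      (fun t => X t q.1) (σ n q.1) ∂(P.prod f.seedLaw) ∂hiddenLaw := fun n =>
    (integral_integral_swap (f := fun h (q : Ω × f.Seed) => windowRegret 𝔖 a₀ a₁ f p π h q.2
      (fun t => X t q.1) (σ n q.1)) (integrable_of_abs_le (hm n) 1 fun q =>
      abs_windowRegret_le ..)).symm
  simp only [hswap]
  -- for a fixed value of the hidden randomness
  have hfix : ∀ h, ∀ η : ℝ, 0 < η → ∀ᶠ n in atTop, ∫ q, windowRegret 𝔖 a₀ a₁ f p π h q.2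
      (fun t => X t q.1) (σ n q.1) ∂(P.prod f.seedLaw) ≤ η := by
    intro h η hη
    have := eventually_integral_le (μ := P.prod f.seedLaw) (G := fun _ => 0)
      (F := fun n q => windowRegret 𝔖 a₀ a₁ f p π h q.2 (fun t => X t q.1) (σ n q.1))
      (fun n => (hm n).comp (measurable_const.prodMk measurable_id))
      (fun n q => abs_windowRegret_le ..) (integrable_zero _ _ _) ?_ hη
    · simpa using this
    · have hπh : Measurable (π h) := hπ.comp (measurable_const.prodMk measurable_id)
      filter_upwards [eventually_totalRegret_le 𝔖 a₀ a₁ x₀ h (hf h) hπh] with q hq η hη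
      obtain ⟨N, hN⟩ := eventually_atTop.mp (hq η hη)
      filter_upwards [eventually_ge_atTop N] with n hn
      rw [zero_add, windowRegret]
      have hle : totalRegret 𝔖 a₀ a₁ f (π h) h q.2 (fun t => X t q.1) (2 * σ n q.1) /
          ((2 * σ n q.1 : ℕ) : ℝ) ≤ η := by
        rcases hσn n q.1 with h0 | h0
        · simp [h0, hη.le]
        · exact div_le_of_le_mul₀ (by positivity) hη.le (hN _ (by omega))
      calc _ ≤ ind (p (h (Sum.inr (σ n q.1)))) * η :=
            mul_le_mul_of_nonneg_left hle (ind_nonneg _)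
        _ ≤ 1 * η := mul_le_mul_of_nonneg_right (ind_le_one _) hη.le
        _ = η := one_mul η
  have := eventually_integral_le (μ := hiddenLaw) (G := fun _ => 0)
    (F := fun n h => ∫ q, windowRegret 𝔖 a₀ a₁ f p π h q.2 (fun t => X t q.1) (σ n q.1)
      ∂(P.prod f.seedLaw))
    (fun n => ((hm n).stronglyMeasurable.integral_prod_right').measurable) ?_
    (integrable_zero _ _ _) (Eventually.of_forall fun h η hη => ?_) hη
  · simpa using this
  · intro n h
    rw [← Real.norm_eq_abs]
    refine (norm_integral_le_of_norm_le_const (C := 1) (Eventually.of_forall fun q => ?_)).trans ?_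
    · exact abs_windowRegret_le ..
    · simp
  · simpa using hfix h η hη

end Consistency

/-! ### Hard stages -/

section SlotMass

variable {𝒳 : Type u} [MeasurableSpace 𝒳]

/-- The number of slots of the window that starts at `t₀` whose context lies in `B`, relative to the
end of the window. -/
noncomputable def Stage.slotMass (S : Stage 𝒳) (B : Set 𝒳) (x : ℕ → 𝒳) (t₀ : ℕ) : ℝ :=
  (∑ t ∈ S.slots x t₀, ind (x t ∈ B)) / ((2 * t₀ : ℕ) : ℝ)

theorem Stage.card_slots_le (S : Stage 𝒳) (x : ℕ → 𝒳) (t₀ : ℕ) : (S.slots x t₀).card ≤ t₀ := by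
  classical
  refine (Finset.card_filter_le _ _).trans ?_
  rw [Nat.card_Ico]
  omega

theorem Stage.slotMass_nonneg (S : Stage 𝒳) (B : Set 𝒳) (x : ℕ → 𝒳) (t₀ : ℕ) :
    0 ≤ S.slotMass B x t₀ :=
  div_nonneg (Finset.sum_nonneg fun _ _ => ind_nonneg _) (Nat.cast_nonneg _)

theorem Stage.slotMass_le_one (S : Stage 𝒳) (B : Set 𝒳) (x : ℕ → 𝒳) (t₀ : ℕ) :
    S.slotMass B x t₀ ≤ 1 := by
  refine div_le_one_of_le₀ ?_ (Nat.cast_nonneg _)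
  refine (Finset.sum_le_card_nsmul _ _ 1 fun t _ => ind_le_one _).trans ?_
  rw [nsmul_one]
  have := S.card_slots_le x t₀
  exact_mod_cast this.trans (by omega)

theorem Stage.measurable_slotMass (S : Stage 𝒳) {B : Set 𝒳} (hB : MeasurableSet B) :
    Measurable fun q : (ℕ → 𝒳) × ℕ => S.slotMass B q.1 q.2 := by
  classical
  refine measurable_from_prod_countable_left fun t₀ => ?_
  have : (fun x : ℕ → 𝒳 => ∑ t ∈ S.slots x t₀, ind (x t ∈ B)) = fun x =>
      ∑ t ∈ Finset.Ico t₀ (2 * t₀), ind (S.Slot x t₀ t) * ind (x t ∈ B) := by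
    funext x
    rw [Stage.slots, Finset.sum_filter]
    refine Finset.sum_congr rfl fun t _ => ?_
    by_cases h : S.Slot x t₀ t <;> simp [h, ind]
  change Measurable fun x : ℕ → 𝒳 => (∑ t ∈ S.slots x t₀, ind (x t ∈ B)) / ((2 * t₀ : ℕ) : ℝ)
  refine Measurable.div_const ?_ _
  rw [this]
  exact Finset.measurable_sum _ fun t _ => (measurable_ind (S.measurableSet_slot t₀ t)).mul
    (measurable_ind (measurable_pi_apply t hB))

variable {Ω : Type z} [MeasurableSpace Ω]

theorem Stage.measurable_slotMass_comp (S : Stage 𝒳) {B : Set 𝒳} (hB : MeasurableSet B)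
    {X : ℕ → Ω → 𝒳} (hX : ∀ t, Measurable (X t)) {σ : Ω → ℕ} (hσ : Measurable σ) :
    Measurable fun ω => S.slotMass B (fun t => X t ω) (σ ω) :=
  (S.measurable_slotMass hB).comp ((measurable_pi_lambda _ hX).prodMk hσ)

theorem Stage.integrable_slotMass (S : Stage 𝒳) {B : Set 𝒳} (hB : MeasurableSet B)
    {X : ℕ → Ω → 𝒳} (hX : ∀ t, Measurable (X t)) {σ : Ω → ℕ} (hσ : Measurable σ) {P : Measure Ω}
    [IsFiniteMeasure P] : Integrable (fun ω => S.slotMass B (fun t => X t ω) (σ ω)) P :=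
  integrable_of_abs_le (S.measurable_slotMass_comp hB hX hσ) 1 fun ω => by
    rw [abs_of_nonneg (S.slotMass_nonneg ..)]; exact S.slotMass_le_one ..

/-- A stage is hard, with gap `g` and mass `ε`, if its windows are separated by a factor `g`, and if
the mass of the slots in a random window, selected by `σ` (where `σ ω = 0` means that no window is
selected), is at least `ε` on average. -/
structure Stage.IsHard (P : Measure Ω) (X : ℕ → Ω → 𝒳) (S : Stage 𝒳) (σ : Ω → ℕ) (g : ℕ) (ε : ℝ) :
    Prop where
  measurable : Measurable σ
  start : ∀ ω, σ ω ≠ 0 → S.a ≤ σ ω ∧ σ ω < S.b ∧ (fun t => X t ω) ∈ S.start (σ ω)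
  gap : ∀ ω t t', t < t' → S.a ≤ t → (fun t => X t ω) ∈ S.start t →
    (fun t => X t ω) ∈ S.start t' → g * t ≤ t'
  mass : ε ≤ ∫ ω, S.slotMass Set.univ (fun t => X t ω) (σ ω) ∂P

/-- Windows that are separated by a large factor, within and across stages, are isolated. -/
theorem isolatedWindow_of_gap {𝔖 : ℕ → Stage 𝒳} {x : ℕ → 𝒳} {g : ℕ → ℕ} (hg : ∀ k, 3 ≤ g k)
    (hgap : ∀ k t t', t < t' → (𝔖 k).a ≤ t → x ∈ (𝔖 k).start t → x ∈ (𝔖 k).start t' →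
      g k * t ≤ t')
    (hab : ∀ j k, j < k → g k * (𝔖 j).b ≤ (𝔖 k).a) {k t₀ : ℕ} (h0 : t₀ ≠ 0) (ha : (𝔖 k).a ≤ t₀)
    (hb : t₀ < (𝔖 k).b) (hs : x ∈ (𝔖 k).start t₀) :
    IsolatedWindow 𝔖 x k t₀ (2 * t₀ / g k) := by
  have hg0 : 0 < g k := by have := hg k; omega
  refine ⟨(Nat.div_lt_iff_lt_mul hg0).mpr ?_, ?_⟩
  · have := Nat.mul_le_mul_left t₀ (hg k)
    omega
  · rintro k' t' s ⟨ha', hb', hs', h1, h2, -⟩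
    -- a window that starts at `t'` with `g k * t' ≤ t₀` only has slots that are far before `t₀`
    have hearly : g k * t' ≤ t₀ → s ≤ 2 * t₀ / g k := by
      intro h
      rw [Nat.le_div_iff_mul_le hg0]
      calc s * g k ≤ 2 * t' * g k := Nat.mul_le_mul_right _ h2.le
        _ = 2 * (g k * t') := by ring
        _ ≤ 2 * t₀ := by omega
    have hlate : ∀ k t₁, t₀ ≤ t₁ → g k * t₁ ≤ t' → 2 * t₀ < s := by
      intro k t₁ h h'
      have := Nat.mul_le_mul_right t₁ (hg k)
      omega
    rcases lt_trichotomy k' k with hk | rfl | hk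
    · refine Or.inr (Or.inl (hearly ?_))
      exact (Nat.mul_le_mul_left _ hb'.le).trans ((hab k' k hk).trans ha)
    · rcases lt_trichotomy t' t₀ with ht | rfl | ht
      · exact Or.inr (Or.inl (hearly (hgap k' t' t₀ ht ha' hs' hs)))
      · exact Or.inl ⟨rfl, rfl⟩
      · exact Or.inr (Or.inr (hlate k' t₀ le_rfl (hgap k' t₀ t' ht ha hs hs')))
    · exact Or.inr (Or.inr (hlate k' _ hb.le ((hab k k' hk).trans ha')))

end SlotMass

/-! ### Hard stages defeat every learning rule -/

section Core

variable {𝒳 : Type u} [MeasurableSpace 𝒳]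

theorem Stage.slotMass_biUnion_le (S : Stage 𝒳) (I : Finset ℕ) (B : ℕ → Set 𝒳) (x : ℕ → 𝒳)
    (t₀ : ℕ) : S.slotMass (⋃ j ∈ I, B j) x t₀ ≤ ∑ j ∈ I, S.slotMass (B j) x t₀ := by
  simp only [Stage.slotMass]
  rw [← Finset.sum_div, Finset.sum_comm]
  refine div_le_div_of_nonneg_right (Finset.sum_le_sum fun t _ => ?_) (Nat.cast_nonneg _)
  by_cases h : x t ∈ ⋃ j ∈ I, B j
  · obtain ⟨j, hj, hx⟩ := Set.mem_iUnion₂.mp h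
    rw [ind_of h, ← ind_of hx]
    exact Finset.single_le_sum (f := fun j => ind (x t ∈ B j)) (fun _ _ => ind_nonneg _) hj
  · rw [ind_of_not h]
    exact Finset.sum_nonneg fun _ _ => ind_nonneg _

variable {𝒜 : Type v} {a₀ a₁ : 𝒜}

/-- The policy that plays, on the set of each stage in a list `κ` of stages, according to the coins
of the stage, where a stage that comes earlier in the list has precedence. -/
noncomputable def coinPolicy (𝔖 : ℕ → Stage 𝒳) (a₀ a₁ : 𝒜) (κ : ℕ → ℕ) (h : Hidden) (y : 𝒳) : 𝒜 :=
  open Classical in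
  if ∃ i, y ∈ (𝔖 (κ i)).A ∧ (∀ j < i, y ∉ (𝔖 (κ j)).A) ∧ Good h (κ i, (𝔖 (κ i)).cell y)
  then a₁ else a₀

theorem coinPolicy_eq {𝔖 : ℕ → Stage 𝒳} {κ : ℕ → ℕ} {i : ℕ} {h : Hidden} {y : 𝒳}
    (hy : y ∈ (𝔖 (κ i)).A) (hn : ∀ j < i, y ∉ (𝔖 (κ j)).A) :
    (Good h (κ i, (𝔖 (κ i)).cell y) → coinPolicy 𝔖 a₀ a₁ κ h y = a₁) ∧
      (¬Good h (κ i, (𝔖 (κ i)).cell y) → coinPolicy 𝔖 a₀ a₁ κ h y = a₀) := by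
  classical
  refine ⟨fun hg => if_pos ⟨i, hy, hn, hg⟩, fun hg => if_neg ?_⟩
  rintro ⟨j, hj, hnj, hgj⟩
  rcases lt_trichotomy j i with hji | rfl | hji
  · exact hn j hji hj
  · exact hg hgj
  · exact hnj i hji hy

variable [MeasurableSpace 𝒜]

theorem measurable_coinPolicy (𝔖 : ℕ → Stage 𝒳) (κ : ℕ → ℕ) :
    Measurable fun p : Hidden × 𝒳 => coinPolicy 𝔖 a₀ a₁ κ p.1 p.2 := by
  classical
  refine Measurable.ite ?_ measurable_const measurable_const
  have hA : ∀ i, MeasurableSet {p : Hidden × 𝒳 | p.2 ∈ (𝔖 (κ i)).A} := fun i =>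
    measurable_snd (𝔖 (κ i)).measurableSet_A
  have hG : ∀ i, MeasurableSet {p : Hidden × 𝒳 | Good p.1 (κ i, (𝔖 (κ i)).cell p.2)} := fun i =>
    (measurableSet_good (S := 𝔖 (κ i)) (κ i) 0).preimage
      (f := fun p : Hidden × 𝒳 => (p.1, fun _ : ℕ => p.2))
      (measurable_fst.prodMk (measurable_pi_lambda _ fun _ => measurable_snd))
  have : {p : Hidden × 𝒳 | ∃ i, p.2 ∈ (𝔖 (κ i)).A ∧ (∀ j < i, p.2 ∉ (𝔖 (κ j)).A) ∧
      Good p.1 (κ i, (𝔖 (κ i)).cell p.2)} = ⋃ i, {p | p.2 ∈ (𝔖 (κ i)).A} ∩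
        ((⋂ j, ⋂ _ : j < i, {p | p.2 ∈ (𝔖 (κ j)).A}ᶜ) ∩
        {p | Good p.1 (κ i, (𝔖 (κ i)).cell p.2)}) := by
    ext p; simp
  rw [this]
  exact MeasurableSet.iUnion fun i => (hA i).inter ((MeasurableSet.iInter fun j =>
    MeasurableSet.iInter fun _ => (hA j).compl).inter (hG i))

variable [MeasurableSingletonClass 𝒜] [Countable 𝒜]
  {f : LearningRule.{u, v, w} 𝒳 𝒜}

/-- The factor by which the regret against the safe action has to be small in order to force little
exploration in a window with about `2 ^ p` periods. -/
noncomputable def growth (p : ℕ) : ℝ := (((2 ^ p : ℕ) : ℝ) + 1) * 4 ^ 2 ^ p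

theorem growth_pos (p : ℕ) : 0 < growth p := by
  unfold growth; positivity

/-- The dichotomy for an isolated window, in terms of average regrets; it holds trivially if no
window is selected (`t₀ = 0`). The set `B` contains the contexts at which the policy `π` need not
agree with the coins. -/
theorem windowRegret_ge (hne : a₁ ≠ a₀) {𝔖 : ℕ → Stage 𝒳} {x : ℕ → 𝒳} {θ : f.Seed} {k t₀ g : ℕ}
    (hI : t₀ ≠ 0 → IsolatedWindow 𝔖 x k t₀ (2 * t₀ / g)) {π : Hidden → 𝒳 → 𝒜}
    (hπ : Measurable fun p : Hidden × 𝒳 => π p.1 p.2) {B : Set 𝒳}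
    (hB : ∀ h, ∀ y ∈ (𝔖 k).A, y ∉ B → (Good h (k, (𝔖 k).cell y) → π h y = a₁) ∧
      (¬Good h (k, (𝔖 k).cell y) → π h y = a₀)) :
    1 / 16 * (𝔖 k).slotMass Set.univ x t₀ - 1 / 2 * (𝔖 k).slotMass B x t₀ -
        4 * growth (𝔖 k).p / g ≤
      3 / 2 * growth (𝔖 k).p *
        ∫ h, windowRegret 𝔖 a₀ a₁ f (fun y => (y : ℝ) ≤ 1 / 2) (fun _ _ => a₀) h θ x t₀
          ∂hiddenLaw +
      ∫ h, windowRegret 𝔖 a₀ a₁ f (fun y => 1 / 2 < (y : ℝ)) π h θ x t₀ ∂hiddenLaw := by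
  have hgr := growth_pos (𝔖 k).p
  rcases Nat.eq_zero_or_pos t₀ with rfl | h0
  · have : (0 : ℝ) ≤ 4 * growth (𝔖 k).p / g := by positivity
    simpa [Stage.slotMass, windowRegret] using this
  have key := (hI h0.ne').regret_ge (f := f) (θ := θ) hne hπ (o := fun t => x t ∈ B)
    (fun h t ht => hB h (x t) (Stage.mem_slots.mp ht).2.2.2.2.2.1) rfl
  have h2 : (0 : ℝ) < ((2 * t₀ : ℕ) : ℝ) := by exact_mod_cast (by omega : 0 < 2 * t₀)
  have hM : ((2 * t₀ / g : ℕ) : ℝ) / ((2 * t₀ : ℕ) : ℝ) ≤ 1 / g := by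
    rw [div_le_iff₀ h2, one_div, inv_mul_eq_div]
    exact Nat.cast_div_le
  have hcard : (𝔖 k).slotMass Set.univ x t₀ =
      ((𝔖 k).slots x t₀).card / ((2 * t₀ : ℕ) : ℝ) := by
    simp [Stage.slotMass, ind]
  have hdiv := div_le_div_of_nonneg_right key h2.le
  simp only [windowRegret, mul_div_assoc', integral_div]
  rw [hcard]
  refine le_trans ?_ (hdiv.trans_eq ?_)
  · rw [Stage.slotMass]
    have := mul_le_mul_of_nonneg_left hM (show 0 ≤ 4 * growth (𝔖 k).p by positivity)
    have e1 : 4 * growth (𝔖 k).p / g = 4 * growth (𝔖 k).p * (1 / g) := by ring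
    rw [e1, sub_div, sub_div, mul_div_assoc, mul_div_assoc, mul_div_assoc]
    exact sub_le_sub_left this _
  · rw [add_div]; rfl

variable {Ω : Type z} [MeasurableSpace Ω]

/-- If there are hard stages of infinitely many types `i`, arbitrarily late and with arbitrarily
large gaps, and if the sets of different types have small overlaps, then no learning rule is
consistent under all online rewards. -/
theorem not_onlineLearnable_of_isHard (hne : a₁ ≠ a₀) {P : Measure Ω} [IsProbabilityMeasure P]
    {X : ℕ → Ω → 𝒳} (hX : ∀ t, Measurable (X t)) {ε : ℝ} (hε : 0 < ε) {p : ℕ → ℕ}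
    {C : ℕ → Set (Set 𝒳)}
    (hard : ∀ i a g, ∃ (S : Stage 𝒳) (σ : Ω → ℕ), S.p = p i ∧ S.A ∈ C i ∧ a ≤ S.a ∧
      S.IsHard P X σ g ε)
    {δ : ℕ → ℝ} (hδ : ∀ n, ∑ i ∈ Finset.range n, δ i ≤ ε / 32)
    (hoverlap : ∀ j i, j < i → ∀ B ∈ C j, ∃ a₀, ∀ (S : Stage 𝒳) (σ : Ω → ℕ), S.p = p i →
      S.A ∈ C i → a₀ ≤ S.a → Measurable σ → (∀ ω, σ ω = 0 ∨ S.a ≤ σ ω) →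
      ∫ ω, S.slotMass B (fun t => X t ω) (σ ω) ∂P ≤ δ j) :
    ¬OnlineLearnable.{u, v, w, z} P X 𝒜 := by
  rintro ⟨f, hf⟩
  have hΩ : Nonempty Ω := by
    by_contra hΩ
    rw [not_nonempty_iff] at hΩ
    exact IsProbabilityMeasure.ne_zero P (Measure.eq_zero_of_isEmpty P)
  obtain ⟨ω₀⟩ := hΩ
  -- gap factors that make the past of a window negligible, for each type
  have hgex : ∀ i, ∃ g : ℕ, 3 ≤ g ∧ 4 * growth (p i) / g ≤ ε / 100 := by
    intro i
    obtain ⟨n, hn⟩ := exists_nat_gt (4 * growth (p i) / (ε / 100))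
    refine ⟨n + 3, by omega, ?_⟩
    rw [div_le_iff₀ (by positivity)]
    rw [div_lt_iff₀ (by positivity)] at hn
    push_cast
    nlinarith
  choose g hg3 hg using hgex
  -- the sequence of stages, in which every type occurs infinitely often
  let ty : ℕ → ℕ := fun k => k.unpair.1
  have : Nonempty (Stage 𝒳 × (Ω → ℕ)) :=
    (hard 0 0 0).elim fun S hS => hS.elim fun σ _ => ⟨(S, σ)⟩
  obtain ⟨Z, hZ⟩ := exists_seq_of_forall_prefix (α := Stage 𝒳 × (Ω → ℕ))
    (Q := fun k prev y => y.1.p = p (ty k) ∧ y.1.A ∈ C (ty k) ∧ k ≤ y.1.a ∧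
      (∀ j < k, g (ty k) * (prev j).1.b ≤ y.1.a) ∧ y.1.IsHard P X y.2 (g (ty k)) ε ∧
      ∀ j < k, ty j < ty k → (prev j).1.A ∈ C (ty j) →
        ∫ ω, y.1.slotMass (prev j).1.A (fun t => X t ω) (y.2 ω) ∂P ≤ δ (ty j)) (by
    rintro k prev prev' y hpp ⟨h1, h2, h3, h4, h5, h6⟩
    refine ⟨h1, h2, h3, fun j hj => hpp j hj ▸ h4 j hj, h5, fun j hj => hpp j hj ▸ h6 j hj⟩) (by
    intro k prev
    have hov : ∀ j, ∃ a₁, ty j < ty k → (prev j).1.A ∈ C (ty j) → ∀ (S : Stage 𝒳) (σ : Ω → ℕ),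
        S.p = p (ty k) → S.A ∈ C (ty k) → a₁ ≤ S.a → Measurable σ →
        (∀ ω, σ ω = 0 ∨ S.a ≤ σ ω) →
        ∫ ω, S.slotMass (prev j).1.A (fun t => X t ω) (σ ω) ∂P ≤ δ (ty j) := by
      intro j
      by_cases h : ty j < ty k ∧ (prev j).1.A ∈ C (ty j)
      · obtain ⟨a₁, ha₁⟩ := hoverlap _ _ h.1 _ h.2
        exact ⟨a₁, fun _ _ => ha₁⟩
      · exact ⟨0, fun h1 h2 => absurd ⟨h1, h2⟩ h⟩
    choose α hα using hov
    obtain ⟨S, σ, hp, hC, ha, hS⟩ := hard (ty k)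
      (k + ∑ j ∈ Finset.range k, (g (ty k) * (prev j).1.b + α j)) (g (ty k))
    have hle : ∀ j < k, g (ty k) * (prev j).1.b + α j ≤ S.a := fun j hj =>
      (Finset.single_le_sum (f := fun j => g (ty k) * (prev j).1.b + α j)
        (fun _ _ => Nat.zero_le _) (Finset.mem_range.mpr hj)).trans (by omega)
    have hkS : k ≤ S.a := by omega
    have hjS : ∀ j < k, g (ty k) * (prev j).1.b ≤ S.a := fun j hj => by
      have := hle j hj; omega
    refine ⟨(S, σ), hp, hC, hkS, hjS, hS,
      fun j hj h1 h2 => hα j h1 h2 S σ hp hC (by have := hle j hj; omega) hS.measurable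
      fun ω => ?_⟩
    by_cases h0 : σ ω = 0
    · exact Or.inl h0
    · exact Or.inr (hS.start ω h0).1)
  set 𝔖 : ℕ → Stage 𝒳 := fun k => (Z k).1 with h𝔖
  set σ : ℕ → Ω → ℕ := fun k => (Z k).2 with hσdef
  have hp : ∀ k, (𝔖 k).p = p (ty k) := fun k => (hZ k).1
  have hC : ∀ k, (𝔖 k).A ∈ C (ty k) := fun k => (hZ k).2.1
  have ha : ∀ k, k ≤ (𝔖 k).a := fun k => (hZ k).2.2.1
  have hab : ∀ j k, j < k → g (ty k) * (𝔖 j).b ≤ (𝔖 k).a := fun j k hjk => (hZ k).2.2.2.1 j hjk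
  have hH : ∀ k, (𝔖 k).IsHard P X (σ k) (g (ty k)) ε := fun k => (hZ k).2.2.2.2.1
  have hov : ∀ j k, j < k → ty j < ty k →
      ∫ ω, (𝔖 k).slotMass (𝔖 j).A (fun t => X t ω) (σ k ω) ∂P ≤ δ (ty j) := fun j k hjk ht =>
    (hZ k).2.2.2.2.2 j hjk ht (hC j)
  have hσ0 : ∀ k ω, σ k ω = 0 ∨ k ≤ σ k ω := by
    intro k ω
    by_cases h0 : σ k ω = 0
    · exact Or.inl h0
    · exact Or.inr ((ha k).trans ((hH k).start ω h0).1)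
  have hiso : ∀ k ω, σ k ω ≠ 0 →
      IsolatedWindow 𝔖 (fun t => X t ω) k (σ k ω) (2 * σ k ω / g (ty k)) := by
    intro k ω h0
    obtain ⟨h1, h2, h3⟩ := (hH k).start ω h0
    exact isolatedWindow_of_gap (g := fun k => g (ty k)) (fun k => hg3 _)
      (fun k t t' => (hH k).gap ω t t') hab h0 h1 h2 h3
  have hcons : ∀ h, IsConsistent P X (mechanism 𝔖 a₀ a₁ (X 0 ω₀) h) f := fun h => hf _
  have hmle : MeasurableSet {y : unitInterval | (y : ℝ) ≤ 1 / 2} :=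
    measurableSet_le measurable_subtype_coe measurable_const
  have hmlt : MeasurableSet {y : unitInterval | 1 / 2 < (y : ℝ)} :=
    measurableSet_lt measurable_const measurable_subtype_coe
  -- for each type, a late stage at which the regret against the safe action is small
  let safeLoss : ℕ → ℝ := fun k => ∫ q, ∫ h, windowRegret 𝔖 a₀ a₁ f (fun y => (y : ℝ) ≤ 1 / 2)
    (fun _ _ => a₀) h q.2 (fun t => X t q.1) (σ k q.1) ∂hiddenLaw ∂(P.prod f.seedLaw)
  obtain ⟨κ, hκ⟩ := exists_seq_of_forall_prefix (α := ℕ)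
    (Q := fun i prev k => ty k = i ∧ i ≤ k ∧ (∀ j < i, prev j < k) ∧
      3 / 2 * growth (p i) * safeLoss k ≤ ε / 100) (by
      rintro i prev prev' k hpp ⟨h1, h2, h3, h4⟩
      exact ⟨h1, h2, fun j hj => hpp j hj ▸ h3 j hj, h4⟩) (by
    intro i prev
    have hgr := growth_pos (p i)
    have hev := eventually_integral_windowRegret_le (a₁ := a₁) hX (X 0 ω₀) hcons hmle
      (π := fun _ _ => a₀) measurable_const (fun k => (hH k).measurable) hσ0
      (η := ε / 100 / (3 / 2 * growth (p i))) (by positivity)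
    obtain ⟨N, hN⟩ := eventually_atTop.mp hev
    let m := N + i + ∑ j ∈ Finset.range i, (prev j + 1)
    have hm : m ≤ Nat.pair i m := Nat.right_le_pair i m
    refine ⟨Nat.pair i m, by simp [ty], by omega, fun j hj => ?_, ?_⟩
    · have := Finset.single_le_sum (f := fun j => prev j + 1) (fun _ _ => Nat.zero_le _)
        (Finset.mem_range.mpr hj)
      omega
    · have := hN (Nat.pair i m) (by omega)
      rw [le_div_iff₀ (by positivity)] at this
      calc _ = safeLoss (Nat.pair i m) * (3 / 2 * growth (p i)) := by ring
        _ ≤ ε / 100 := this)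
  have hκty : ∀ i, ty (κ i) = i := fun i => (hκ i).1
  have hκle : ∀ i, i ≤ κ i := fun i => (hκ i).2.1
  have hκlt : ∀ j i, j < i → κ j < κ i := fun j i hji => (hκ i).2.2.1 j hji
  have hπ := measurable_coinPolicy (a₀ := a₀) (a₁ := a₁) 𝔖 κ
  have hev := eventually_integral_windowRegret_le (a₁ := a₁) hX (X 0 ω₀) hcons hmlt
    hπ (σ := fun i => σ (κ i)) (fun i => (hH _).measurable)
    (fun i ω => (hσ0 (κ i) ω).imp id (hκle i).trans) (η := ε / 100) (by positivity)
  obtain ⟨i, hi⟩ := hev.exists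
  -- the dichotomy at the stage `κ i`, averaged over the contexts and the seed
  set B : Set 𝒳 := ⋃ j ∈ Finset.range i, (𝔖 (κ j)).A with hBdef
  have hBm : MeasurableSet B := Finset.measurableSet_biUnion _ fun j _ => (𝔖 (κ j)).measurableSet_A
  have hpt : ∀ q : Ω × f.Seed, _ := fun q => windowRegret_ge (f := f) (θ := q.2) hne
    (hiso (κ i) q.1) hπ (B := B) fun h y hy hyB => coinPolicy_eq hy fun j hj hyj =>
      hyB (Set.mem_biUnion (Finset.mem_coe.mpr (Finset.mem_range.mpr hj)) hyj)
  have hint : ∀ (pr : unitInterval → Prop) (_ : MeasurableSet {y | pr y}) (π : Hidden → 𝒳 → 𝒜)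
      (_ : Measurable fun p : Hidden × 𝒳 => π p.1 p.2),
      Integrable (fun q : Ω × f.Seed => ∫ h, windowRegret 𝔖 a₀ a₁ f pr π h q.2
        (fun t => X t q.1) (σ (κ i) q.1) ∂hiddenLaw) (P.prod f.seedLaw) := by
    intro pr hpr π hπ
    exact Integrable.integral_prod_right (integrable_of_abs_le (μ := hiddenLaw.prod
      (P.prod f.seedLaw)) (measurable_windowRegret_comp hX hpr hπ (hH (κ i)).measurable) 1
      fun q => abs_windowRegret_le ..)
  have hmass : ∀ B : Set 𝒳, MeasurableSet B → Integrable (fun ω =>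
      (𝔖 (κ i)).slotMass B (fun t => X t ω) (σ (κ i) ω)) P := fun B hB =>
    (𝔖 (κ i)).integrable_slotMass hB hX (hH (κ i)).measurable
  have hmass' : ∀ B : Set 𝒳, MeasurableSet B → Integrable (fun q : Ω × f.Seed =>
      (𝔖 (κ i)).slotMass B (fun t => X t q.1) (σ (κ i) q.1)) (P.prod f.seedLaw) := fun B hB =>
    (hmass B hB).comp_fst f.seedLaw
  have hfst : ∀ B : Set 𝒳, ∫ q : Ω × f.Seed,
      (𝔖 (κ i)).slotMass B (fun t => X t q.1) (σ (κ i) q.1) ∂(P.prod f.seedLaw) =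
      ∫ ω, (𝔖 (κ i)).slotMass B (fun t => X t ω) (σ (κ i) ω) ∂P := by
    intro B
    rw [integral_fun_fst (fun ω => (𝔖 (κ i)).slotMass B (fun t => X t ω) (σ (κ i) ω))]
    simp
  have i1 := (hmass' _ MeasurableSet.univ).const_mul (1 / 16)
  have i2 := (hmass' _ hBm).const_mul (1 / 2)
  have i3 : Integrable (fun _ : Ω × f.Seed => 4 * growth (𝔖 (κ i)).p / (g (ty (κ i)) : ℝ))
    (P.prod f.seedLaw) := integrable_const _
  have i4 := (hint _ hmle (fun _ _ => a₀) measurable_const).const_mul (3 / 2 * growth (𝔖 (κ i)).p)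
  have i5 := hint _ hmlt _ hπ
  have i12 : Integrable (fun q : Ω × f.Seed =>
      1 / 16 * (𝔖 (κ i)).slotMass Set.univ (fun t => X t q.1) (σ (κ i) q.1) -
      1 / 2 * (𝔖 (κ i)).slotMass B (fun t => X t q.1) (σ (κ i) q.1)) (P.prod f.seedLaw) :=
    i1.sub i2
  have htot := integral_mono (i12.sub i3) (i4.add i5) hpt
  simp only [Pi.add_apply, Pi.sub_apply] at htot
  rw [integral_sub i12 i3, integral_sub i1 i2, integral_add i4 i5,
    integral_const_mul, integral_const_mul, integral_const_mul, hfst, hfst] at htot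
  simp only [integral_const, probReal_univ, one_smul] at htot
  have hε1 := (hH (κ i)).mass
  have hloss := (hκ i).2.2.2
  have hgi := hg i
  rw [hp, hκty] at htot
  have hBle : ∫ ω, (𝔖 (κ i)).slotMass B (fun t => X t ω) (σ (κ i) ω) ∂P ≤ ε / 32 := by
    refine le_trans (integral_mono (hmass B hBm) (integrable_finsetSum _ fun j _ =>
      hmass _ (𝔖 (κ j)).measurableSet_A) fun ω => Stage.slotMass_biUnion_le ..) ?_
    rw [integral_finsetSum _ fun j _ => hmass _ (𝔖 (κ j)).measurableSet_A]
    refine (Finset.sum_le_sum fun j hj => ?_).trans (hδ i)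
    have hji := Finset.mem_range.mp hj
    have := hov (κ j) (κ i) (hκlt j i hji) (by rw [hκty, hκty]; exact hji)
    rwa [hκty] at this
  -- the mass contributes `ε / 16`, which exceeds the overlap `ε / 64` and three errors `ε / 100`
  linarith

end Core

/-! ### Visits and limit submeasures -/

section FirstTimes

theorem mem_firstTimes_of_comp {α β : Type*} {i t : ℕ} {x : ℕ → α} {c : α → β}
    (ht : t ∈ firstTimes i fun s => c (x s)) : t ∈ firstTimes i x := by
  obtain ⟨h1, k, hk1, hk2, hk⟩ := ht
  exact ⟨h1, k, hk1, hk2, fun t' h h' he => hk t' h h' (congrArg c he)⟩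

theorem mem_firstTimes_comp {α β : Type*} {i t n : ℕ} {x : ℕ → α} {c : α → β}
    (hc : ∀ s ≤ n, ∀ t ≤ n, c (x s) = c (x t) → x s = x t) (htn : t ≤ n)
    (ht : t ∈ firstTimes i x) : t ∈ firstTimes i fun s => c (x s) := by
  obtain ⟨h1, k, hk1, hk2, hk⟩ := ht
  exact ⟨h1, k, hk1, hk2, fun t' h h' he => hk t' h h' (hc t' (h'.le.trans htn) t htn he)⟩

end FirstTimes

section Visits

variable {𝒳 : Type u} {i : ℕ} {A : Set 𝒳} {x : ℕ → 𝒳} {I J : Finset ℕ}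

theorem visits_eq_sum_ind (i : ℕ) (A : Set 𝒳) (x : ℕ → 𝒳) (I : Finset ℕ) :
    visits i A x I = ∑ t ∈ I, ind (t ∈ firstTimes i x ∧ x t ∈ A) := by
  classical
  refine Finset.sum_congr rfl fun t _ => ?_
  by_cases h1 : t ∈ firstTimes i x <;> by_cases h2 : x t ∈ A <;> simp [h1, h2, ind]

theorem visits_nonneg : 0 ≤ visits i A x I := by
  rw [visits_eq_sum_ind]
  exact Finset.sum_nonneg fun _ _ => ind_nonneg _

theorem visits_le_card : visits i A x I ≤ I.card := by
  rw [visits_eq_sum_ind]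
  refine (Finset.sum_le_card_nsmul _ _ 1 fun t _ => ind_le_one _).trans ?_
  rw [nsmul_one]

theorem visits_mono (h : I ⊆ J) : visits i A x I ≤ visits i A x J := by
  rw [visits_eq_sum_ind, visits_eq_sum_ind]
  exact Finset.sum_le_sum_of_subset_of_nonneg h fun _ _ _ => ind_nonneg _

theorem average_visits_le_one (T : ℕ) :
    1 / (T : ℝ) * visits i A x (Finset.Icc 1 T) ≤ 1 := by
  rw [one_div, inv_mul_eq_div]
  refine div_le_one_of_le₀ (visits_le_card.trans ?_) (Nat.cast_nonneg _)
  simp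

theorem average_visits_nonneg (T : ℕ) :
    0 ≤ 1 / (T : ℝ) * visits i A x (Finset.Icc 1 T) :=
  mul_nonneg (by positivity) visits_nonneg

theorem isBoundedUnder_average_visits : IsBoundedUnder (· ≤ ·) atTop fun T : ℕ =>
    1 / (T : ℝ) * visits i A x (Finset.Icc 1 T) :=
  isBoundedUnder_of ⟨1, average_visits_le_one⟩

theorem isCoboundedUnder_average_visits : IsCoboundedUnder (· ≤ ·) atTop fun T : ℕ =>
    1 / (T : ℝ) * visits i A x (Finset.Icc 1 T) :=
  IsBoundedUnder.isCoboundedUnder_le (isBoundedUnder_of ⟨0, average_visits_nonneg⟩)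

theorem limitSubmeasure_nonneg (i : ℕ) (x : ℕ → 𝒳) (A : Set 𝒳) : 0 ≤ limitSubmeasure i x A :=
  le_limsup_of_frequently_le (Eventually.of_forall average_visits_nonneg).frequently
    isBoundedUnder_average_visits

theorem limitSubmeasure_le_one (i : ℕ) (x : ℕ → 𝒳) (A : Set 𝒳) : limitSubmeasure i x A ≤ 1 :=
  limsup_le_of_le isCoboundedUnder_average_visits (Eventually.of_forall average_visits_le_one)

theorem eventually_visits_le (i : ℕ) (x : ℕ → 𝒳) (A : Set 𝒳) {η : ℝ} (hη : 0 < η) :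
    ∀ᶠ T : ℕ in atTop, visits i A x (Finset.Icc 1 T) ≤ T * (limitSubmeasure i x A + η) := by
  filter_upwards [eventually_lt_of_limsup_lt (b := limitSubmeasure i x A + η)
    (show limitSubmeasure i x A < _ by linarith) isBoundedUnder_average_visits,
    eventually_gt_atTop 0] with T hT h0
  have h0' : (0 : ℝ) < T := by exact_mod_cast h0
  rw [one_div, inv_mul_eq_div, div_lt_iff₀ h0'] at hT
  linarith

/-- The context is visited with density at least `c` on infinitely many dyadic periods, unless the
limit submeasure is small. -/
theorem frequently_visits_of_lt_limitSubmeasure {c : ℝ} (hc : 0 < c)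
    (h : 4 * c < limitSubmeasure i x A) :
    ∃ᶠ s : ℕ in atTop, c * 2 ^ (s + 1) ≤ visits i A x (Finset.Ico (2 ^ s) (2 * 2 ^ s)) := by
  intro hev
  simp only [not_le] at hev
  obtain ⟨s₀, hs₀⟩ := eventually_atTop.mp hev
  have hsum : ∀ m, visits i A x (Finset.Ico 1 (2 ^ (s₀ + m))) ≤
      2 ^ s₀ + c * 2 ^ (s₀ + m + 1) := by
    intro m
    induction m with
    | zero =>
      refine visits_le_card.trans ?_
      have : (0 : ℝ) ≤ c * 2 ^ (s₀ + 0 + 1) := by positivity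
      have h2 : (((Finset.Ico 1 (2 ^ (s₀ + 0))).card : ℕ) : ℝ) ≤ ((2 ^ s₀ : ℕ) : ℝ) := by
        rw [Nat.card_Ico]; exact_mod_cast Nat.sub_le _ _
      push_cast at h2
      linarith
    | succ m ih =>
      have hlt := hs₀ (s₀ + m) (Nat.le_add_right _ _)
      have hsplit : visits i A x (Finset.Ico 1 (2 ^ (s₀ + (m + 1)))) =
          visits i A x (Finset.Ico 1 (2 ^ (s₀ + m))) +
          visits i A x (Finset.Ico (2 ^ (s₀ + m)) (2 * 2 ^ (s₀ + m))) := by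
        have e : 2 ^ (s₀ + (m + 1)) = 2 * 2 ^ (s₀ + m) := by ring
        rw [e]
        exact (Finset.sum_Ico_consecutive _ Nat.one_le_two_pow (by omega)).symm
      rw [hsplit]
      have e : (2 : ℝ) ^ (s₀ + (m + 1) + 1) = 2 * 2 ^ (s₀ + m + 1) := by ring
      rw [e]
      linarith
  -- compare `T` with the next power of `2`
  refine absurd (le_of_forall_pos_le_add fun η hη => ?_ : limitSubmeasure i x A ≤ 4 * c)
    (not_le.mpr h)
  refine limsup_le_of_le isCoboundedUnder_average_visits ?_
  obtain ⟨N, hN⟩ := exists_nat_gt ((2 : ℝ) ^ s₀ / η)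
  filter_upwards [eventually_ge_atTop (N + 2 ^ s₀)] with T hT
  have hT1 : 2 ^ s₀ ≤ T := by omega
  have hT0 : T ≠ 0 := by have := Nat.two_pow_pos s₀; omega
  have hT0' : (0 : ℝ) < T := by exact_mod_cast Nat.pos_of_ne_zero hT0
  obtain ⟨m, hm⟩ := Nat.exists_eq_add_of_le ((Nat.le_log_iff_pow_le one_lt_two hT0).mpr hT1)
  have hlow : 2 ^ (s₀ + m) ≤ T := by rw [← hm]; exact Nat.pow_log_le_self 2 hT0
  have hup : T < 2 ^ (s₀ + (m + 1)) := by
    have := Nat.lt_pow_succ_log_self one_lt_two T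
    rwa [hm] at this
  have h1 : visits i A x (Finset.Icc 1 T) ≤ 2 ^ s₀ + c * 2 ^ (s₀ + (m + 1) + 1) := by
    refine (visits_mono fun t ht => ?_).trans (hsum (m + 1))
    rw [Finset.mem_Icc] at ht
    rw [Finset.mem_Ico]
    exact ⟨ht.1, ht.2.trans_lt hup⟩
  have h2 : (2 : ℝ) ^ (s₀ + (m + 1) + 1) ≤ 4 * T := by
    have : ((2 ^ (s₀ + m) : ℕ) : ℝ) ≤ T := by exact_mod_cast hlow
    push_cast at this
    have e : (2 : ℝ) ^ (s₀ + (m + 1) + 1) = 4 * 2 ^ (s₀ + m) := by ring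
    linarith
  have h3 : (2 : ℝ) ^ s₀ ≤ η * T := by
    rw [div_lt_iff₀ hη] at hN
    have : (N : ℝ) ≤ T := by exact_mod_cast (Nat.le_add_right N _).trans hT
    nlinarith
  rw [one_div, inv_mul_eq_div, div_le_iff₀ hT0']
  nlinarith

theorem integral_limitSubmeasure_nonneg (i : ℕ) {Ω : Type z}
    [MeasurableSpace Ω] (X : ℕ → Ω → 𝒳) (P : Measure Ω) :
    0 ≤ ∫ ω, limitSubmeasure i (fun t => X t ω) A ∂P :=
  integral_nonneg fun _ => limitSubmeasure_nonneg ..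

theorem average_window_visits_le_one (t₀ : ℕ) :
    1 / (2 * (t₀ : ℝ)) * visits i A x (Finset.Ico t₀ (2 * t₀)) ≤ 1 := by
  rw [one_div, inv_mul_eq_div]
  refine div_le_one_of_le₀ (visits_le_card.trans ?_) (by positivity)
  rw [Nat.card_Ico]
  exact_mod_cast Nat.sub_le _ _

theorem average_window_visits_nonneg (t₀ : ℕ) :
    0 ≤ 1 / (2 * (t₀ : ℝ)) * visits i A x (Finset.Ico t₀ (2 * t₀)) :=
  mul_nonneg (by positivity) visits_nonneg

end Visits

/-! ### Measurability and separation of contexts -/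

section Measurability

variable {𝒳 : Type u} [MeasurableSpace 𝒳] [MeasurableEq 𝒳]
  {Ω : Type z} [MeasurableSpace Ω] {X : ℕ → Ω → 𝒳} {A : Set 𝒳}

theorem measurable_visits (hX : ∀ t, Measurable (X t)) (hA : MeasurableSet A) (i : ℕ)
    (I : Finset ℕ) : Measurable fun ω => visits i A (fun t => X t ω) I := by
  simp only [visits_eq_sum_ind]
  refine Finset.measurable_sum _ fun t _ => measurable_ind (MeasurableSet.inter ?_ (hX t hA))
  exact measurable_pi_lambda _ hX (measurableSet_firstTimes i t measurable_id)

theorem measurable_limitSubmeasure (hX : ∀ t, Measurable (X t)) (hA : MeasurableSet A) (i : ℕ) :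
    Measurable fun ω => limitSubmeasure i (fun t => X t ω) A :=
  Measurable.limsup fun T => (measurable_visits hX hA i (Finset.Icc 1 T)).const_mul _

theorem integrable_limitSubmeasure (hX : ∀ t, Measurable (X t)) (hA : MeasurableSet A) (i : ℕ)
    {P : Measure Ω} [IsFiniteMeasure P] :
    Integrable (fun ω => limitSubmeasure i (fun t => X t ω) A) P :=
  integrable_of_abs_le (measurable_limitSubmeasure hX hA i) 1 fun ω => by
    rw [abs_of_nonneg (limitSubmeasure_nonneg ..)]; exact limitSubmeasure_le_one ..

theorem integral_limitSubmeasure_le_one (hX : ∀ t, Measurable (X t)) (hA : MeasurableSet A) (i : ℕ)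
    (P : Measure Ω) [IsProbabilityMeasure P] :
    ∫ ω, limitSubmeasure i (fun t => X t ω) A ∂P ≤ 1 := by
  simpa using integral_mono (μ := P) (integrable_limitSubmeasure hX hA i) (integrable_const 1)
    fun ω => limitSubmeasure_le_one i (fun t => X t ω) A

open MeasurableSpace

variable [CountablyGenerated 𝒳] [SeparatesPoints 𝒳]

/-- A countable partition that, with large probability, separates the distinct contexts among
finitely many. -/
theorem exists_cell (hX : ∀ t, Measurable (X t)) (P : Measure Ω) [IsProbabilityMeasure P] (n : ℕ)
    {η : ℝ} (hη : 0 < η) : ∃ c : 𝒳 → ℕ, Measurable c ∧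
      P.real {ω | ∀ s ≤ n, ∀ t ≤ n, c (X s ω) = c (X t ω) → X s ω = X t ω}ᶜ ≤ η := by
  let c : ℕ → 𝒳 → ℕ := fun m y => Encodable.encode fun i : Fin m => mapNatBool 𝒳 y i
  have hc : ∀ m, Measurable (c m) := fun m =>
    (Measurable.of_discrete (f := fun f : Fin m → Bool => Encodable.encode f)).comp
      (measurable_pi_lambda _ fun i => (measurable_pi_apply (i : ℕ)).comp
        (measurable_mapNatBool 𝒳))
  have hce : ∀ m y y', c m y = c m y' ↔ ∀ i < m, mapNatBool 𝒳 y i = mapNatBool 𝒳 y' i := by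
    intro m y y'
    rw [Encodable.encode_inj, funext_iff]
    exact ⟨fun h i hi => h ⟨i, hi⟩, fun h i => h i i.2⟩
  let E : ℕ → Set Ω := fun m =>
    {ω | ∀ s ≤ n, ∀ t ≤ n, c m (X s ω) = c m (X t ω) → X s ω = X t ω}ᶜ
  have hE : ∀ m, MeasurableSet (E m) := by
    intro m
    refine MeasurableSet.compl ?_
    simp only [Set.ofPred_forall]
    refine MeasurableSet.iInter fun s => MeasurableSet.iInter fun _ => MeasurableSet.iInter fun t =>
      MeasurableSet.iInter fun _ => ?_
    exact (measurableSet_eq_fun ((hc m).comp (hX s)) ((hc m).comp (hX t))).imp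
      (measurableSet_eq_fun (hX s) (hX t))
  have hanti : Antitone E := by
    intro m m' hmm
    refine Set.compl_subset_compl.mpr fun ω h s hs t ht he => h s hs t ht ?_
    rw [hce] at he ⊢
    exact fun i hi => he i (hi.trans_le hmm)
  have hempty : ⋂ m, E m = ∅ := by
    rw [Set.eq_empty_iff_forall_notMem]
    intro ω hω
    -- a bit at which the contexts at the times `s` and `t` differ
    have hbit : ∀ s t, ∃ i, X s ω ≠ X t ω → mapNatBool 𝒳 (X s ω) i ≠ mapNatBool 𝒳 (X t ω) i := by
      intro s t
      by_cases h : X s ω = X t ω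
      · exact ⟨0, fun h' => absurd h h'⟩
      · obtain ⟨i, hi⟩ := Function.ne_iff.mp ((injective_mapNatBool 𝒳).ne h)
        exact ⟨i, fun _ => hi⟩
    choose b hb using hbit
    let m := ∑ s ∈ Finset.range (n + 1), ∑ t ∈ Finset.range (n + 1), (b s t + 1)
    refine Set.mem_iInter.mp hω m fun s hs t ht he => ?_
    by_contra hne
    refine hb s t hne ((hce _ _ _).mp he _ ?_)
    have h1 := Finset.single_le_sum (f := fun t => b s t + 1) (fun _ _ => Nat.zero_le _)
      (Finset.mem_range.mpr (Nat.lt_succ_of_le ht))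
    have h2 := Finset.single_le_sum (f := fun s => ∑ t ∈ Finset.range (n + 1), (b s t + 1))
      (fun _ _ => Nat.zero_le _) (Finset.mem_range.mpr (Nat.lt_succ_of_le hs))
    exact (Nat.lt_of_succ_le h1).trans_le h2
  have ht := tendsto_measure_iInter_atTop (μ := P) (fun m => (hE m).nullMeasurableSet) hanti
    ⟨0, measure_ne_top _ _⟩
  rw [hempty, measure_empty] at ht
  have hlt := (ht.eventually_lt_const (ENNReal.ofReal_pos.mpr hη)).exists
  obtain ⟨m, hm⟩ := hlt
  refine ⟨c m, hc m, ?_⟩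
  exact ENNReal.toReal_le_of_le_ofReal hη.le hm.le

end Measurability

/-! ### Hard stages from windows with many visits -/

section HardStages

variable {𝒳 : Type u} [MeasurableSpace 𝒳]

theorem Stage.slotMass_le_visits (S : Stage 𝒳) (B : Set 𝒳) (x : ℕ → 𝒳) (t₀ : ℕ) :
    S.slotMass B x t₀ ≤
      1 / (2 * (t₀ : ℝ)) * visits S.p B x (Finset.Ico t₀ (2 * t₀)) := by
  classical
  rw [Stage.slotMass, one_div, inv_mul_eq_div, Nat.cast_mul, Nat.cast_ofNat, visits_eq_sum_ind]
  refine div_le_div_of_nonneg_right ?_ (by positivity)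
  rw [Stage.slots, Finset.sum_filter]
  refine Finset.sum_le_sum fun t _ => ?_
  split_ifs with h
  · exact ind_mono fun hB => ⟨mem_firstTimes_of_comp h.2.2.2.2.2.2, hB⟩
  · exact ind_nonneg _

/-- If the cells separate the contexts, the slots of a window are the first times with context in
the set of the stage. -/
theorem Stage.visits_le_slotMass {S : Stage 𝒳} {x : ℕ → 𝒳} {t₀ : ℕ} (ha : S.a ≤ t₀) (hb : t₀ < S.b)
    (hs : x ∈ S.start t₀)
    (hc : ∀ s ≤ 2 * S.b, ∀ t ≤ 2 * S.b, S.cell (x s) = S.cell (x t) → x s = x t) :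
    1 / (2 * (t₀ : ℝ)) * visits S.p S.A x (Finset.Ico t₀ (2 * t₀)) ≤
      S.slotMass Set.univ x t₀ := by
  classical
  rw [Stage.slotMass, one_div, inv_mul_eq_div, Nat.cast_mul, Nat.cast_ofNat, visits_eq_sum_ind]
  refine div_le_div_of_nonneg_right ?_ (by positivity)
  rw [Stage.slots, Finset.sum_filter]
  refine Finset.sum_le_sum fun t ht => ?_
  rw [Finset.mem_Ico] at ht
  split_ifs with h
  · exact ind_mono fun _ => Set.mem_univ _
  · rw [ind_of_not]
    rintro ⟨h1, h2⟩
    exact h ⟨ha, hb, hs, ht.1, ht.2, h2, mem_firstTimes_comp hc (by omega) h1⟩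

variable [MeasurableEq 𝒳]
  {Ω : Type z} [MeasurableSpace Ω] {X : ℕ → Ω → 𝒳} {A : Set 𝒳}

theorem measurable_window_visits (hX : ∀ t, Measurable (X t)) (hA : MeasurableSet A) (p : ℕ)
    {σ : Ω → ℕ} (hσ : Measurable σ) : Measurable fun ω => 1 / (2 * (σ ω : ℝ)) *
      visits p A (fun t => X t ω) (Finset.Ico (σ ω) (2 * σ ω)) := by
  have : Measurable fun q : Ω × ℕ => 1 / (2 * (q.2 : ℝ)) *
      visits p A (fun t => X t q.1) (Finset.Ico q.2 (2 * q.2)) :=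
    measurable_from_prod_countable_left fun t₀ =>
      (measurable_visits hX hA p (Finset.Ico t₀ (2 * t₀))).const_mul (1 / (2 * (t₀ : ℝ)))
  exact this.comp (measurable_id.prodMk hσ)

theorem integrable_window_visits (hX : ∀ t, Measurable (X t)) (hA : MeasurableSet A) (p : ℕ)
    {σ : Ω → ℕ} (hσ : Measurable σ) {P : Measure Ω} [IsFiniteMeasure P] :
    Integrable (fun ω => 1 / (2 * (σ ω : ℝ)) *
      visits p A (fun t => X t ω) (Finset.Ico (σ ω) (2 * σ ω))) P :=
  integrable_of_abs_le (measurable_window_visits hX hA p hσ) 1 fun ω => by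
    rw [abs_of_nonneg (average_window_visits_nonneg _)]; exact average_window_visits_le_one _

open MeasurableSpace

variable [CountablyGenerated 𝒳] [SeparatesPoints 𝒳]

/-- Many new visits in random windows give a hard stage: a fine partition of the space separates all
contexts that matter. -/
theorem exists_isHard (hX : ∀ t, Measurable (X t)) {P : Measure Ω} [IsProbabilityMeasure P]
    {a b p g : ℕ} (hA : MeasurableSet A) {start : ℕ → Set (ℕ → 𝒳)}
    (hstart : ∀ t, MeasurableSet (start t)) (hcongr : ∀ t (x y : ℕ → 𝒳),
      (∀ s ∈ Finset.Icc 1 t, x s = y s) → (x ∈ start t ↔ y ∈ start t)) {σ : Ω → ℕ}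
    (hσ : Measurable σ)
    (hσs : ∀ ω, σ ω ≠ 0 → a ≤ σ ω ∧ σ ω < b ∧ (fun t => X t ω) ∈ start (σ ω))
    (hgap : ∀ ω t t', t < t' → a ≤ t → (fun t => X t ω) ∈ start t →
      (fun t => X t ω) ∈ start t' → g * t ≤ t') {ε : ℝ}
    (hmass : ε < ∫ ω, 1 / (2 * (σ ω : ℝ)) *
      visits p A (fun t => X t ω) (Finset.Ico (σ ω) (2 * σ ω)) ∂P) :
    ∃ S : Stage 𝒳, S.p = p ∧ S.A = A ∧ S.a = a ∧ S.IsHard P X σ g ε := by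
  obtain ⟨c, hc, hcP⟩ := exists_cell hX P (2 * b) (sub_pos.mpr hmass)
  let S : Stage 𝒳 := ⟨a, b, p, A, hA, c, hc, start, hstart, hcongr⟩
  refine ⟨S, rfl, rfl, rfl, hσ, hσs, hgap, ?_⟩
  set D : Set Ω := {ω | ∀ s ≤ 2 * b, ∀ t ≤ 2 * b, c (X s ω) = c (X t ω) → X s ω = X t ω}ᶜ with hD
  have hDm : MeasurableSet D := by
    refine MeasurableSet.compl ?_
    simp only [Set.ofPred_forall]
    refine MeasurableSet.iInter fun s => MeasurableSet.iInter fun _ => MeasurableSet.iInter fun t =>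
      MeasurableSet.iInter fun _ => ?_
    exact (measurableSet_eq_fun (hc.comp (hX s)) (hc.comp (hX t))).imp
      (measurableSet_eq_fun (hX s) (hX t))
  have hS := S.integrable_slotMass MeasurableSet.univ hX hσ (P := P)
  have hDi : Integrable (fun ω => ind (ω ∈ D)) P := integrable_ind hDm
  have := integral_mono (integrable_window_visits hX hA p hσ) (hS.add hDi) (fun ω => ?_)
  · simp only [Pi.add_apply] at this
    rw [integral_add hS hDi, integral_ind (p := fun ω => ω ∈ D) P hDm] at this
    have h2 : P.real {ω | ω ∈ D} = P.real D := rfl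
    rw [h2] at this
    linarith
  · simp only [Pi.add_apply]
    rcases eq_or_ne (σ ω) 0 with h0 | h0
    · simp only [h0, Nat.cast_zero, mul_zero, div_zero, zero_mul]
      exact add_nonneg (S.slotMass_nonneg ..) (ind_nonneg _)
    by_cases hω : ω ∈ D
    · rw [ind_of hω]
      have := S.slotMass_nonneg Set.univ (fun t => X t ω) (σ ω)
      have := average_window_visits_le_one (i := p) (A := A) (x := fun t => X t ω) (σ ω)
      linarith
    · rw [ind_of_not hω, add_zero]
      obtain ⟨h1, h2, h3⟩ := hσs ω h0
      exact Stage.visits_le_slotMass (S := S) h1 h2 h3 (not_not.mp hω)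

end HardStages

/-! ### Sparse selections of events that occur infinitely often -/

section Sparse

variable {Ω : Type z} [MeasurableSpace Ω]

/-- Of events that occur infinitely often, one occurs at an index in a finite set with large gaps,
with large probability. The residue classes modulo the gap are treated one after the other. -/
theorem exists_sparse_finset (P : Measure Ω) [IsProbabilityMeasure P] {H : ℕ → Set Ω}
    (hH : ∀ s, MeasurableSet (H s)) {g : ℕ} (hg : 0 < g) (l : ℕ) {η : ℝ} (hη : 0 < η) :
    ∃ S : Finset ℕ, (∀ s ∈ S, l ≤ s) ∧ (∀ s ∈ S, ∀ s' ∈ S, s < s' → s + g ≤ s') ∧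
      P.real ({ω | ∃ᶠ s in atTop, ω ∈ H s} \ ⋃ s ∈ S, H s) ≤ η := by
  have key : ∀ r, ∃ S : Finset ℕ, (∀ s ∈ S, l ≤ s) ∧
      (∀ s ∈ S, ∀ s' ∈ S, s < s' → s + g ≤ s') ∧
      P.real ({ω | ∃ᶠ s in atTop, s % g < r ∧ ω ∈ H s} \ ⋃ s ∈ S, H s) ≤ r * (η / g) := by
    intro r
    induction r with
    | zero => exact ⟨∅, by simp, by simp, by simp⟩
    | succ r ih =>
      obtain ⟨S, hSl, hSg, hSP⟩ := ih
      let m := l + ∑ s ∈ S, (s + g)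
      have hm : ∀ s ∈ S, s + g ≤ m := fun s hs =>
        (Finset.single_le_sum (f := fun s => s + g) (fun _ _ => Nat.zero_le _) hs).trans
          (Nat.le_add_left _ _)
      let I : ℕ → Finset ℕ := fun n => (Finset.Ico m n).filter fun s => s % g = r
      let U : Set Ω := ⋃ s, ⋃ _ : m ≤ s ∧ s % g = r, H s
      let Q : ℕ → Set Ω := fun n => U \ ⋃ s ∈ I n, H s
      have hQ : ∀ n, MeasurableSet (Q n) := fun n =>
        (MeasurableSet.iUnion fun s => MeasurableSet.iUnion fun _ => hH s).diff
          (Finset.measurableSet_biUnion _ fun s _ => hH s)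
      have hanti : Antitone Q := fun n n' hn => Set.sdiff_subset_sdiff_right <|
        Set.biUnion_subset_biUnion_left <| Finset.coe_subset.mpr <|
          Finset.filter_subset_filter _ (Finset.Ico_subset_Ico_right hn)
      have hempty : ⋂ n, Q n = ∅ := by
        rw [Set.eq_empty_iff_forall_notMem]
        intro ω hω
        rw [Set.mem_iInter] at hω
        obtain ⟨s, ⟨h1, h2⟩, hs⟩ := Set.mem_iUnion₂.mp (hω 0).1
        exact (hω (s + 1)).2 (Set.mem_biUnion (Finset.mem_coe.mpr (Finset.mem_filter.mpr
          ⟨Finset.mem_Ico.mpr ⟨h1, Nat.lt_succ_self s⟩, h2⟩)) hs)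
      have ht := tendsto_measure_iInter_atTop (μ := P) (fun n => (hQ n).nullMeasurableSet) hanti
        ⟨0, measure_ne_top _ _⟩
      rw [hempty, measure_empty] at ht
      have hηg : 0 < η / g := by positivity
      obtain ⟨n, hn⟩ := (ht.eventually_lt_const (ENNReal.ofReal_pos.mpr hηg)).exists
      have hn' : P.real (Q n) ≤ η / g := ENNReal.toReal_le_of_le_ofReal hηg.le hn.le
      have hI : ∀ s, s ∈ I n ↔ (m ≤ s ∧ s < n) ∧ s % g = r := fun s => by
        rw [Finset.mem_filter, Finset.mem_Ico]
      refine ⟨S ∪ I n, fun s hs => ?_, fun s hs s' hs' hss => ?_, ?_⟩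
      · rcases Finset.mem_union.mp hs with hs | hs
        · exact hSl s hs
        · exact (Nat.le_add_right _ _).trans ((hI s).mp hs).1.1
      · rcases Finset.mem_union.mp hs with hs | hs <;> rcases Finset.mem_union.mp hs' with hs' | hs'
        · exact hSg s hs s' hs' hss
        · exact (hm s hs).trans ((hI s').mp hs').1.1
        · have h1 := hm s' hs'
          have h2 := ((hI s).mp hs).1.1
          omega
        · have h : s ≡ s' [MOD g] := (((hI s).mp hs).2).trans ((hI s').mp hs').2.symm
          have := Nat.le_of_dvd (Nat.sub_pos_of_lt hss) ((Nat.modEq_iff_dvd' hss.le).mp h)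
          omega
      · have hsub : {ω | ∃ᶠ s in atTop, s % g < r + 1 ∧ ω ∈ H s} \ ⋃ s ∈ S ∪ I n, H s ⊆
            ({ω | ∃ᶠ s in atTop, s % g < r ∧ ω ∈ H s} \ ⋃ s ∈ S, H s) ∪ Q n := by
          rintro ω ⟨hω, hωS⟩
          simp only [Set.mem_iUnion, not_exists, Finset.mem_union] at hωS
          by_cases hr : ∃ᶠ s in atTop, s % g < r ∧ ω ∈ H s
          · refine Or.inl ⟨hr, fun h => ?_⟩
            obtain ⟨s, hs, hsω⟩ := Set.mem_iUnion₂.mp h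
            exact hωS s (Or.inl hs) hsω
          · refine Or.inr ⟨?_, fun h => ?_⟩
            · obtain ⟨s, ⟨hs1, hs2⟩, hs3, hs4⟩ := (Frequently.and_eventually hω
                ((not_frequently.mp hr).and (eventually_ge_atTop m))).exists
              exact Set.mem_iUnion₂.mpr ⟨s, ⟨hs4, by
                by_contra hne
                exact hs3 ⟨by omega, hs2⟩⟩, hs2⟩
            · obtain ⟨s, hs, hsω⟩ := Set.mem_iUnion₂.mp h
              exact hωS s (Or.inr hs) hsω
        refine (measureReal_mono hsub).trans ((measureReal_union_le _ _).trans ?_)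
        push_cast
        linarith
  obtain ⟨S, h1, h2, h3⟩ := key g
  refine ⟨S, h1, h2, ?_⟩
  have e : (g : ℝ) * (η / g) = η := by field_simp
  rw [e] at h3
  convert h3 using 5 with ω
  exact frequently_congr (Eventually.of_forall fun s => by simp [Nat.mod_lt s hg])

/-- The start `2 ^ s` of a dyadic period with `ω ∈ H s`, `s ∈ S`, can be selected measurably; the
value `0` means that there is none. -/
theorem exists_measurable_selection (S : Finset ℕ) {H : ℕ → Set Ω} (hH : ∀ s, MeasurableSet (H s)) :
    ∃ σ : Ω → ℕ, Measurable σ ∧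
      ∀ ω, (σ ω = 0 ∧ ω ∉ ⋃ s ∈ S, H s) ∨ ∃ s ∈ S, σ ω = 2 ^ s ∧ ω ∈ H s := by
  classical
  induction S using Finset.induction_on with
  | empty => exact ⟨fun _ => 0, measurable_const, fun ω => Or.inl ⟨rfl, by simp⟩⟩
  | insert s S _ ih =>
    obtain ⟨σ, hσ, h⟩ := ih
    refine ⟨fun ω => if ω ∈ H s then 2 ^ s else σ ω,
      Measurable.ite (hH s) measurable_const hσ, fun ω => ?_⟩
    by_cases hs : ω ∈ H s
    · exact Or.inr ⟨s, Finset.mem_insert_self s S, if_pos hs, hs⟩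
    · simp only [if_neg hs]
      refine (h ω).imp (fun h => ⟨h.1, ?_⟩) fun ⟨s', h1, h2⟩ =>
        ⟨s', Finset.mem_insert_of_mem h1, h2⟩
      rw [Finset.set_biUnion_insert]
      exact fun h' => h'.elim hs h.2

end Sparse

/-! ### Stopping times of the context filtration -/

section Filtration

variable {𝒳 : Type u} [MeasurableSpace 𝒳] {Ω : Type z} [mΩ : MeasurableSpace Ω] {X : ℕ → Ω → 𝒳}

/-- The events of the filtration generated by the contexts are determined by the past contexts. -/
theorem exists_eq_preimage_of_contextFiltration (hX : ∀ t, Measurable (X t)) {t : ℕ} {E : Set Ω}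
    (hE : MeasurableSet[contextFiltration X hX t] E) : ∃ B : Set (ℕ → 𝒳), MeasurableSet B ∧
      (∀ x y : ℕ → 𝒳, (∀ s ∈ Finset.Icc 1 t, x s = y s) → (x ∈ B ↔ y ∈ B)) ∧
      ∀ ω, ω ∈ E ↔ (fun t => X t ω) ∈ B := by
  have e : contextFiltration X hX t =
      MeasurableSpace.comap (fun ω (s : Finset.Icc 1 t) => X s ω) MeasurableSpace.pi := by
    change (⨆ s ∈ Finset.Icc 1 t, MeasurableSpace.comap (X s) inferInstance) = _
    rw [MeasurableSpace.pi, MeasurableSpace.comap_iSup, iSup_subtype']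
    simp only [MeasurableSpace.comap_comp]
    rfl
  rw [e] at hE
  obtain ⟨B, hB, rfl⟩ := hE
  refine ⟨(fun x (s : Finset.Icc 1 t) => x s) ⁻¹' B,
    (measurable_pi_lambda (fun (x : ℕ → 𝒳) (s : Finset.Icc 1 t) => x s)
      fun s => measurable_pi_apply (s : ℕ)) hB, fun x y hxy => ?_,
    fun ω => Iff.rfl⟩
  have : (fun s : Finset.Icc 1 t => x s) = fun s : Finset.Icc 1 t => y s :=
    funext fun s => hxy s s.2
  rw [Set.mem_preimage, Set.mem_preimage, this]

theorem measurable_of_isStoppingTime {m : Filtration ℕ mΩ} {τ : Ω → ℕ}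
    (hτ : IsStoppingTime m fun ω => (τ ω : WithTop ℕ)) : Measurable τ := by
  refine measurable_to_countable' fun n => ?_
  have := m.le n _ (hτ.measurableSet_eq n)
  convert this using 1
  ext ω
  simp

end Filtration

/-! ### Hard stages when the conditions fail -/

section Reductions

open MeasurableSpace

variable {𝒳 : Type u} [MeasurableSpace 𝒳] [MeasurableEq 𝒳] {Ω : Type z} [MeasurableSpace Ω]
  {X : ℕ → Ω → 𝒳}
  {P : Measure Ω} [IsProbabilityMeasure P] {A : Set 𝒳} {p : ℕ} {ε : ℝ}

/-- A set with small limit submeasure has few slots in late windows, by the reverse Fatou lemma. -/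
theorem exists_forall_integral_slotMass_le (hX : ∀ t, Measurable (X t)) {B : Set 𝒳}
    (hB : MeasurableSet B) {d η : ℝ} (hη : 0 < η)
    (h : ∫ ω, limitSubmeasure p (fun t => X t ω) B ∂P ≤ d) :
    ∃ a₀, ∀ (S : Stage 𝒳) (σ : Ω → ℕ), S.p = p → a₀ ≤ S.a → Measurable σ →
      (∀ ω, σ ω = 0 ∨ S.a ≤ σ ω) →
      ∫ ω, S.slotMass B (fun t => X t ω) (σ ω) ∂P ≤ d + η := by
  by_contra! hcon
  choose S σ hp ha hσ hσ0 hlt using hcon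
  have hev := eventually_integral_le (μ := P)
    (F := fun n ω => (S n).slotMass B (fun t => X t ω) (σ n ω))
    (G := fun ω => limitSubmeasure p (fun t => X t ω) B)
    (fun n => (S n).measurable_slotMass_comp hB hX (hσ n))
    (fun n ω => by rw [abs_of_nonneg ((S n).slotMass_nonneg ..)]; exact (S n).slotMass_le_one ..)
    (integrable_limitSubmeasure hX hB p) (Eventually.of_forall fun ω η hη => ?_) hη
  · obtain ⟨n, hn⟩ := hev.exists
    linarith [hlt n]
  · obtain ⟨N, hN⟩ := eventually_atTop.mp (eventually_visits_le p (fun t => X t ω) B hη)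
    have hG := limitSubmeasure_nonneg p (fun t => X t ω) B
    filter_upwards [eventually_ge_atTop (N + 1)] with n hn
    rcases hσ0 n ω with h0 | h0
    · simp only [h0, Stage.slotMass, mul_zero, Nat.cast_zero, div_zero]
      linarith
    · have h1 : N + 1 ≤ σ n ω := hn.trans ((ha n).trans h0)
      have h2 := hN (2 * σ n ω) (by omega)
      have h3 := (S n).slotMass_le_visits B (fun t => X t ω) (σ n ω)
      rw [hp] at h3
      refine h3.trans ?_
      have h4 : (0 : ℝ) < σ n ω := by exact_mod_cast (by omega : 0 < σ n ω)
      rw [one_div, inv_mul_eq_div, div_le_iff₀ (by positivity)]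
      refine (visits_mono fun t ht => ?_).trans (h2.trans_eq ?_)
      · rw [Finset.mem_Ico] at ht
        rw [Finset.mem_Icc]
        omega
      · push_cast; ring

variable [CountablyGenerated 𝒳] [SeparatesPoints 𝒳]

/-- A set with large limit submeasure gives hard stages whose windows are dyadic periods. -/
theorem exists_isHard_of_limitSubmeasure (hX : ∀ t, Measurable (X t)) (hA : MeasurableSet A)
    (hε : 0 < ε) (h : ε ≤ ∫ ω, limitSubmeasure p (fun t => X t ω) A ∂P) (a g : ℕ) :
    ∃ (S : Stage 𝒳) (σ : Ω → ℕ), S.p = p ∧ S.A = A ∧ a ≤ S.a ∧ S.IsHard P X σ g (ε ^ 2 / 64) := by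
  classical
  -- with this value, the limit submeasure is at most `4 * c = ε / 4` where few periods are heavy
  let c := ε / 16
  have hc : 0 < c := by positivity
  let H : ℕ → Set Ω := fun s =>
    {ω | c * 2 ^ (s + 1) ≤ visits p A (fun t => X t ω) (Finset.Ico (2 ^ s) (2 * 2 ^ s))}
  have hH : ∀ s, MeasurableSet (H s) := fun s =>
    measurableSet_le measurable_const (measurable_visits hX hA p _)
  obtain ⟨I, hIa, hIg, hIP⟩ := exists_sparse_finset P hH (Nat.succ_pos g) a
    (show 0 < ε / 4 by positivity)
  obtain ⟨σ, hσ, hσI⟩ := exists_measurable_selection I hH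
  set U : Set Ω := ⋃ s ∈ I, H s with hU
  have hUm : MeasurableSet U := Finset.measurableSet_biUnion _ fun s _ => hH s
  have hpow : ∀ {s s' : ℕ}, s ∈ I → s' ∈ I → 2 ^ s < 2 ^ s' → g * 2 ^ s ≤ 2 ^ s' := by
    intro s s' hs hs' hlt
    have h1 := hIg s hs s' hs' ((Nat.pow_lt_pow_iff_right one_lt_two).mp hlt)
    calc g * 2 ^ s ≤ 2 ^ (g + 1) * 2 ^ s :=
          Nat.mul_le_mul_right _ (Nat.lt_two_pow_self.le.trans
            (Nat.pow_le_pow_right two_pos (Nat.le_succ g)))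
      _ = 2 ^ (s + (g + 1)) := by ring
      _ ≤ 2 ^ s' := Nat.pow_le_pow_right two_pos h1
  have hmass : ε ^ 2 / 64 < ∫ ω, 1 / (2 * (σ ω : ℝ)) *
      visits p A (fun t => X t ω) (Finset.Ico (σ ω) (2 * σ ω)) ∂P := by
    -- the window average is at least `c` on `U`
    have h1 : c * P.real U ≤ ∫ ω, 1 / (2 * (σ ω : ℝ)) *
        visits p A (fun t => X t ω) (Finset.Ico (σ ω) (2 * σ ω)) ∂P := by
      have h2 : ∫ ω, c * ind (ω ∈ U) ∂P = c * P.real U := by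
        rw [integral_const_mul, integral_ind (p := fun ω => ω ∈ U) P hUm]; rfl
      rw [← h2]
      refine integral_mono ((integrable_ind hUm).const_mul c) (integrable_window_visits hX hA p hσ)
        fun ω => ?_
      rcases hσI ω with h | ⟨s, hs, hσs, hsω⟩
      · simp only [ind_of_not h.2, mul_zero]
        exact average_window_visits_nonneg _
      · have hU' : ω ∈ U := Set.mem_biUnion (Finset.mem_coe.mpr hs) hsω
        rw [ind_of hU', mul_one]
        simp only [hσs]
        push_cast
        rw [one_div, inv_mul_eq_div, le_div_iff₀ (by positivity)]
        have : c * 2 ^ (s + 1) ≤ visits p A (fun t => X t ω) (Finset.Ico (2 ^ s) (2 * 2 ^ s)) := hsω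
        rw [pow_succ] at this
        linarith
    -- the limit submeasure is above `4 c` with large probability
    let M : Set Ω := {ω | 4 * c < limitSubmeasure p (fun t => X t ω) A}
    have hM : MeasurableSet M := measurableSet_lt measurable_const
      (measurable_limitSubmeasure hX hA p)
    have h3 : ε ≤ 4 * c + P.real M := by
      refine h.trans ?_
      have hi : Integrable (fun ω => ind (ω ∈ M)) P := integrable_ind hM
      have e : ∫ ω, (4 * c + ind (ω ∈ M)) ∂P = 4 * c + P.real M := by
        rw [integral_add (integrable_const _) hi, integral_ind (p := fun ω => ω ∈ M) P hM]
        simp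
      rw [← e]
      refine integral_mono (integrable_limitSubmeasure hX hA p) ((integrable_const _).add hi)
        fun ω => ?_
      change _ ≤ 4 * c + ind (ω ∈ M)
      by_cases hω : ω ∈ M
      · rw [ind_of hω]
        linarith [limitSubmeasure_le_one p (fun t => X t ω) A]
      · rw [ind_of_not hω, add_zero]
        exact not_lt.mp hω
    have h4 : P.real M ≤ P.real U + ε / 4 := by
      have hMU : M ⊆ U ∪ ({ω | ∃ᶠ s in atTop, ω ∈ H s} \ U) := by
        rw [Set.union_sdiff_self]
        exact fun ω hω => Or.inr (frequently_visits_of_lt_limitSubmeasure hc hω)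
      exact (measureReal_mono hMU).trans ((measureReal_union_le _ _).trans
        (add_le_add_right hIP _))
    have h5 : ε / 2 ≤ P.real U := by
      have : 4 * c = ε / 4 := by simp only [c]; ring
      linarith
    refine lt_of_lt_of_le ?_ h1
    have h6 := mul_le_mul_of_nonneg_left h5 hc.le
    refine lt_of_lt_of_le ?_ h6
    have e : c * (ε / 2) = ε ^ 2 / 32 := by simp only [c]; ring
    rw [e]
    have : 0 < ε ^ 2 := by positivity
    linarith
  have hstart : ∀ ω, σ ω ≠ 0 → a ≤ σ ω ∧ σ ω < ∑ s ∈ I, 2 ^ s + 1 ∧ ∃ s ∈ I, σ ω = 2 ^ s := by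
    intro ω h0
    rcases hσI ω with h | ⟨s, hs, hσs, -⟩
    · exact absurd h.1 h0
    · rw [hσs]
      refine ⟨(hIa s hs).trans Nat.lt_two_pow_self.le, Nat.lt_succ_of_le ?_, s, hs, rfl⟩
      exact Finset.single_le_sum (f := fun s => 2 ^ s) (fun _ _ => Nat.zero_le _) hs
  obtain ⟨S, hSp, hSA, hSa, hS⟩ := exists_isHard (g := g) hX hA
    (start := fun t => {_x | ∃ s ∈ I, t = 2 ^ s})
    (fun t => MeasurableSet.const _) (fun t x y _ => Iff.rfl) hσ hstart
    (by rintro ω _ _ hlt - ⟨s, hs, rfl⟩ ⟨s', hs', rfl⟩; exact hpow hs hs' hlt) hmass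
  exact ⟨S, σ, hSp, hSA, hSa.ge, hS⟩

/-- A stopping time with many new visits gives a hard stage whose only window starts at the
stopping time. -/
theorem exists_isHard_of_isStoppingTime (hX : ∀ t, Measurable (X t)) (hA : MeasurableSet A)
    {τ : Ω → ℕ} (hτ : IsStoppingTime (contextFiltration X hX) fun ω => (τ ω : WithTop ℕ)) {a : ℕ}
    (ha : ∀ ω, a ≤ τ ω)
    (h : ε < ∫ ω, 1 / (2 * (τ ω : ℝ)) *
      visits p A (fun t => X t ω) (Finset.Ico (τ ω) (2 * τ ω)) ∂P) (g : ℕ) :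
    ∃ (S : Stage 𝒳) (σ : Ω → ℕ), S.p = p ∧ S.A = A ∧ a ≤ S.a ∧ S.IsHard P X σ g ε := by
  classical
  have hτm := measurable_of_isStoppingTime hτ
  let σ : ℕ → Ω → ℕ := fun b ω => if τ ω < b then τ ω else 0
  have hσ : ∀ b, Measurable (σ b) := fun b =>
    Measurable.ite (measurableSet_lt hτm measurable_const) hτm measurable_const
  -- truncation of the stopping time
  have ht : Tendsto (fun b => ∫ ω, 1 / (2 * (σ b ω : ℝ)) *
      visits p A (fun t => X t ω) (Finset.Ico (σ b ω) (2 * σ b ω)) ∂P) atTop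
      (𝓝 (∫ ω, 1 / (2 * (τ ω : ℝ)) *
        visits p A (fun t => X t ω) (Finset.Ico (τ ω) (2 * τ ω)) ∂P)) := by
    refine tendsto_integral_of_dominated_convergence (fun _ => 1)
      (fun b => (measurable_window_visits hX hA p (hσ b)).aestronglyMeasurable)
      (integrable_const 1) (fun b => Eventually.of_forall fun ω => ?_)
      (Eventually.of_forall fun ω => ?_)
    · rw [Real.norm_of_nonneg (average_window_visits_nonneg _)]
      exact average_window_visits_le_one _
    · refine tendsto_const_nhds.congr' ?_
      filter_upwards [eventually_gt_atTop (τ ω)] with b hb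
      simp only [σ, if_pos hb]
  obtain ⟨b, hb⟩ := (ht.eventually_const_lt h).exists
  choose B hBm hBc hB using fun t => exists_eq_preimage_of_contextFiltration hX
    (hτ.measurableSet_eq t)
  have hB' : ∀ ω t, (fun t => X t ω) ∈ B t ↔ τ ω = t := fun ω t => by
    rw [← hB]; simp
  have hstart : ∀ ω, σ b ω ≠ 0 →
      a ≤ σ b ω ∧ σ b ω < b ∧ (fun t => X t ω) ∈ B (σ b ω) := by
    intro ω h0
    by_cases hlt : τ ω < b
    · have e : σ b ω = τ ω := if_pos hlt
      rw [e]
      exact ⟨ha ω, hlt, (hB' ω _).mpr rfl⟩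
    · exact absurd (if_neg hlt) h0
  obtain ⟨S, hSp, hSA, hSa, hS⟩ := exists_isHard (P := P) (a := a) (b := b) (g := g) hX hA
    (start := B) hBm hBc (hσ b) hstart (fun ω t t' hlt _ h1 h2 => by rw [hB'] at h1 h2; omega) hb
  exact ⟨S, σ b, hSp, hSA, hSa.ge, hS⟩

end Reductions

/-! ### Monotonicity of the deviation levels -/

section Levels

theorem scaleTime_succ_two_mul (i k : ℕ) : scaleTime (i + 1) (2 * k) = scaleTime i k := by
  have h1 : 2 * k / 2 ^ (i + 1) = k / 2 ^ i := by
    rw [pow_succ', Nat.mul_div_mul_left _ _ two_pos]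
  have h2 : 2 * k % 2 ^ (i + 1) = 2 * (k % 2 ^ i) := by
    rw [pow_succ', Nat.mul_mod_mul_left]
  rw [scaleTime, scaleTime, h1, h2, pow_succ' 2 i, ← mul_add, mul_left_comm,
    Nat.mul_div_mul_left _ _ two_pos]

/-- The periods of scale `i + 1` refine those of scale `i`. -/
theorem firstTimes_subset_succ {α : Type*} (i : ℕ) (x : ℕ → α) :
    firstTimes i x ⊆ firstTimes (i + 1) x := by
  rintro t ⟨h1, k, hk1, hk2, hk⟩
  rw [← scaleTime_succ_two_mul i] at hk1 hk2
  rcases lt_or_ge t (scaleTime (i + 1) (2 * k + 1)) with h | h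
  · exact ⟨h1, 2 * k, hk1, h, fun t' h' => hk t' (scaleTime_succ_two_mul i k ▸ h')⟩
  · refine ⟨h1, 2 * k + 1, h, hk2, fun t' h' => hk t' ?_⟩
    rw [← scaleTime_succ_two_mul i]
    exact (scaleTime_mono (i + 1) (Nat.le_succ _)).trans h'

theorem visits_le_succ {𝒳 : Type u} (i : ℕ) (A : Set 𝒳) (x : ℕ → 𝒳) (I : Finset ℕ) :
    visits i A x I ≤ visits (i + 1) A x I := by
  rw [visits_eq_sum_ind, visits_eq_sum_ind]
  exact Finset.sum_le_sum fun t _ => ind_mono (And.imp_left fun h => firstTimes_subset_succ i x h)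

theorem Real.sSup_le_sSup_of_nonneg {s t : Set ℝ} (h : s ⊆ t) (ht : BddAbove t)
    (h0 : ∀ x ∈ t, 0 ≤ x) : sSup s ≤ sSup t :=
  Real.sSup_le (fun _ hx => le_csSup ht (h hx)) (Real.sSup_nonneg h0)

variable {𝒳 : Type u} [MeasurableSpace 𝒳] {Ω : Type z} [MeasurableSpace Ω] {P : Measure Ω}
  {X : ℕ → Ω → 𝒳} {hX : ∀ t, Measurable (X t)} {p T : ℕ} {ε : ℝ}

theorem deviationLevel_le_one : deviationLevel P X hX p ε T ≤ 1 :=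
  Real.sSup_le (fun _ h => h.2.1) zero_le_one

theorem monotone_deviationLevel (p : ℕ) (ε : ℝ) : Monotone (deviationLevel P X hX p ε) := by
  intro T T' hT
  exact Real.sSup_le_sSup_of_nonneg (fun δ hδ => ⟨hδ.1, hδ.2.1, fun A hA hAδ τ hτ hτT =>
    hδ.2.2 A hA hAδ τ hτ fun ω => hT.trans (hτT ω)⟩) ⟨1, fun _ h => h.2.1⟩ fun _ h => h.1

/-- A finer scale has more first times, so the condition in the supremum is more restrictive. -/
theorem deviationLevel_succ_le [MeasurableEq 𝒳] [IsProbabilityMeasure P] :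
    deviationLevel P X hX (p + 1) ε T ≤ deviationLevel P X hX p ε T := by
  refine Real.sSup_le_sSup_of_nonneg (fun δ hδ => ⟨hδ.1, hδ.2.1, fun A hA hAδ τ hτ hτT =>
    le_trans ?_ (hδ.2.2 A hA hAδ τ hτ hτT)⟩) ⟨1, fun _ h => h.2.1⟩ fun _ h => h.1
  have hτm := measurable_of_isStoppingTime hτ
  exact integral_mono (integrable_window_visits hX hA p hτm)
    (integrable_window_visits hX hA (p + 1) hτm) fun ω =>
      mul_le_mul_of_nonneg_left (visits_le_succ p A _ _) (by positivity)

theorem exists_of_deviationLevel_lt {d : ℝ} (hd : 0 ≤ d) (hd1 : d ≤ 1)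
    (h : deviationLevel P X hX p ε T < d) : ∃ A : Set 𝒳, MeasurableSet A ∧
      (⨆ l : ℕ, ∫ ω, limitSubmeasure l (fun t => X t ω) A ∂P) ≤ d ∧
      ∃ τ : Ω → ℕ, IsStoppingTime (contextFiltration X hX) (fun ω => (τ ω : WithTop ℕ)) ∧
        (∀ ω, T ≤ τ ω) ∧ ε < ∫ ω, (1 / (2 * (τ ω : ℝ))) *
          visits p A (fun t => X t ω) (Finset.Ico (τ ω) (2 * τ ω)) ∂P := by
  by_contra! hcon
  exact h.not_ge (le_csSup ⟨1, fun _ h => h.2.1⟩ ⟨hd, hd1, hcon⟩)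

end Levels

/-! ### The two conditions are necessary -/

section Final

open MeasurableSpace

variable {𝒳 : Type u} [MeasurableSpace 𝒳] [CountablyGenerated 𝒳] [SeparatesPoints 𝒳]
  [MeasurableEq 𝒳] {𝒜 : Type v} [MeasurableSpace 𝒜] [MeasurableSingletonClass 𝒜] [Countable 𝒜]
  {Ω : Type z} [MeasurableSpace Ω] {P : Measure Ω} [IsProbabilityMeasure P] {X : ℕ → Ω → 𝒳}

/-- For a learnable process, the condition on disjoint sets holds. Otherwise, infinitely many of the
sets would be visited with constant density on dyadic periods. -/
theorem OnlineLearnable.conditionFour (hX : ∀ t, Measurable (X t)) {a₀ a₁ : 𝒜} (hne : a₁ ≠ a₀)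
    (hlearn : OnlineLearnable.{u, v, w, z} P X 𝒜) : ConditionFour P X := by
  intro A hA hdisj
  by_contra hnot
  simp only [Metric.tendsto_atTop, not_forall, not_exists, not_lt] at hnot
  obtain ⟨ε, hε, hfreq⟩ := hnot
  have hfreq' : ∀ N, ∃ n > N, ε ≤ ∫ ω, limitSubmeasure n (fun t => X t ω) (A n) ∂P := by
    intro N
    obtain ⟨n, hn, h⟩ := hfreq (N + 1)
    rw [Real.dist_eq, sub_zero, abs_of_nonneg (integral_limitSubmeasure_nonneg ..)] at h
    exact ⟨n, hn, h⟩
  obtain ⟨φ, hφ, hφε⟩ := Nat.exists_strictMono_subsequence hfreq'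
  refine not_onlineLearnable_of_isHard hne hX (show 0 < ε ^ 2 / 64 by positivity) (p := φ)
    (C := fun i => {A (φ i)}) (δ := fun _ => 0) (fun i a g => ?_) (fun n => ?_) ?_ hlearn
  · exact exists_isHard_of_limitSubmeasure hX (hA _) hε (hφε i) a g
  · simp only [Finset.sum_const_zero]; positivity
  · rintro j i hji _ rfl
    refine ⟨0, fun S σ _ hSA _ _ _ => le_of_eq ?_⟩
    -- the slots of a stage lie in its set, which is disjoint from the sets of the other types
    have h0 : ∀ ω, S.slotMass (A (φ j)) (fun t => X t ω) (σ ω) = 0 := by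
      intro ω
      rw [Stage.slotMass, Finset.sum_eq_zero, zero_div]
      intro t ht
      refine ind_of_not fun h => ?_
      have h' := (Stage.mem_slots.mp ht).2.2.2.2.2.1
      rw [hSA] at h'
      exact Set.disjoint_left.mp (hdisj (hφ.injective.ne hji.ne)) h h'
    simp [h0]

/-- For a learnable process, the deviation levels are bounded below. Otherwise there would be sets
`A_i` with summably small limit submeasures that are visited with constant density after arbitrarily
late stopping times. -/
theorem OnlineLearnable.exists_le_deviationLevel (hX : ∀ t, Measurable (X t)) {a₀ a₁ : 𝒜}
    (hne : a₁ ≠ a₀) (hlearn : OnlineLearnable.{u, v, w, z} P X 𝒜) {ε : ℝ} (hε : 0 < ε) :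
    ∃ d : ℝ, 0 < d ∧ ∀ p, ∃ T, d ≤ deviationLevel P X hX p ε T := by
  by_contra! hcon
  -- levels in `[0, 1]`, as in the supremum, with `∑ i, 2 * d i ≤ ε / 32`
  let d : ℕ → ℝ := fun i => min 1 (ε / 128) * (1 / 2) ^ i
  have hm : 0 < min 1 (ε / 128) := lt_min one_pos (by positivity)
  have hd0 : ∀ i, 0 < d i := fun i => by positivity
  have hd1 : ∀ i, d i ≤ 1 := fun i => mul_le_one₀ (min_le_left _ _) (by positivity)
    (pow_le_one₀ (by norm_num) (by norm_num))
  choose p hp using fun i => hcon (d i) (hd0 i)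
  refine not_onlineLearnable_of_isHard hne hX hε (p := p)
    (C := fun i => {A | MeasurableSet A ∧
      (⨆ l : ℕ, ∫ ω, limitSubmeasure l (fun t => X t ω) A ∂P) ≤ d i})
    (δ := fun i => d i + d i) (fun i a g => ?_) (fun n => ?_) ?_ hlearn
  · obtain ⟨A, hA, hAd, τ, hτ, hτa, hτε⟩ := exists_of_deviationLevel_lt (hd0 i).le (hd1 i) (hp i a)
    obtain ⟨S, σ, hSp, hSA, hSa, hS⟩ := exists_isHard_of_isStoppingTime hX hA hτ hτa hτε g
    exact ⟨S, σ, hSp, by rw [hSA]; exact ⟨hA, hAd⟩, hSa, hS⟩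
  · have hsum : ∑ i ∈ Finset.range n, ((1 : ℝ) / 2) ^ i ≤ 2 := sum_geometric_two_le n
    calc ∑ i ∈ Finset.range n, (d i + d i)
        = 2 * min 1 (ε / 128) * ∑ i ∈ Finset.range n, ((1 : ℝ) / 2) ^ i := by
          rw [Finset.mul_sum]
          exact Finset.sum_congr rfl fun i _ => by simp only [d]; ring
      _ ≤ 2 * (ε / 128) * 2 := by
          have := min_le_right 1 (ε / 128)
          gcongr
      _ = ε / 32 := by ring
  · rintro j i - B ⟨hB, hBd⟩
    have hle : ∫ ω, limitSubmeasure (p i) (fun t => X t ω) B ∂P ≤ d j := by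
      refine (le_ciSup (f := fun l : ℕ => ∫ ω, limitSubmeasure l (fun t => X t ω) B ∂P)
        ⟨1, ?_⟩ (p i)).trans hBd
      rintro _ ⟨l, rfl⟩
      exact integral_limitSubmeasure_le_one hX hB l P
    obtain ⟨a₀, ha₀⟩ := exists_forall_integral_slotMass_le hX hB (hd0 j) hle
    exact ⟨a₀, fun S σ hSp _ ha hσ hσ0 => ha₀ S σ hSp ha hσ hσ0⟩

end Final

theorem mainTheorem4
    {𝒳 : Type u} [TopologicalSpace 𝒳] [TopologicalSpace.SeparableSpace 𝒳]
    [TopologicalSpace.MetrizableSpace 𝒳] [MeasurableSpace 𝒳] [BorelSpace 𝒳]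
    {𝒜 : Type v} [MeasurableSpace 𝒜] [MeasurableSingletonClass 𝒜] [Finite 𝒜]
    (h𝒜 : 2 ≤ Nat.card 𝒜)
    {Ω : Type z} [MeasurableSpace Ω] (P : Measure Ω) [IsProbabilityMeasure P]
    (X : ℕ → Ω → 𝒳) (hX : ∀ t, Measurable (X t))
    (hlearn : OnlineLearnable.{u, v, w, z} P X 𝒜) :
    ConditionSix P X hX := by
  have : SecondCountableTopology 𝒳 := by
    let := TopologicalSpace.metrizableSpaceMetric 𝒳
    exact UniformSpace.secondCountable_of_separable 𝒳
  have : Nontrivial 𝒜 := Finite.one_lt_card_iff_nontrivial.mp h𝒜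
  obtain ⟨a₀, a₁, hne⟩ := exists_pair_ne 𝒜
  refine ⟨hlearn.conditionFour hX hne.symm, fun ε hε => ?_⟩
  have hbdd : ∀ p, BddAbove (Set.range (deviationLevel P X hX p ε)) := fun p =>
    ⟨1, by rintro _ ⟨T, rfl⟩; exact deviationLevel_le_one⟩
  let δ : ℕ → ℝ := fun p => ⨆ T, deviationLevel P X hX p ε T
  have hδ : Antitone δ := antitone_nat_of_succ_le fun p =>
    ciSup_mono (hbdd p) fun T => deviationLevel_succ_le
  obtain ⟨d, hd, hdp⟩ := hlearn.exists_le_deviationLevel hX hne.symm hε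
  have hdδ : ∀ p, d ≤ δ p := fun p => (hdp p).elim fun T hT => hT.trans (le_ciSup (hbdd p) T)
  exact ⟨δ, fun p => tendsto_atTop_ciSup (monotone_deviationLevel p ε) (hbdd p), ⨅ p, δ p,
    hd.trans_le (le_ciInf hdδ),
    tendsto_atTop_ciInf hδ ⟨d, by rintro _ ⟨p, rfl⟩; exact hdδ p⟩⟩
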